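/- Let $\mathbb{H}$ be the Heisenberg group, i.e. $\mathbb{R}^3$ with $x\cdot y=(x_1+y_1,\,x_2+y_2,\,x_3+y_3+\tfrac12(x_1y_2-x_2y_1))$, let $X_1=\partial_{x_1}-\tfrac12x_2\partial_{x_3}$, $X_2=\partial_{x_2}+\tfrac12x_1\partial_{x_3}$, let $\nabla=(X_1,X_2)$ be the sub-gradient with $|\nabla f|=((X_1f)^2+(X_2f)^2)^{1/2}$, and let $d(x)$ be the Carnot–Carathéodory distance from $x$ to the identity $0$: the infimum of $\int_0^1(a_1^2+a_2^2)^{1/2}\,ds$ over Lipschitz curves $\gamma:[0,1]\to\mathbb{H}$ joining $x$ to $0$ with $\gamma'=a_1X_1(\gamma)+a_2X_2(\gamma)$ almost everywhere, $a_1,a_2$ measurable. Let $N\ge1$ and $\Omega=\mathbb{H}^{\mathbb{Z}^N}$; write $i\sim j$ if $\sum_l|i_l-j_l|=1$. For $x\in\mathbb{H}$, $i\in\mathbb{Z}^N$, $\omega\in\Omega$ let $x\bullet_i\omega$ be the configuration with $i$-th coordinate $x$ and all other coordinates those of $\omega$. A function $f:\Omega\to\mathbb{R}$ is called $C^n$ (smooth)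 if $x\mapsto f(x\bullet_i\omega)$ is $C^n$ ($C^\infty$) on $\mathbb{H}$ for all $i,\omega$; put $\nabla_if(\omega)=\nabla\big(f(\cdot\bullet_i\omega)\big)(\omega_i)$. Let $(\phi_{\{i,j\}})_{i\sim j}$ be $C^2$ functions on $\Omega$, $\phi_{\{i,j\}}$ depending only on the coordinates $i,j$, with $\|\phi_{\{i,j\}}\|_\infty\le M$ and $\|\nabla_i\nabla_j\phi_{\{i,j\}}\|_\infty\le M$ for all $i\sim j$ and some $M\in(0,\infty)$. Let $p\ge2$, $\frac1p+\frac1q=1$, $\alpha>0$, $\varepsilon,\rho,\theta\in\mathbb{R}$ with $\varepsilon\rho>0$, and $\varepsilon>-\frac{\alpha}{2N}$ if $p=2$. For $i\in\mathbb{Z}^N$ and $\omega\in\Omega$ let $$U_i^\omega(x)=\alpha\, d(x)^p+\varepsilon\sum_{j\sim i}\big(d(x)+\rho\, d(\omega_j)\big)^2+\theta\sum_{j\sim i}\phi_{\{i,j\}}(x\bullet_i\omega),\qquad \mathbb{E}_i^\omega(dx)=\frac{e^{-U_i^\omega(x)}}{\int_{\mathbb{H}}e^{-U_i^\omega(y)}dy}\,dx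 ,$$ and for $g:\Omega\to\mathbb{R}$ write $\mathbb{E}_i^\omega(g)=\int g(x\bullet_i\omega)\,\mathbb{E}_i^\omega(dx)$. Then every $\mathbb{E}_i^\omega$ is a well-defined probability measure, and there is a constant $c\in(0,\infty)$, independent of $i$ and of the boundary condition $\omega$, such that for all $i$, all $\omega$ and all smooth $f:\Omega\to\mathbb{R}$ $$\mathbb{E}_i^\omega\Big(|f|^q\log\frac{|f|^q}{\mathbb{E}_i^\omega|f|^q}\Big)\le c\,\mathbb{E}_i^\omega\big(|\nabla_if|^q\big).$$ Here, whenever the right-hand side is finite, $|f|^q$ and $|f|^q\log\big(|f|^q/\mathbb{E}_i^\omega|f|^q\big)$ are $\mathbb{E}_i^\omega$-integrable; when it is infinite, nothing is claimed. -/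

import Mathlib

open MeasureTheory

noncomputable section

/-- The underlying manifold `ℝ³` of the Heisenberg group, with coordinates
`x.1`, `x.2.1`, `x.2.2`. The group law is
`x · y = (x₁ + y₁, x₂ + y₂, x₃ + y₃ + (x₁ y₂ - x₂ y₁) / 2)`, the identity is `0`, and the Haar
measure is Lebesgue measure `volume`. -/
abbrev Heis : Type := ℝ × ℝ × ℝ

namespace Heis

/-- The left invariant vector field `X₁ = ∂₁ - (x₂ / 2) ∂₃`. -/
def X₁ (x : Heis) : Heis := (1, 0, -(x.2.1 / 2))

/-- The left invariant vector field `X₂ = ∂₂ + (x₁ / 2) ∂₃`. -/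
def X₂ (x : Heis) : Heis := (0, 1, x.1 / 2)

/-- The horizontal frame `(X₁, X₂)`. -/
def X (k : Fin 2) : Heis → Heis := ![X₁, X₂] k

/-- The derivative `X_k f` of a function along the vector field `X_k`. -/
def lieDeriv (k : Fin 2) (f : Heis → ℝ) (x : Heis) : ℝ := fderiv ℝ f x (X k x)

/-- `γ : [0,1] → ℍ` is an admissible curve from `x` to `y` with coefficients `a₁, a₂`:
it is Lipschitz and `γ' = a₁ X₁(γ) + a₂ X₂(γ)` almost everywhere, `a₁, a₂` measurable. -/
structure IsAdmissible (x y : Heis) (γ : ℝ → Heis) (a₁ a₂ : ℝ → ℝ) : Prop where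
  lipschitz : ∃ K, LipschitzOnWith K γ (Set.Icc 0 1)
  measurable₁ : Measurable a₁
  measurable₂ : Measurable a₂
  deriv : ∀ᵐ s ∂(volume.restrict (Set.Icc (0 : ℝ) 1)),
    HasDerivAt γ (a₁ s • X₁ (γ s) + a₂ s • X₂ (γ s)) s
  source : γ 0 = x
  target : γ 1 = y

/-- The Carnot–Carathéodory distance: infimum of the lengths of admissible curves. -/
def ccDist (x y : Heis) : ℝ :=
  sInf {l : ℝ | ∃ γ a₁ a₂, IsAdmissible x y γ a₁ a₂ ∧
    l = ∫ s in (0 : ℝ)..1, Real.sqrt (a₁ s ^ 2 + a₂ s ^ 2)}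

/-- `d(x) = d(x, e)`, the distance to the identity. -/
def d (x : Heis) : ℝ := ccDist x 0

end Heis

/-- The sites of the lattice `ℤ^N`. -/
abbrev Site (N : ℕ) : Type := Fin N → ℤ

namespace Site

variable {N : ℕ}

/-- The `ℓ¹` lattice metric. -/
def dist1 (i j : Site N) : ℤ := ∑ l, |i l - j l|

/-- The finite set of nearest neighbours of `i`, i.e. of all `j` with `dist1 i j = 1`
(see `mem_neighbors`). -/
def neighbors (i : Site N) : Finset (Site N) :=
  {j ∈ Finset.Icc (i - 1) (i + 1) | dist1 i j = 1}

theorem mem_neighbors {i j : Site N} : j ∈ neighbors i ↔ dist1 i j = 1 := by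
  simp only [neighbors, Finset.mem_filter, Finset.mem_Icc, and_iff_right_iff_imp]
  intro h
  have key : ∀ l, |i l - j l| ≤ 1 := fun l => by
    rw [← h]
    exact Finset.single_le_sum (f := fun l => |i l - j l|) (fun _ _ => abs_nonneg _)
      (Finset.mem_univ l)
  refine ⟨fun l => ?_, fun l => ?_⟩ <;>
    · have := abs_le.mp (key l)
      simp only [Pi.sub_apply, Pi.add_apply, Pi.one_apply]
      omega

end Site

/-- The configuration space `Ω = ℍ^(ℤ^N)`. -/
abbrev Config (N : ℕ) : Type := Site N → Heis

namespace Config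

variable {N : ℕ}

/-- The configuration `x •ᵢ ω`: coordinate `i` is `x`, all others are those of `ω`. -/
def glue (i : Site N) (x : Heis) (ω : Config N) : Config N := Function.update ω i x

/-- `f ∈ C^(n)(Ω)`: every `fᵢ(·|ω) = f(· •ᵢ ω)` is of class `C^n` on `ℍ`. -/
def IsC (n : WithTop ℕ∞) (f : Config N → ℝ) : Prop :=
  ∀ (i : Site N) (ω : Config N), ContDiff ℝ n (fun x => f (glue i x ω))

/-- `X_{i,k} f(ω) = X_k fᵢ(x|ω)` at `x = ωᵢ`. -/
def siteDeriv (i : Site N) (k : Fin 2) (f : Config N → ℝ) (ω : Config N) : ℝ :=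
  Heis.lieDeriv k (fun x => f (glue i x ω)) (ω i)

/-- `|∇ᵢ f|(ω)`, the Euclidean length of `∇ᵢ f = (X_{i,1} f, X_{i,2} f)`. -/
def siteGradNorm (i : Site N) (f : Config N → ℝ) (ω : Config N) : ℝ :=
  Real.sqrt (∑ k, siteDeriv i k f ω ^ 2)

/-- `Φ = (φ_{i,j})`, indexed by unordered pairs of nearest neighbours, is a bounded potential of
range 1: each `φ_{i,j}` is `C²`, localised in `{i,j}`, and `φ_{i,j}` and `∇ᵢ∇ⱼ φ_{i,j}` are
bounded uniformly in `i ∼ j`. (The values of `φ` on other pairs are never used.) -/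
def IsBoundedPotential (φ : Sym2 (Site N) → Config N → ℝ) : Prop :=
  ∃ M : ℝ, 0 < M ∧ ∀ i j : Site N, Site.dist1 i j = 1 →
    IsC 2 (φ s(i, j)) ∧
    DependsOn (φ s(i, j)) {i, j} ∧
    (∀ ω, |φ s(i, j) ω| ≤ M) ∧
    ∀ ω k l, |siteDeriv i k (siteDeriv j l (φ s(i, j))) ω| ≤ M

/-- The single-site energy
`U_i^ω(x) = α d(x)^p + ε ∑_{j ∼ i} (d(x) + ρ d(ω_j))² + θ ∑_{j ∼ i} φ_{i,j}(x, ω_j)`. -/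
def energy (α p ε ρ θ : ℝ) (φ : Sym2 (Site N) → Config N → ℝ)
    (i : Site N) (ω : Config N) (x : Heis) : ℝ :=
  α * Heis.d x ^ p
    + ε * ∑ j ∈ Site.neighbors i, (Heis.d x + ρ * Heis.d (ω j)) ^ 2
    + θ * ∑ j ∈ Site.neighbors i, φ s(i, j) (glue i x ω)

/-- The single-site measure `E_i^ω(dx) = e^{-U_i^ω(x)} dx / ∫ e^{-U_i^ω}` on `ℍ`. -/
def siteMeasure (α p ε ρ θ : ℝ) (φ : Sym2 (Site N) → Config N → ℝ)
    (i : Site N) (ω : Config N) : Measure Heis :=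
  (volume : Measure Heis).tilted (fun x => -energy α p ε ρ θ φ i ω x)

end Config

end

/-!
Expanding the squares turns `U_i^ω` into `α d ^ p + κ d ^ 2 + L d + B` up to an additive constant,
with `κ` and `B` bounded uniformly in `i` and `ω`, but with an unbounded `L ≥ 0`. So `U_i^ω`
behaves like a radial potential whose slope is comparable to `H = L + (1 + d) ^ (p - 1)`, and what
is needed is a logarithmic Sobolev inequality with a constant that does not depend on `L`.

Everything is done at the natural length scale `1 / H`, on which `e^{-U}` varies by bounded factors.
Joining `x` to `x ⋆ v` by flows of `X₁` and `X₂`, with commutators for the central direction, bounds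
the oscillation of `f` at scale `λ / H` by `∫ |∇ f|^q e^{-U}`. Moving towards the identity by a
large multiple of `1 / H` increases `e^{-U}` by a large factor, so that the part of
`∫ |f - m|^q H^q e^{-U}` far from the identity is absorbed into the part nearer to it; near the
identity `f` is compared with its average. This gives the weighted Poincaré inequality
`∫ |f - m|^q H^q e^{-U} ≤ C ∫ |∇ f|^q e^{-U}`.

In the entropy of `|f - m|^q`, the logarithm of the density contributes `U + log ∫ e^{-U}`, which is
of order `H^q` because `(p - 1) (q - 1) = 1`, and so is controlled by the weighted Poincaré
inequality. The logarithm of `|f - m|^q e^{-U}` is decomposed dyadically, each level being treated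
by the oscillation bound at a scale smaller than `1 / H` that depends on the level. Finally `f - m`
is recentred to `f`, using `q ≤ 2`.
-/

noncomputable section

/-! ### Real and measure-theoretic inequalities -/

section Radial

variable {p s t : ℝ}

theorem rpow_mul_sub_le (hp : 1 ≤ p) (hs : 0 ≤ s) (hst : s ≤ t) :
    t ^ (p - 1) * (t - s) ≤ t ^ p - s ^ p := by
  have mul_base (u : ℝ) (hu : 0 ≤ u) : u ^ p = u ^ (p - 1) * u := by
    conv_rhs => rw [← Real.rpow_one u, ← Real.rpow_mul hu, one_mul]
    rw [← Real.rpow_add_of_nonneg hu (by linarith) zero_le_one, sub_add_cancel]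
  have monotone : s ^ (p - 1) * s ≤ t ^ (p - 1) * s := by gcongr
  rw [mul_base t (hs.trans hst), mul_base s hs]
  linarith

theorem rpow_sub_rpow_le (hp : 1 ≤ p) (hs : 0 ≤ s) (hst : s ≤ t) :
    t ^ p - s ^ p ≤ p * (t ^ (p - 1) * (t - s)) := by
  rcases (hs.trans hst).eq_or_lt with rfl | t_pos
  · simp [hst.antisymm hs]
  have bernoulli := one_add_mul_self_le_rpow_one_add (s := s / t - 1)
    (by linarith [div_nonneg hs t_pos.le]) hp
  rw [add_sub_cancel, Real.div_rpow hs t_pos.le, le_div_iff₀ (by positivity)] at bernoulli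
  have mul_ratio : t ^ p * (s / t) = t ^ (p - 1) * s := by
    rw [Real.rpow_sub_one t_pos.ne']
    ring
  have mul_one' : t ^ p = t ^ (p - 1) * t := by
    rw [Real.rpow_sub_one t_pos.ne', div_mul_cancel₀ _ t_pos.ne']
  linear_combination bernoulli - p * mul_ratio + p * mul_one'

theorem one_add_rpow_mul_sub_le (hp : 1 ≤ p) (hs : 0 ≤ s) (hst : s ≤ t) :
    (1 + t) ^ (p - 1) * (t - s) ≤ 2 ^ (p - 1) * (t ^ p - s ^ p + 1) := by
  have t_nonneg := hs.trans hst
  have exponent_nonneg : 0 ≤ p - 1 := by linarith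
  rcases le_total 1 t with ht | ht
  · calc (1 + t) ^ (p - 1) * (t - s) ≤ (2 * t) ^ (p - 1) * (t - s) := by
          gcongr
          linarith
      _ = 2 ^ (p - 1) * (t ^ (p - 1) * (t - s)) := by
          rw [Real.mul_rpow two_pos.le t_nonneg, mul_assoc]
      _ ≤ 2 ^ (p - 1) * (t ^ p - s ^ p + 1) := by
          gcongr
          linarith [rpow_mul_sub_le hp hs hst]
  · have monotone : s ^ p ≤ t ^ p := by gcongr
    calc (1 + t) ^ (p - 1) * (t - s) ≤ 2 ^ (p - 1) * 1 := by
          gcongr <;> linarith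
      _ ≤ 2 ^ (p - 1) * (t ^ p - s ^ p + 1) := by
          gcongr
          linarith

theorem exists_sq_sub_sq_le (hp : 2 < p) {δ : ℝ} (hδ : 0 < δ) :
    ∃ C : ℝ, 0 ≤ C ∧ ∀ s t : ℝ, 0 ≤ s → s ≤ t → t ^ 2 - s ^ 2 ≤ δ * (t ^ p - s ^ p) + C := by
  obtain ⟨R, hR⟩ := Filter.eventually_atTop.1
    ((tendsto_rpow_atTop (y := p - 2) (by linarith)).eventually_ge_atTop (2 / δ))
  refine ⟨R ^ 2, sq_nonneg R, fun s t hs hst => ?_⟩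
  have t_nonneg := hs.trans hst
  have power_le := rpow_mul_sub_le (by linarith : 1 ≤ p) hs hst
  have slope_nonneg : 0 ≤ t * (t - s) := mul_nonneg t_nonneg (by linarith)
  rcases le_or_gt R t with ht | ht
  · have slope_le : 2 * t ≤ δ * t ^ (p - 1) := by
      rw [show p - 1 = (p - 2) + 1 by ring,
        Real.rpow_add_of_nonneg t_nonneg (by linarith) zero_le_one, Real.rpow_one]
      have := (div_le_iff₀' hδ).1 (hR t ht)
      nlinarith
    calc t ^ 2 - s ^ 2 ≤ 2 * t * (t - s) := by nlinarith
      _ ≤ δ * t ^ (p - 1) * (t - s) := by gcongr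
      _ ≤ δ * (t ^ p - s ^ p) := by rw [mul_assoc]; gcongr
      _ ≤ δ * (t ^ p - s ^ p) + R ^ 2 := le_add_of_nonneg_right (sq_nonneg R)
  · have power_nonneg : 0 ≤ t ^ p - s ^ p := sub_nonneg.2 (by gcongr)
    nlinarith [mul_nonneg hδ.le power_nonneg]

/- For `p > 2` the quadratic term is of lower order; for `p = 2` it only changes the leading
coefficient. -/
theorem exists_mul_rpow_sub_le {α K c₀ : ℝ} (hp : 2 ≤ p) (hα : 0 < α) (hK : 0 ≤ K)
    (hc₀ : p = 2 → 0 < c₀) :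
    ∃ b C : ℝ, 0 < b ∧ 0 ≤ C ∧ ∀ κ : ℝ, |κ| ≤ K → (p = 2 → c₀ ≤ α + κ) →
      ∀ s t : ℝ, 0 ≤ s → s ≤ t →
        b * (t ^ p - s ^ p) - C ≤ α * (t ^ p - s ^ p) + κ * (t ^ 2 - s ^ 2) := by
  rcases hp.eq_or_lt with rfl | hp
  · refine ⟨c₀, 0, hc₀ rfl, le_rfl, fun κ _ hκ s t hs hst => ?_⟩
    have sq_nonneg : 0 ≤ t ^ 2 - s ^ 2 := by nlinarith
    simp only [Real.rpow_two]
    linarith [mul_le_mul_of_nonneg_right (hκ rfl) sq_nonneg]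
  · obtain ⟨C, C_nonneg, sq_le⟩ := exists_sq_sub_sq_le hp (δ := α / (2 * (K + 1))) (by positivity)
    refine ⟨α / 2, (K + 1) * C, by positivity, by positivity, fun κ hκ _ s t hs hst => ?_⟩
    have sq_nonneg : 0 ≤ t ^ 2 - s ^ 2 := by nlinarith
    have perturbation_le : -κ * (t ^ 2 - s ^ 2) ≤ α / 2 * (t ^ p - s ^ p) + (K + 1) * C := by
      calc -κ * (t ^ 2 - s ^ 2) ≤ (K + 1) * (t ^ 2 - s ^ 2) := by
            gcongr
            linarith [(abs_le.1 hκ).1]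
        _ ≤ (K + 1) * (α / (2 * (K + 1)) * (t ^ p - s ^ p) + C) := by
            gcongr
            exact sq_le s t hs hst
        _ = α / 2 * (t ^ p - s ^ p) + (K + 1) * C := by field_simp
    linarith

theorem exists_radial_lower {α K c₀ : ℝ} (hp : 2 ≤ p) (hα : 0 < α) (hK : 0 ≤ K)
    (hc₀ : p = 2 → 0 < c₀) :
    ∃ c C : ℝ, 0 < c ∧ c ≤ 1 ∧ ∀ κ : ℝ, |κ| ≤ K → (p = 2 → c₀ ≤ α + κ) →
      ∀ s t : ℝ, 0 ≤ s → s ≤ t →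
        c * ((1 + t) ^ (p - 1) * (t - s)) - C ≤ α * (t ^ p - s ^ p) + κ * (t ^ 2 - s ^ 2) := by
  obtain ⟨b, C, b_pos, -, lower⟩ := exists_mul_rpow_sub_le hp hα hK hc₀
  refine ⟨min 1 (b / 2 ^ (p - 1)), b + C, lt_min one_pos (by positivity), min_le_left _ _,
    fun κ hκ hκ₀ s t hs hst => ?_⟩
  have slope_nonneg : 0 ≤ (1 + t) ^ (p - 1) * (t - s) :=
    mul_nonneg (Real.rpow_nonneg (by linarith) _) (by linarith)
  have slope_le : min 1 (b / 2 ^ (p - 1)) * ((1 + t) ^ (p - 1) * (t - s)) ≤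
      b * (t ^ p - s ^ p + 1) := by
    calc min 1 (b / 2 ^ (p - 1)) * ((1 + t) ^ (p - 1) * (t - s))
        ≤ b / 2 ^ (p - 1) * (2 ^ (p - 1) * (t ^ p - s ^ p + 1)) := by
          exact mul_le_mul (min_le_right _ _) (one_add_rpow_mul_sub_le (by linarith) hs hst)
            slope_nonneg (by positivity)
      _ = b * (t ^ p - s ^ p + 1) := by field_simp
  linarith [lower κ hκ hκ₀ s t hs hst]

theorem radial_upper {α K κ : ℝ} (hp : 2 ≤ p) (hα : 0 ≤ α) (hκ : |κ| ≤ K) (hs : 0 ≤ s)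
    (hst : s ≤ t) :
    α * (t ^ p - s ^ p) + κ * (t ^ 2 - s ^ 2) ≤
      (α * p + 2 * K) * ((1 + t) ^ (p - 1) * (t - s)) := by
  have t_nonneg := hs.trans hst
  have exponent_nonneg : 0 ≤ p - 1 := by linarith
  have sub_nonneg : 0 ≤ t - s := by linarith
  have power_le : t ^ p - s ^ p ≤ p * ((1 + t) ^ (p - 1) * (t - s)) := by
    refine (rpow_sub_rpow_le (by linarith) hs hst).trans ?_
    gcongr
    linarith
  have base_le : 1 + t ≤ (1 + t) ^ (p - 1) :=
    Real.self_le_rpow_of_one_le (by linarith) (by linarith)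
  have sq_le : t ^ 2 - s ^ 2 ≤ 2 * ((1 + t) ^ (p - 1) * (t - s)) := by nlinarith
  have sq_nonneg : 0 ≤ t ^ 2 - s ^ 2 := by nlinarith
  calc α * (t ^ p - s ^ p) + κ * (t ^ 2 - s ^ 2)
      ≤ α * (p * ((1 + t) ^ (p - 1) * (t - s))) + K * (2 * ((1 + t) ^ (p - 1) * (t - s))) := by
        gcongr
        · exact (abs_nonneg κ).trans hκ
        · exact (abs_le.1 hκ).2
    _ = (α * p + 2 * K) * ((1 + t) ^ (p - 1) * (t - s)) := by ring

end Radial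

theorem rpow_lintegral_enorm_le {α : Type*} [MeasurableSpace α] {μ : Measure α} {f : α → ℝ}
    {q : ℝ} (hq : 1 ≤ q) (hf : AEStronglyMeasurable f μ) :
    (∫⁻ a, ‖f a‖ₑ ∂μ) ^ q ≤ μ Set.univ ^ (q - 1) * ∫⁻ a, ‖f a‖ₑ ^ q ∂μ := by
  have q_pos : 0 < q := by linarith
  have holder := eLpNorm'_le_eLpNorm'_mul_rpow_measure_univ one_pos hq hf
  simp only [eLpNorm', ENNReal.rpow_one, div_one] at holder
  refine (ENNReal.rpow_le_rpow holder q_pos.le).trans_eq ?_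
  rw [ENNReal.mul_rpow_of_nonneg _ _ q_pos.le, ← ENNReal.rpow_mul, ← ENNReal.rpow_mul,
    one_div_mul_cancel q_pos.ne', ENNReal.rpow_one, sub_mul, one_div_mul_cancel q_pos.ne', one_mul,
    mul_comm]

/-- The truncation of `t` to the interval `[-R, R]`. -/
def clip (R t : ℝ) : ℝ := max (-R) (min R t)

theorem lipschitzWith_clip (R : ℝ) : LipschitzWith 1 (clip R) :=
  (LipschitzWith.id.const_min R).const_max (-R)

theorem clip_of_abs_le {R t : ℝ} (h : |t| ≤ R) : clip R t = t := by
  rw [clip, min_eq_right (abs_le.1 h).2, max_eq_right (abs_le.1 h).1]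

theorem abs_clip_le {R : ℝ} (hR : 0 ≤ R) (t : ℝ) : |clip R t| ≤ R :=
  abs_le.2 ⟨le_max_left _ _, max_le (by linarith) (min_le_left _ _)⟩

theorem abs_clip_le_abs {R : ℝ} (hR : 0 ≤ R) (t : ℝ) : |clip R t| ≤ |t| := by
  simpa [Real.dist_eq, clip_of_abs_le (t := 0) (by simpa)] using
    (lipschitzWith_clip R).dist_le_mul t 0

theorem lintegral_mul_enorm_rpow_le_of_clip {α : Type*} [MeasurableSpace α] {μ : Measure α}
    {w : α → ENNReal} {g : α → ℝ} {q : ℝ} {b : ENNReal} (hw : Measurable w) (hg : Measurable g)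
    (h : ∀ n : ℕ, ∫⁻ x, w x * ‖clip n (g x)‖ₑ ^ q ∂μ ≤ b) :
    ∫⁻ x, w x * ‖g x‖ₑ ^ q ∂μ ≤ b := by
  have eventually_eq (x : α) : (fun n : ℕ => w x * ‖clip n (g x)‖ₑ ^ q) =ᶠ[Filter.atTop]
      fun _ => w x * ‖g x‖ₑ ^ q := by
    obtain ⟨n₀, hn₀⟩ := exists_nat_ge |g x|
    filter_upwards [Filter.eventually_ge_atTop n₀] with n hn
    rw [clip_of_abs_le (hn₀.trans (by exact_mod_cast hn))]
  calc ∫⁻ x, w x * ‖g x‖ₑ ^ q ∂μ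
      = ∫⁻ x, Filter.liminf (fun n : ℕ => w x * ‖clip n (g x)‖ₑ ^ q) Filter.atTop ∂μ :=
        lintegral_congr fun x => by
          rw [Filter.liminf_congr (eventually_eq x), Filter.liminf_const]
    _ ≤ Filter.liminf (fun n : ℕ => ∫⁻ x, w x * ‖clip n (g x)‖ₑ ^ q ∂μ) Filter.atTop :=
        lintegral_liminf_le fun n => hw.mul
          ((((lipschitzWith_clip n).continuous.measurable.comp hg).enorm).pow_const q)
    _ ≤ Filter.liminf (fun _ : ℕ => b) Filter.atTop :=
        Filter.liminf_le_liminf (.of_forall h)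
    _ = b := Filter.liminf_const _

open InformationTheory (klFun)

section ScalarEntropy

theorem klFun_le_sub_one_sq {u : ℝ} (hu : 0 ≤ u) : klFun u ≤ (u - 1) ^ 2 := by
  rcases hu.eq_or_lt with rfl | u_pos
  · simp [InformationTheory.klFun_zero]
  · rw [InformationTheory.klFun_apply]
    linarith [mul_le_mul_of_nonneg_left (Real.log_le_sub_one_of_pos u_pos) hu]

theorem klFun_one_add_rpow_le {u q : ℝ} (hq : 0 ≤ q) (hq2 : q ≤ 2) (hu : |u| ≤ 1) :
    klFun ((1 + u) ^ q) ≤ 9 * |u| ^ q := by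
  have base_nonneg : 0 ≤ 1 + u := by linarith [(abs_le.1 hu).1]
  have near_one : |(1 + u) ^ q - 1| ≤ 3 * |u| := by
    rcases le_total 0 u with hu0 | hu0
    · have one_le : 1 ≤ (1 + u) ^ q := Real.one_le_rpow (by linarith) hq
      have le_sq : (1 + u) ^ q ≤ (1 + u) ^ (2 : ℝ) :=
        Real.rpow_le_rpow_of_exponent_le (by linarith) hq2
      rw [Real.rpow_two] at le_sq
      rw [abs_of_nonneg hu0] at hu ⊢
      rw [abs_of_nonneg (by linarith)]
      nlinarith
    · have le_one : (1 + u) ^ q ≤ 1 := Real.rpow_le_one base_nonneg (by linarith) hq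
      have sq_le : (1 + u) ^ (2 : ℝ) ≤ (1 + u) ^ q :=
        Real.rpow_le_rpow_of_exponent_ge' base_nonneg (by linarith) hq hq2
      rw [Real.rpow_two] at sq_le
      rw [abs_of_nonpos hu0, abs_of_nonpos (by linarith)]
      nlinarith
  have sq_le_rpow : |u| ^ (2 : ℝ) ≤ |u| ^ q :=
    Real.rpow_le_rpow_of_exponent_ge' (abs_nonneg u) hu hq hq2
  calc klFun ((1 + u) ^ q) ≤ |(1 + u) ^ q - 1| ^ 2 := by
        rw [sq_abs]
        exact klFun_le_sub_one_sq (Real.rpow_nonneg base_nonneg q)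
    _ ≤ (3 * |u|) ^ 2 := by gcongr
    _ = 9 * |u| ^ (2 : ℝ) := by rw [Real.rpow_two]; ring
    _ ≤ 9 * |u| ^ q := by gcongr

theorem rpow_mul_klFun_div_le {m y q : ℝ} (hq : 0 ≤ q) (hq2 : q ≤ 2) (hm : m ≠ 0)
    (hy : |y| ≤ |m|) : |m| ^ q * klFun (|m + y| ^ q / |m| ^ q) ≤ 9 * |y| ^ q := by
  have m_pos : 0 < |m| := abs_pos.2 hm
  have ratio_le : |y / m| ≤ 1 := by rwa [abs_div, div_le_one m_pos]
  have ratio_eq : |m + y| / |m| = 1 + y / m := by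
    rw [← abs_div, add_div, div_self hm, abs_of_nonneg (by linarith [(abs_le.1 ratio_le).1])]
  calc |m| ^ q * klFun (|m + y| ^ q / |m| ^ q) = |m| ^ q * klFun ((1 + y / m) ^ q) := by
        rw [← Real.div_rpow (abs_nonneg _) m_pos.le, ratio_eq]
    _ ≤ |m| ^ q * (9 * |y / m| ^ q) := by
        gcongr
        exact klFun_one_add_rpow_le hq hq2 ratio_le
    _ = 9 * |y| ^ q := by
        rw [abs_div, Real.div_rpow (abs_nonneg _) m_pos.le]
        field_simp

theorem max_mul_log_max_div {a t : ℝ} (ha : 0 ≤ a) (ht : 0 < t) :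
    max a t * Real.log (max a t / t) = a * Real.posLog (a / t) := by
  have ratio_abs : |a / t| = a / t := abs_of_nonneg (by positivity)
  rcases le_total a t with hat | hat
  · rw [max_eq_right hat, div_self ht.ne', Real.log_one, mul_zero,
      (Real.posLog_eq_zero_iff _).2 (ratio_abs.trans_le ((div_le_one ht).2 hat)), mul_zero]
  · rw [max_eq_left hat, Real.posLog_eq_log (((one_le_div ht).2 hat).trans_eq ratio_abs.symm)]

theorem mul_klFun_div_le_of_le_max {F a s t : ℝ} (hF : 0 ≤ F) (ha : 0 ≤ a) (ht : 0 < t)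
    (hts : t ≤ s) (hs : s ≤ max a t) (hFa : F ≤ 4 * max a t) :
    s * klFun (F / s) ≤ 9 * (t + a + a * Real.posLog (a / t)) := by
  have s_pos : 0 < s := ht.trans_le hts
  have max_pos : 0 < max a t := s_pos.trans_le hs
  have max_le : max a t ≤ t + a := max_le (by linarith) (by linarith)
  have posLog_nonneg := mul_nonneg ha (Real.posLog_nonneg (x := a / t))
  have log_four : Real.log 4 ≤ 2 := by
    rw [show (4 : ℝ) = 2 ^ 2 by norm_num, Real.log_pow]
    norm_num
    linarith [Real.log_two_lt_d9]
  have log_max_nonneg : 0 ≤ Real.log (max a t / t) :=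
    Real.log_nonneg ((one_le_div ht).2 (le_max_right a t))
  have log_le : F * Real.log (F / s) ≤ 8 * max a t + 4 * (a * Real.posLog (a / t)) := by
    rcases hF.eq_or_lt with rfl | F_pos
    · linarith
    calc F * Real.log (F / s) ≤ F * Real.log (4 * (max a t / t)) := by
          rw [← mul_div_assoc]
          gcongr
      _ = F * (Real.log 4 + Real.log (max a t / t)) := by
          rw [Real.log_mul (by norm_num) (by positivity)]
      _ ≤ 4 * max a t * (2 + Real.log (max a t / t)) := by gcongr
      _ = 8 * max a t + 4 * (a * Real.posLog (a / t)) := by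
          rw [← max_mul_log_max_div ha ht]
          ring
  calc s * klFun (F / s) = F * Real.log (F / s) + s - F := by
        rw [InformationTheory.klFun_apply]
        field_simp
    _ ≤ 9 * (t + a + a * Real.posLog (a / t)) := by linarith

theorem abs_add_rpow_le_four_mul_max {m y q : ℝ} (hq : 0 ≤ q) (hq2 : q ≤ 2) :
    |m + y| ^ q ≤ 4 * max (|m| ^ q) (|y| ^ q) := by
  have two_rpow_le : (2 : ℝ) ^ q ≤ 4 := by
    calc (2 : ℝ) ^ q ≤ 2 ^ (2 : ℝ) := Real.rpow_le_rpow_of_exponent_le one_le_two hq2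
      _ = 4 := by norm_num
  calc |m + y| ^ q ≤ (2 * max |m| |y|) ^ q := by
        gcongr
        linarith [abs_add_le m y, le_max_left |m| |y|, le_max_right |m| |y|]
    _ = 2 ^ q * max (|m| ^ q) (|y| ^ q) := by
        rw [Real.mul_rpow two_pos.le (by positivity),
          (Real.monotoneOn_rpow_Ici_of_exponent_nonneg hq).map_max (abs_nonneg m) (abs_nonneg y)]
    _ ≤ 4 * max (|m| ^ q) (|y| ^ q) := by gcongr

theorem mul_klFun_abs_add_rpow_div_le {m y q t : ℝ} (hq : 0 < q) (hq2 : q ≤ 2) (ht : 0 < t) :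
    max (|m| ^ q) t * klFun (|m + y| ^ q / max (|m| ^ q) t) ≤
      9 * (t + |y| ^ q + |y| ^ q * Real.posLog (|y| ^ q / t)) := by
  have y_nonneg : 0 ≤ |y| ^ q := by positivity
  by_cases h : |y| ≤ |m| ∧ t ≤ |m| ^ q
  · have m_ne_zero : m ≠ 0 := by
      rintro rfl
      rw [abs_zero, Real.zero_rpow hq.ne'] at h
      exact ht.not_ge h.2
    rw [max_eq_left h.2]
    have := mul_nonneg y_nonneg (Real.posLog_nonneg (x := |y| ^ q / t))
    linarith [rpow_mul_klFun_div_le hq.le hq2 m_ne_zero h.1]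
  · have m_le : |m| ^ q ≤ max (|y| ^ q) t := by
      rcases le_or_gt |m| |y| with hy | hy
      · exact le_max_of_le_left (by gcongr)
      · exact le_max_of_le_right (not_le.1 fun ht => h ⟨hy.le, ht⟩).le
    refine mul_klFun_div_le_of_le_max (by positivity) y_nonneg ht (le_max_right _ _)
      (max_le m_le (le_max_right _ _)) ((abs_add_rpow_le_four_mul_max hq.le hq2).trans ?_)
    exact mul_le_mul_of_nonneg_left (max_le m_le (le_max_left _ _)) (by norm_num)

theorem ofReal_mul_klFun_rpow_div_le {m u q t : ℝ} (hq : 0 < q) (hq2 : q ≤ 2) (ht : 0 < t) :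
    ENNReal.ofReal (max (|m| ^ q) t * klFun (|u| ^ q / max (|m| ^ q) t)) ≤
      9 * (ENNReal.ofReal t + ‖u - m‖ₑ ^ q +
        ‖u - m‖ₑ ^ q * ENNReal.ofReal (Real.posLog (|u - m| ^ q / t))) := by
  have real_le := mul_klFun_abs_add_rpow_div_le (m := m) (y := u - m) hq hq2 ht
  rw [add_sub_cancel] at real_le
  have deviation_nonneg : 0 ≤ |u - m| ^ q := by positivity
  refine (ENNReal.ofReal_le_ofReal real_le).trans_eq ?_
  rw [Real.enorm_eq_ofReal_abs, ENNReal.ofReal_rpow_of_nonneg (abs_nonneg _) hq.le,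
    ENNReal.ofReal_mul (by norm_num), ENNReal.ofReal_add (by positivity)
      (mul_nonneg deviation_nonneg Real.posLog_nonneg), ENNReal.ofReal_add ht.le deviation_nonneg,
    ENNReal.ofReal_mul deviation_nonneg, ENNReal.ofReal_ofNat]

end ScalarEntropy

section Entropy

variable {α : Type*} [MeasurableSpace α] {μ : Measure α} {F : α → ℝ} {s : ℝ}

theorem mul_klFun_div {u : ℝ} (hs : 0 < s) :
    s * klFun (u / s) = u * Real.log (u / s) + s - u := by
  rw [InformationTheory.klFun_apply]
  field_simp

theorem integrable_of_integrable_klFun_div [IsFiniteMeasure μ] (hF : AEStronglyMeasurable F μ)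
    (hF0 : 0 ≤ F) (hs : 0 < s) (hint : Integrable (fun x => klFun (F x / s)) μ) :
    Integrable F μ := by
  refine ((hint.add (integrable_const (Real.exp 1))).const_mul s).mono' hF (.of_forall fun x => ?_)
  have ratio_nonneg : 0 ≤ F x / s := div_nonneg (hF0 x) hs.le
  have kl_nonneg := mul_nonneg (Real.exp_pos 1).le
    (InformationTheory.klFun_nonneg (div_nonneg ratio_nonneg (Real.exp_pos 1).le))
  have ratio_le : F x / s ≤ klFun (F x / s) + Real.exp 1 := by
    rcases ratio_nonneg.eq_or_lt with ratio_zero | ratio_pos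
    · rw [← ratio_zero, InformationTheory.klFun_zero]
      positivity
    · rw [mul_klFun_div (Real.exp_pos 1), Real.log_div ratio_pos.ne' (Real.exp_pos 1).ne',
        Real.log_exp] at kl_nonneg
      rw [InformationTheory.klFun_apply]
      linarith
  rw [Real.norm_of_nonneg (hF0 x)]
  exact (div_le_iff₀' hs).1 ratio_le

theorem entropy_le_of_integrable_klFun_div [IsProbabilityMeasure μ]
    (hF : AEStronglyMeasurable F μ) (hF0 : 0 ≤ F) (hs : 0 < s)
    (hint : Integrable (fun x => klFun (F x / s)) μ) :
    Integrable (fun x => F x * Real.log (F x / ∫ y, F y ∂μ)) μ ∧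
      ∫ x, F x * Real.log (F x / ∫ y, F y ∂μ) ∂μ ≤ s * ∫ x, klFun (F x / s) ∂μ := by
  have F_int := integrable_of_integrable_klFun_div hF hF0 hs hint
  set A := ∫ y, F y ∂μ
  have kl_nonneg : 0 ≤ s * ∫ x, klFun (F x / s) ∂μ := mul_nonneg hs.le
    (integral_nonneg fun x => InformationTheory.klFun_nonneg (div_nonneg (hF0 x) hs.le))
  have A_nonneg : 0 ≤ A := integral_nonneg hF0
  rcases A_nonneg.eq_or_lt with A_zero | A_pos
  · simp only [← A_zero, div_zero, Real.log_zero, mul_zero, integral_zero]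
    exact ⟨integrable_zero α ℝ μ, kl_nonneg⟩
  have entropy_eq (x : α) : F x * Real.log (F x / A) =
      s * klFun (F x / s) + F x * (1 - Real.log (A / s)) - s := by
    rw [mul_klFun_div hs]
    rcases (hF0 x).eq_or_lt with F_zero | F_pos
    · simp [← F_zero]
    · rw [Real.log_div F_pos.ne' A_pos.ne', Real.log_div F_pos.ne' hs.ne',
        Real.log_div A_pos.ne' hs.ne']
      ring
  have sum_int := (hint.const_mul s).add (F_int.mul_const (1 - Real.log (A / s)))
  simp only [entropy_eq]
  refine ⟨sum_int.sub (integrable_const s), ?_⟩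
  rw [integral_sub (by exact sum_int) (integrable_const s),
    integral_add (hint.const_mul s) (F_int.mul_const _), integral_const_mul, integral_mul_const,
    integral_const, probReal_univ, one_smul]
  have mean_nonneg := mul_nonneg hs.le
    (InformationTheory.klFun_nonneg (div_nonneg A_pos.le hs.le))
  rw [mul_klFun_div hs] at mean_nonneg
  linarith

theorem integrable_and_integral_le_of_lintegral_le (hF : AEStronglyMeasurable F μ) (hF0 : 0 ≤ F)
    {b : ℝ} (hb : 0 ≤ b) (h : ∫⁻ x, ENNReal.ofReal (F x) ∂μ ≤ ENNReal.ofReal b) :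
    Integrable F μ ∧ ∫ x, F x ∂μ ≤ b := by
  refine ⟨⟨hF, ?_⟩, ?_⟩
  · rw [hasFiniteIntegral_iff_ofReal (.of_forall hF0)]
    exact h.trans_lt ENNReal.ofReal_lt_top
  · rw [integral_eq_lintegral_of_nonneg_ae (.of_forall hF0) hF]
    exact ENNReal.toReal_le_of_le_ofReal hb h

theorem entropy_le_of_centered [IsProbabilityMeasure μ] {f : α → ℝ} {m q t A : ℝ}
    (hf : Measurable f) (hq : 0 < q) (hq2 : q ≤ 2) (ht : 0 < t) (hA : 0 ≤ A)
    (hmoment : ∫⁻ x, ‖f x - m‖ₑ ^ q ∂μ ≤ ENNReal.ofReal A)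
    (hentropy : ∫⁻ x, ‖f x - m‖ₑ ^ q * ENNReal.ofReal (Real.posLog (|f x - m| ^ q / t)) ∂μ ≤
      ENNReal.ofReal A) :
    Integrable (fun x => |f x| ^ q) μ ∧
      Integrable (fun x => |f x| ^ q * Real.log (|f x| ^ q / ∫ y, |f y| ^ q ∂μ)) μ ∧
      ∫ x, |f x| ^ q * Real.log (|f x| ^ q / ∫ y, |f y| ^ q ∂μ) ∂μ ≤ 9 * (t + 2 * A) := by
  set s := max (|m| ^ q) t
  have s_pos : 0 < s := ht.trans_le (le_max_right _ _)
  have power_meas : Measurable fun x => |f x| ^ q := by fun_prop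
  have power_nonneg : 0 ≤ fun x => |f x| ^ q := fun x => by positivity
  have kl_nonneg : 0 ≤ fun x => s * klFun (|f x| ^ q / s) := fun x =>
    mul_nonneg s_pos.le (InformationTheory.klFun_nonneg (by positivity))
  have kl_meas : Measurable fun x => s * klFun (|f x| ^ q / s) :=
    (InformationTheory.measurable_klFun.comp (power_meas.div_const s)).const_mul s
  have kl_lintegral_le : ∫⁻ x, ENNReal.ofReal (s * klFun (|f x| ^ q / s)) ∂μ ≤
      ENNReal.ofReal (9 * (t + 2 * A)) := by
    refine (lintegral_mono fun x => ofReal_mul_klFun_rpow_div_le hq hq2 ht).trans ?_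
    rw [lintegral_const_mul _ (by fun_prop), lintegral_add_left (by fun_prop),
      lintegral_add_left (by fun_prop), lintegral_const, measure_univ, mul_one,
      ENNReal.ofReal_mul (by norm_num), ENNReal.ofReal_ofNat, two_mul, ← add_assoc,
      ENNReal.ofReal_add (by positivity) hA, ENNReal.ofReal_add ht.le hA]
    gcongr
  obtain ⟨kl_int, kl_integral_le⟩ := integrable_and_integral_le_of_lintegral_le
    kl_meas.aestronglyMeasurable kl_nonneg (by positivity) kl_lintegral_le
  rw [integrable_const_mul_iff s_pos.ne'.isUnit] at kl_int
  rw [integral_const_mul] at kl_integral_le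
  obtain ⟨entropy_int, entropy_le⟩ := entropy_le_of_integrable_klFun_div
    power_meas.aestronglyMeasurable power_nonneg s_pos kl_int
  exact ⟨integrable_of_integrable_klFun_div power_meas.aestronglyMeasurable power_nonneg s_pos
    kl_int, entropy_int, entropy_le.trans kl_integral_le⟩

end Entropy

theorem tilted_add_const {α : Type*} [MeasurableSpace α] (μ : Measure α) (f : α → ℝ) (c : ℝ) :
    μ.tilted (fun x => f x + c) = μ.tilted f := by
  simp only [Measure.tilted, Real.exp_add, integral_mul_const,
    mul_div_mul_right _ _ (Real.exp_pos c).ne']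

namespace Heis

/-! ### The group and its horizontal curves -/

/-- The group law of the Heisenberg group, written `x ⋆ y` below: `Heis` already carries the
coordinatewise product of `ℝ × ℝ × ℝ`. The inverse of `x` is `-x` and the identity is `0`. -/
def hmul (x y : Heis) : Heis :=
  (x.1 + y.1, x.2.1 + y.2.1, x.2.2 + y.2.2 + (x.1 * y.2.1 - x.2.1 * y.1) / 2)

local infixl:70 " ⋆ " => hmul

theorem hmul_assoc (x y z : Heis) : x ⋆ y ⋆ z = x ⋆ (y ⋆ z) := by
  simp only [hmul, Prod.mk.injEq]
  exact ⟨by ring, by ring, by ring⟩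

theorem hmul_zero (x : Heis) : x ⋆ 0 = x := by simp [hmul]

theorem zero_hmul (x : Heis) : 0 ⋆ x = x := by simp [hmul]

theorem neg_hmul_self (x : Heis) : -x ⋆ x = 0 := by
  simp only [hmul, Prod.fst_neg, Prod.snd_neg, Prod.mk_eq_zero]
  exact ⟨by ring, by ring, by ring⟩

theorem hmul_neg_cancel (x y : Heis) : x ⋆ (-x ⋆ y) = y := by
  rw [← hmul_assoc, show x ⋆ -x = 0 by simpa using neg_hmul_self (-x), zero_hmul]

@[fun_prop]
theorem continuous_hmul {Y : Type*} [TopologicalSpace Y] {f g : Y → Heis} (hf : Continuous f)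
    (hg : Continuous g) : Continuous fun y => f y ⋆ g y := by
  unfold hmul; fun_prop

@[fun_prop]
theorem measurable_hmul {Y : Type*} [MeasurableSpace Y] {f g : Y → Heis} (hf : Measurable f)
    (hg : Measurable g) : Measurable fun y => f y ⋆ g y := by
  unfold hmul; fun_prop

theorem measurePreserving_shear (a b c e g : ℝ) : MeasurePreserving
    (fun x : Heis => ((x.1 + a, x.2.1 + b, x.2.2 + (c + e * x.1 + g * x.2.1)) : Heis)) := by
  have fiber (c : ℝ) : MeasurePreserving (fun y : ℝ × ℝ => (y.1 + b, y.2 + (c + g * y.1))) :=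
    (measurePreserving_add_right volume b).skew_product
      (g := fun s t => t + (c + g * s)) (by unfold Function.uncurry; fun_prop)
      (.of_forall fun s => (measurePreserving_add_right volume _).map_eq)
  exact (measurePreserving_add_right volume a).skew_product
    (g := fun x (y : ℝ × ℝ) => (y.1 + b, y.2 + (c + e * x + g * y.1)))
    (by unfold Function.uncurry; fun_prop) (.of_forall fun _ => (fiber _).map_eq)

theorem measurePreserving_hmul_right (y : Heis) : MeasurePreserving (fun x => x ⋆ y) := by
  convert! measurePreserving_shear y.1 y.2.1 y.2.2 (y.2.1 / 2) (-(y.1 / 2)) using 3 with x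
  simp only [hmul]
  ring_nf

theorem measurePreserving_hmul_left (x : Heis) : MeasurePreserving (fun y => x ⋆ y) := by
  convert! measurePreserving_shear x.1 x.2.1 x.2.2 (-(x.2.1 / 2)) (x.1 / 2) using 2 with y
  simp only [hmul, Prod.mk.injEq]
  exact ⟨by ring, by ring, by ring⟩

/-- The homogeneous norm `max (|v₁|, |v₂|, |v₃|^(1/2))`, comparable to the distance `d`. -/
def hnorm (v : Heis) : ℝ := max (max |v.1| |v.2.1|) (Real.sqrt |v.2.2|)

theorem hnorm_lt_iff {v : Heis} {r : ℝ} (hr : 0 < r) :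
    hnorm v < r ↔ |v.1| < r ∧ |v.2.1| < r ∧ |v.2.2| < r ^ 2 := by
  simp only [hnorm, max_lt_iff, Real.sqrt_lt' hr, and_assoc]

theorem hnorm_le_iff {v : Heis} {r : ℝ} (hr : 0 ≤ r) :
    hnorm v ≤ r ↔ |v.1| ≤ r ∧ |v.2.1| ≤ r ∧ |v.2.2| ≤ r ^ 2 := by
  simp only [hnorm, max_le_iff, Real.sqrt_le_left hr, and_assoc]

theorem hnorm_nonneg (v : Heis) : 0 ≤ hnorm v := le_max_of_le_right (Real.sqrt_nonneg _)

theorem abs_coord_le_hnorm (v : Heis) :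
    |v.1| ≤ hnorm v ∧ |v.2.1| ≤ hnorm v ∧ |v.2.2| ≤ hnorm v ^ 2 :=
  (hnorm_le_iff (hnorm_nonneg v)).1 le_rfl

theorem hnorm_neg (v : Heis) : hnorm (-v) = hnorm v := by simp [hnorm]

theorem hnorm_zero : hnorm 0 = 0 := by simp [hnorm]

@[fun_prop]
theorem continuous_hnorm : Continuous hnorm := by
  unfold hnorm; fun_prop

@[fun_prop]
theorem measurable_hnorm : Measurable hnorm := continuous_hnorm.measurable

theorem hnorm_hmul_le (v u : Heis) : hnorm (v ⋆ u) ≤ hnorm v + hnorm u := by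
  have hv := hnorm_nonneg v
  have hu := hnorm_nonneg u
  obtain ⟨v₁, v₂, v₃⟩ := abs_coord_le_hnorm v
  obtain ⟨u₁, u₂, u₃⟩ := abs_coord_le_hnorm u
  refine (hnorm_le_iff (by positivity)).2
    ⟨(abs_add_le _ _).trans (by gcongr), (abs_add_le _ _).trans (by gcongr), ?_⟩
  have cross₁ : |v.1 * u.2.1| ≤ hnorm v * hnorm u := by rw [abs_mul]; gcongr
  have cross₂ : |v.2.1 * u.1| ≤ hnorm v * hnorm u := by rw [abs_mul]; gcongr
  simp only [hmul]
  rw [abs_le] at *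
  constructor <;> nlinarith

theorem measurableSet_hnorm_lt (r : ℝ) : MeasurableSet {v : Heis | hnorm v < r} :=
  measurableSet_lt measurable_hnorm measurable_const

theorem volume_hnorm_lt {r : ℝ} (hr : 0 < r) :
    volume {v : Heis | hnorm v < r} = ENNReal.ofReal (8 * r ^ 4) := by
  have box : {v : Heis | hnorm v < r} =
      Metric.ball (0 : ℝ) r ×ˢ Metric.ball (0 : ℝ) r ×ˢ Metric.ball (0 : ℝ) (r ^ 2) := by
    ext v
    simp [hnorm_lt_iff hr]
  rw [box, Measure.volume_eq_prod, Measure.prod_prod, Measure.volume_eq_prod, Measure.prod_prod,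
    Real.volume_ball, Real.volume_ball, ← ENNReal.ofReal_mul (by positivity),
    ← ENNReal.ofReal_mul (by positivity)]
  ring_nf

/-- The one-parameter subgroup generated by `X k`. -/
def flow (k : Fin 2) (t : ℝ) : Heis := ![((t, 0, 0) : Heis), (0, t, 0)] k

@[fun_prop]
theorem continuous_flow (k : Fin 2) : Continuous (flow k) := by
  fin_cases k
  · change Continuous fun t : ℝ => ((t, 0, 0) : Heis)
    fun_prop
  · change Continuous fun t : ℝ => ((0, t, 0) : Heis)
    fun_prop

theorem hmul_flow (x : Heis) (k : Fin 2) (t : ℝ) : x ⋆ flow k t = x + t • X k x := by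
  fin_cases k <;> ext <;> simp [hmul, flow, X, X₁, X₂] <;> ring

theorem X_hmul_flow (x : Heis) (k : Fin 2) (t : ℝ) : X k (x ⋆ flow k t) = X k x := by
  fin_cases k <;> simp [hmul, flow, X, X₁, X₂]

theorem hmul_flow_neg (x : Heis) (k : Fin 2) (t : ℝ) : x ⋆ flow k t ⋆ flow k (-t) = x := by
  rw [hmul_flow, X_hmul_flow, hmul_flow, neg_smul, add_neg_cancel_right]

/-- A finite sequence of moves `(k, t)` along the one-parameter subgroups; it describes the
horizontal polygon that starts at the identity and follows the moves of the list from its last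
entry to its first. -/
abbrev Word : Type := List (Fin 2 × ℝ)

/-- The endpoint of the horizontal polygon described by a word. -/
def Word.endpoint : Word → Heis
  | [] => 0
  | (k, t) :: w => Word.endpoint w ⋆ flow k t

/-- The length of the horizontal polygon described by a word. -/
def Word.length : Word → ℝ
  | [] => 0
  | (_, t) :: w => Word.length w + |t|

theorem Word.length_nonneg (w : Word) : 0 ≤ Word.length w := by
  induction w with
  | nil => exact le_rfl
  | cons a w ih => exact add_nonneg ih (abs_nonneg _)

/-- The commutator of `flow 0 s` and `flow 1 t` is the central element `(0, 0, s * t)`, so six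
moves suffice. -/
theorem exists_word (v : Heis) : ∃ w : Word, w.endpoint = v ∧ Word.length w ≤ 10 * hnorm v := by
  obtain ⟨v₁, v₂, v₃⟩ := abs_coord_le_hnorm v
  have hn := hnorm_nonneg v
  set c := v.2.2 - v.1 * v.2.1 / 2 with hc
  have cross : |v.1 * v.2.1| ≤ hnorm v * hnorm v := by rw [abs_mul]; gcongr
  have sqrt_le : Real.sqrt |c| ≤ 2 * hnorm v := by
    rw [Real.sqrt_le_left (by positivity)]
    rw [abs_le] at *
    constructor <;> nlinarith
  obtain ⟨s, t, hst, hs, ht⟩ :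
      ∃ s t : ℝ, s * t = c ∧ |s| = Real.sqrt |c| ∧ |t| = Real.sqrt |c| := by
    have sqrt_sq : Real.sqrt |c| * Real.sqrt |c| = |c| := Real.mul_self_sqrt (abs_nonneg c)
    have abs_sqrt := abs_of_nonneg (Real.sqrt_nonneg |c|)
    rcases le_total 0 c with h | h
    · exact ⟨_, _, by rw [sqrt_sq, abs_of_nonneg h], abs_sqrt, abs_sqrt⟩
    · exact ⟨Real.sqrt |c|, -Real.sqrt |c|, by rw [mul_neg, sqrt_sq, abs_of_nonpos h, neg_neg],
        abs_sqrt, by rw [abs_neg, abs_sqrt]⟩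
  refine ⟨[(1, -t), (0, -s), (1, t), (0, s), (1, v.2.1), (0, v.1)], ?_, ?_⟩
  · simp only [Word.endpoint, hmul, flow, Matrix.cons_val_zero, Matrix.cons_val_one, Prod.fst_zero,
      Prod.snd_zero]
    refine Prod.ext (by ring) (Prod.ext (by ring) ?_)
    linear_combination hst - hc
  · simp only [Word.length, abs_neg]
    linarith

section Lipschitz

variable {f b g : ℝ → ℝ} {K : NNReal} {t : ℝ}

theorem ae_abs_le_of_lipschitzOnWith (hf : LipschitzOnWith K f (Set.Icc 0 1))
    (hb : ∀ᵐ s ∂(volume.restrict (Set.Icc (0 : ℝ) 1)), HasDerivAt f (b s) s) :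
    ∀ᵐ s ∂(volume.restrict (Set.Icc (0 : ℝ) 1)), |b s| ≤ K := by
  rw [← restrict_Ioo_eq_restrict_Icc] at hb ⊢
  filter_upwards [hb, ae_restrict_mem measurableSet_Ioo] with s hs hmem
  simpa [hs.deriv] using norm_deriv_le_of_lipschitzOn (Icc_mem_nhds hmem.1 hmem.2) hf

theorem integral_eq_sub_of_lipschitzOnWith (hf : LipschitzOnWith K f (Set.Icc 0 1))
    (hb : ∀ᵐ s ∂(volume.restrict (Set.Icc (0 : ℝ) 1)), HasDerivAt f (b s) s)
    (ht : t ∈ Set.Icc (0 : ℝ) 1) : ∫ s in (0 : ℝ)..t, b s = f t - f 0 := by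
  have hsub : Set.uIcc 0 t ⊆ Set.Icc (0 : ℝ) 1 := Set.uIcc_subset_Icc (by simp) ht
  rw [← (hf.mono hsub).absolutelyContinuousOnInterval.integral_deriv_eq_sub]
  refine intervalIntegral.integral_congr_ae ?_
  filter_upwards [(ae_restrict_iff' measurableSet_Icc).1 hb] with s hs hmem
  exact (hs (hsub (Set.uIoc_subset_uIcc hmem))).deriv.symm

theorem abs_sub_le_integral_of_lipschitzOnWith (hf : LipschitzOnWith K f (Set.Icc 0 1))
    (hb : ∀ᵐ s ∂(volume.restrict (Set.Icc (0 : ℝ) 1)), HasDerivAt f (b s) s)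
    (ht : t ∈ Set.Icc (0 : ℝ) 1) (hg : IntervalIntegrable g volume 0 t)
    (hbg : ∀ s ∈ Set.Icc 0 t, |b s| ≤ g s) : |f t - f 0| ≤ ∫ s in (0 : ℝ)..t, g s := by
  rw [← integral_eq_sub_of_lipschitzOnWith hf hb ht, ← Real.norm_eq_abs]
  exact intervalIntegral.norm_integral_le_of_norm_le ht.1
    (.of_forall fun s hs => hbg s ⟨hs.1.le, hs.2⟩) hg

end Lipschitz

section Speed

variable (a₁ a₂ : ℝ → ℝ) (s : ℝ)

/-- The speed, with respect to the orthonormal frame `(X₁, X₂)`, of a curve with coefficients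
`a₁, a₂`. -/
def speed : ℝ := Real.sqrt (a₁ s ^ 2 + a₂ s ^ 2)

theorem speed_nonneg : 0 ≤ speed a₁ a₂ s := Real.sqrt_nonneg _

theorem abs_fst_le_speed : |a₁ s| ≤ speed a₁ a₂ s :=
  Real.abs_le_sqrt (by nlinarith [sq_nonneg (a₂ s)])

theorem abs_snd_le_speed : |a₂ s| ≤ speed a₁ a₂ s :=
  Real.abs_le_sqrt (by nlinarith [sq_nonneg (a₁ s)])

theorem speed_le : speed a₁ a₂ s ≤ |a₁ s| + |a₂ s| := by
  refine Real.sqrt_le_iff.2 ⟨by positivity, ?_⟩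
  nlinarith [sq_abs (a₁ s), sq_abs (a₂ s), mul_nonneg (abs_nonneg (a₁ s)) (abs_nonneg (a₂ s))]

theorem speed_comp_affine {c : ℝ} (hc : 0 ≤ c) (b : ℝ) :
    speed (fun t => c * a₁ (b + c * t)) (fun t => c * a₂ (b + c * t)) s =
      c * speed a₁ a₂ (b + c * s) := by
  simp only [speed, mul_pow, ← mul_add]
  rw [Real.sqrt_mul (by positivity), Real.sqrt_sq hc]

end Speed

/-- The linear part of the left translation by `g`, which is an affine map. -/
def leftLinear (g : Heis) : Heis →L[ℝ] Heis :=
  LinearMap.toContinuousLinearMap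
    { toFun := fun v => (v.1, v.2.1, v.2.2 + (g.1 * v.2.1 - g.2.1 * v.1) / 2)
      map_add' := fun u v => by
        simp only [Prod.fst_add, Prod.snd_add, Prod.mk_add_mk, Prod.mk.injEq, true_and]
        ring
      map_smul' := fun c v => by
        simp only [Prod.smul_fst, Prod.smul_snd, Prod.smul_mk, smul_eq_mul, Prod.mk.injEq,
          RingHom.id_apply, true_and]
        ring }

theorem leftLinear_apply (g v : Heis) :
    leftLinear g v = (v.1, v.2.1, v.2.2 + (g.1 * v.2.1 - g.2.1 * v.1) / 2) := rfl

theorem hmul_eq_add_leftLinear (g v : Heis) : g ⋆ v = g + leftLinear g v := by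
  simp only [hmul, leftLinear_apply, Prod.ext_iff, Prod.fst_add, Prod.snd_add, true_and]
  ring

theorem X_hmul (g v : Heis) (k : Fin 2) : X k (g ⋆ v) = leftLinear g (X k v) := by
  fin_cases k <;> ext <;> simp [hmul, leftLinear_apply, X, X₁, X₂] <;> ring

theorem ae_comp_affine {P : ℝ → Prop} {b c : ℝ} {S T : Set ℝ} (hS : MeasurableSet S)
    (hT : MeasurableSet T) (hc : c ≠ 0) (hST : Set.MapsTo (fun t => b + c * t) T S)
    (hP : ∀ᵐ s ∂(volume.restrict S), P s) : ∀ᵐ t ∂(volume.restrict T), P (b + c * t) := by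
  rw [ae_restrict_iff' hS] at hP
  rw [ae_restrict_iff' hT]
  have quasi := (measurePreserving_add_left (volume : Measure ℝ) b).quasiMeasurePreserving.comp
    (Measure.quasiMeasurePreserving_smul volume hc)
  filter_upwards [quasi.ae hP] with t ht hmem
  exact ht (hST hmem)

theorem hasDerivAt_comp_affine {E : Type*} [NormedAddCommGroup E] [NormedSpace ℝ E] {γ : ℝ → E}
    {w : E} {b c t : ℝ} (h : HasDerivAt γ w (b + c * t)) :
    HasDerivAt (fun s => γ (b + c * s)) (c • w) t := by
  have affine : HasDerivAt (fun s : ℝ => b + c * s) c t := by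
    simpa using ((hasDerivAt_id t).const_mul c).const_add b
  exact h.scomp t affine

theorem lipschitzWith_affine (b c : ℝ) : LipschitzWith ‖c‖₊ fun s : ℝ => b + c * s := by
  simpa using (LipschitzWith.const b).add (lipschitzWith_smul c)

namespace IsAdmissible

variable {x y z : Heis} {γ γ' : ℝ → Heis} {a₁ a₂ a₁' a₂' : ℝ → ℝ} {s t : ℝ}

theorem ae_hasDerivAt_coord (h : IsAdmissible x y γ a₁ a₂) :
    ∀ᵐ s ∂(volume.restrict (Set.Icc (0 : ℝ) 1)),
      HasDerivAt (fun s => (γ s).1) (a₁ s) s ∧ HasDerivAt (fun s => (γ s).2.1) (a₂ s) s ∧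
      HasDerivAt (fun s => (γ s).2.2) ((a₂ s * (γ s).1 - a₁ s * (γ s).2.1) / 2) s := by
  filter_upwards [h.deriv] with s hs
  have h₁ := (ContinuousLinearMap.fst ℝ ℝ (ℝ × ℝ)).hasFDerivAt.comp_hasDerivAt s hs
  have h₂₃ := (ContinuousLinearMap.snd ℝ ℝ (ℝ × ℝ)).hasFDerivAt.comp_hasDerivAt s hs
  have h₂ := (ContinuousLinearMap.fst ℝ ℝ ℝ).hasFDerivAt.comp_hasDerivAt s h₂₃
  have h₃ := (ContinuousLinearMap.snd ℝ ℝ ℝ).hasFDerivAt.comp_hasDerivAt s h₂₃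
  simp only [X₁, X₂, Prod.smul_mk, Prod.mk_add_mk, smul_eq_mul, ContinuousLinearMap.coe_fst',
    ContinuousLinearMap.coe_snd'] at h₁ h₂ h₃
  exact ⟨by convert! h₁ using 1; ring, by convert! h₂ using 1; ring, by convert! h₃ using 1; ring⟩

theorem exists_lipschitz_coord (h : IsAdmissible x y γ a₁ a₂) :
    ∃ K, LipschitzOnWith K (fun t => (γ t).1) (Set.Icc 0 1) ∧
      LipschitzOnWith K (fun t => (γ t).2.1) (Set.Icc 0 1) ∧
      LipschitzOnWith K (fun t => (γ t).2.2) (Set.Icc 0 1) := by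
  obtain ⟨K, hK⟩ := h.lipschitz
  exact ⟨K, fun s hs t ht => (le_max_left _ _).trans (hK hs ht),
    fun s hs t ht => ((le_max_left _ _).trans (le_max_right _ _)).trans (hK hs ht),
    fun s hs t ht => ((le_max_right _ _).trans (le_max_right _ _)).trans (hK hs ht)⟩

theorem integrableOn_speed (h : IsAdmissible x y γ a₁ a₂) :
    IntegrableOn (speed a₁ a₂) (Set.Icc 0 1) := by
  obtain ⟨K, lip₁, lip₂, -⟩ := h.exists_lipschitz_coord
  have hd := h.ae_hasDerivAt_coord
  have meas : Measurable (speed a₁ a₂) := by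
    have := h.measurable₁
    have := h.measurable₂
    unfold speed; fun_prop
  refine Measure.integrableOn_of_bounded (M := K + K) (by simp) meas.aestronglyMeasurable ?_
  filter_upwards [ae_abs_le_of_lipschitzOnWith lip₁ (hd.mono fun s hs => hs.1),
    ae_abs_le_of_lipschitzOnWith lip₂ (hd.mono fun s hs => hs.2.1)] with s h₁ h₂
  rw [Real.norm_of_nonneg (speed_nonneg _ _ _)]
  exact (speed_le _ _ _).trans (add_le_add h₁ h₂)

theorem intervalIntegrable_speed (h : IsAdmissible x y γ a₁ a₂) (hs : s ∈ Set.Icc (0 : ℝ) 1)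
    (ht : t ∈ Set.Icc (0 : ℝ) 1) : IntervalIntegrable (speed a₁ a₂) volume s t :=
  (h.integrableOn_speed.mono_set (Set.uIcc_subset_Icc hs ht)).intervalIntegrable

theorem integral_speed_mono (h : IsAdmissible x y γ a₁ a₂) (hs : 0 ≤ s) (hst : s ≤ t)
    (ht : t ≤ 1) : ∫ r in (0 : ℝ)..s, speed a₁ a₂ r ≤ ∫ r in (0 : ℝ)..t, speed a₁ a₂ r :=
  intervalIntegral.integral_mono_interval le_rfl hs hst (.of_forall fun r => speed_nonneg _ _ r)
    (h.intervalIntegrable_speed (by simp) ⟨hs.trans hst, ht⟩)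

theorem hmul_left (h : IsAdmissible x y γ a₁ a₂) (g : Heis) :
    IsAdmissible (g ⋆ x) (g ⋆ y) (fun t => g ⋆ γ t) a₁ a₂ where
  lipschitz := by
    obtain ⟨K, hK⟩ := h.lipschitz
    simp only [hmul_eq_add_leftLinear]
    exact ⟨_, (LipschitzWith.const g).lipschitzOnWith.add
      ((leftLinear g).lipschitz.comp_lipschitzOnWith hK)⟩
  measurable₁ := h.measurable₁
  measurable₂ := h.measurable₂
  deriv := by
    filter_upwards [h.deriv] with s hs
    change HasDerivAt _ (a₁ s • X 0 (g ⋆ γ s) + a₂ s • X 1 (g ⋆ γ s)) s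
    rw [X_hmul, X_hmul, ← map_smul, ← map_smul, ← map_add]
    simp only [hmul_eq_add_leftLinear]
    exact ((leftLinear g).hasFDerivAt.comp_hasDerivAt s hs).const_add g
  source := by rw [h.source]
  target := by rw [h.target]

/-- The third coordinate of a horizontal curve starting at the identity is the area it sweeps out
in the plane of the first two, hence at most quadratic in the length. -/
theorem hnorm_le_integral_speed (h : IsAdmissible 0 y γ a₁ a₂) (ht : t ∈ Set.Icc (0 : ℝ) 1) :
    hnorm (γ t) ≤ ∫ s in (0 : ℝ)..t, speed a₁ a₂ s := by
  obtain ⟨K, lip₁, lip₂, lip₃⟩ := h.exists_lipschitz_coord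
  have hd := h.ae_hasDerivAt_coord
  have integrable {s : ℝ} (hs : s ∈ Set.Icc (0 : ℝ) 1) :=
    h.intervalIntegrable_speed (s := 0) (by simp) hs
  set l := ∫ s in (0 : ℝ)..t, speed a₁ a₂ s
  have bound₁ {s : ℝ} (hs : s ∈ Set.Icc 0 t) : |(γ s).1| ≤ l := by
    have hs' : s ∈ Set.Icc (0 : ℝ) 1 := ⟨hs.1, hs.2.trans ht.2⟩
    have := abs_sub_le_integral_of_lipschitzOnWith lip₁ (hd.mono fun s hs => hs.1) hs'
      (integrable hs') fun r _ => abs_fst_le_speed a₁ a₂ r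
    rw [h.source, Prod.fst_zero, sub_zero] at this
    exact this.trans (h.integral_speed_mono hs.1 hs.2 ht.2)
  have bound₂ {s : ℝ} (hs : s ∈ Set.Icc 0 t) : |(γ s).2.1| ≤ l := by
    have hs' : s ∈ Set.Icc (0 : ℝ) 1 := ⟨hs.1, hs.2.trans ht.2⟩
    have := abs_sub_le_integral_of_lipschitzOnWith lip₂ (hd.mono fun s hs => hs.2.1) hs'
      (integrable hs') fun r _ => abs_snd_le_speed a₁ a₂ r
    rw [h.source, Prod.snd_zero, Prod.fst_zero, sub_zero] at this
    exact this.trans (h.integral_speed_mono hs.1 hs.2 ht.2)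
  have mem_t : t ∈ Set.Icc 0 t := ⟨ht.1, le_rfl⟩
  have l_nonneg : 0 ≤ l := (abs_nonneg _).trans (bound₁ mem_t)
  refine (hnorm_le_iff l_nonneg).2 ⟨bound₁ mem_t, bound₂ mem_t, ?_⟩
  have := abs_sub_le_integral_of_lipschitzOnWith (g := fun r => l * speed a₁ a₂ r) lip₃
    (hd.mono fun s hs => hs.2.2) ht ((integrable ht).const_mul l) fun r hr => ?_
  · rw [h.source, Prod.snd_zero, Prod.snd_zero, sub_zero] at this
    rwa [sq, ← intervalIntegral.integral_const_mul]
  · have area : |a₂ r * (γ r).1 - a₁ r * (γ r).2.1| ≤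
        speed a₁ a₂ r * l + speed a₁ a₂ r * l := by
      refine (abs_sub _ _).trans ?_
      rw [abs_mul, abs_mul]
      exact add_le_add
        (mul_le_mul (abs_snd_le_speed ..) (bound₁ hr) (abs_nonneg _) (speed_nonneg ..))
        (mul_le_mul (abs_fst_le_speed ..) (bound₂ hr) (abs_nonneg _) (speed_nonneg ..))
    rw [abs_div, abs_two]
    linarith

theorem hnorm_displacement_le (h : IsAdmissible x y γ a₁ a₂) (ht : t ∈ Set.Icc (0 : ℝ) 1) :
    hnorm (-x ⋆ γ t) ≤ ∫ s in (0 : ℝ)..t, speed a₁ a₂ s := by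
  have translated := h.hmul_left (-x)
  rw [neg_hmul_self] at translated
  exact translated.hnorm_le_integral_speed ht

theorem tail (h : IsAdmissible x y γ a₁ a₂) (hs : s ∈ Set.Ico (0 : ℝ) 1) :
    IsAdmissible (γ s) y (fun t => γ (s + (1 - s) * t))
      (fun t => (1 - s) * a₁ (s + (1 - s) * t)) (fun t => (1 - s) * a₂ (s + (1 - s) * t)) := by
  obtain ⟨hs₀, hs₁⟩ := hs
  have mapsTo : Set.MapsTo (fun t => s + (1 - s) * t) (Set.Icc 0 1) (Set.Icc 0 1) := by
    rintro t ⟨ht₀, ht₁⟩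
    constructor <;> nlinarith
  have := h.measurable₁
  have := h.measurable₂
  refine ⟨?_, by fun_prop, by fun_prop, ?_, by simp, by simpa using h.target⟩
  · obtain ⟨K, hK⟩ := h.lipschitz
    exact ⟨_, hK.comp (lipschitzWith_affine s (1 - s)).lipschitzOnWith mapsTo⟩
  · filter_upwards [ae_comp_affine measurableSet_Icc measurableSet_Icc (sub_pos.2 hs₁).ne' mapsTo
      h.deriv] with t ht
    simpa only [smul_add, smul_smul] using hasDerivAt_comp_affine ht

end IsAdmissible

section Concat

/-- The curve that runs through `γ` on `[0, 1/2]` and through `γ'` on `[1/2, 1]`, provided that `γ`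
ends where `γ'` starts. Clamping the parameters makes it Lipschitz at once. -/
def concat (γ γ' : ℝ → Heis) (t : ℝ) : Heis :=
  γ (min (0 + 2 * t) 1) + γ' (max (-1 + 2 * t) 0) - γ' 0

/-- The coefficient of `concat γ γ'` along `X k`, from those of `γ` and `γ'`. -/
def concatCoeff (a a' : ℝ → ℝ) (t : ℝ) : ℝ :=
  if t < 1 / 2 then 2 * a (0 + 2 * t) else 2 * a' (-1 + 2 * t)

variable {x y z : Heis} {γ γ' : ℝ → Heis} {a₁ a₂ a₁' a₂' : ℝ → ℝ} {t : ℝ}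

theorem concat_eq_left (ht : t ≤ 1 / 2) : concat γ γ' t = γ (0 + 2 * t) := by
  rw [concat, min_eq_left (by linarith), max_eq_right (by linarith), add_sub_cancel_right]

theorem concat_eq_right (hγ : γ 1 = γ' 0) (ht : 1 / 2 ≤ t) : concat γ γ' t = γ' (-1 + 2 * t) := by
  rw [concat, min_eq_right (by linarith), max_eq_left (by linarith), hγ, add_sub_cancel_left]

theorem measurable_concatCoeff {a a' : ℝ → ℝ} (ha : Measurable a) (ha' : Measurable a') :
    Measurable (concatCoeff a a') :=
  Measurable.ite measurableSet_Iio (by fun_prop) (by fun_prop)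

theorem IsAdmissible.trans (h : IsAdmissible x y γ a₁ a₂) (h' : IsAdmissible y z γ' a₁' a₂') :
    IsAdmissible x z (concat γ γ') (concatCoeff a₁ a₁') (concatCoeff a₂ a₂') where
  lipschitz := by
    obtain ⟨K, hK⟩ := h.lipschitz
    obtain ⟨K', hK'⟩ := h'.lipschitz
    have left := hK.comp ((lipschitzWith_affine 0 2).min_const 1).lipschitzOnWith
      (s := Set.Icc 0 1) fun t ht => ⟨le_min (by linarith [ht.1]) zero_le_one, min_le_right _ _⟩
    have right := hK'.comp ((lipschitzWith_affine (-1) 2).max_const 0).lipschitzOnWith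
      (s := Set.Icc 0 1) fun t ht => ⟨le_max_right _ _, max_le (by linarith [ht.2]) zero_le_one⟩
    exact ⟨_, (left.add right).sub (LipschitzWith.const (γ' 0)).lipschitzOnWith⟩
  measurable₁ := measurable_concatCoeff h.measurable₁ h'.measurable₁
  measurable₂ := measurable_concatCoeff h.measurable₂ h'.measurable₂
  deriv := by
    have left := ae_comp_affine (b := 0) measurableSet_Icc measurableSet_Icc two_ne_zero
      (T := Set.Icc 0 (1 / 2)) (fun t ht => ⟨by linarith [ht.1], by linarith [ht.2]⟩) h.deriv
    have right := ae_comp_affine (b := -1) measurableSet_Icc measurableSet_Icc two_ne_zero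
      (T := Set.Icc (1 / 2) 1) (fun t ht => ⟨by linarith [ht.1], by linarith [ht.2]⟩) h'.deriv
    rw [ae_restrict_iff' measurableSet_Icc] at left right ⊢
    filter_upwards [left, right, Measure.ae_ne volume (1 / 2 : ℝ)] with t hl hr hne ht
    rcases lt_or_gt_of_ne hne with hlt | hgt
    · rw [concat_eq_left hlt.le, concatCoeff, concatCoeff, if_pos hlt, if_pos hlt]
      refine HasDerivAt.congr_of_eventuallyEq (f := fun t => γ (0 + 2 * t)) ?_
        (Filter.eventuallyEq_of_mem (Iio_mem_nhds hlt) fun s hs => concat_eq_left (le_of_lt hs))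
      simpa only [smul_add, smul_smul] using hasDerivAt_comp_affine (hl ⟨ht.1, hlt.le⟩)
    · have junction : γ 1 = γ' 0 := by rw [h.target, h'.source]
      rw [concat_eq_right junction hgt.le, concatCoeff, concatCoeff, if_neg hgt.le.not_gt,
        if_neg hgt.le.not_gt]
      refine HasDerivAt.congr_of_eventuallyEq (f := fun t => γ' (-1 + 2 * t)) ?_
        (Filter.eventuallyEq_of_mem (Ioi_mem_nhds hgt) fun s hs =>
          concat_eq_right junction (le_of_lt hs))
      simpa only [smul_add, smul_smul] using hasDerivAt_comp_affine (hr ⟨hgt.le, ht.2⟩)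
  source := by rw [concat_eq_left (by norm_num), mul_zero, add_zero, h.source]
  target := by
    rw [concat_eq_right (by rw [h.target, h'.source]) (by norm_num)]
    norm_num [h'.target]

theorem speed_concatCoeff (t : ℝ) : speed (concatCoeff a₁ a₁') (concatCoeff a₂ a₂') t =
    if t < 1 / 2 then 2 * speed a₁ a₂ (0 + 2 * t) else 2 * speed a₁' a₂' (-1 + 2 * t) := by
  rw [← speed_comp_affine _ _ _ zero_le_two, ← speed_comp_affine _ _ _ zero_le_two]
  split_ifs with ht <;> simp only [speed, concatCoeff, ht, if_true, if_false]

theorem integral_speed_concatCoeff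
    (h : IntervalIntegrable (speed (concatCoeff a₁ a₁') (concatCoeff a₂ a₂')) volume 0 1) :
    ∫ t in (0 : ℝ)..1, speed (concatCoeff a₁ a₁') (concatCoeff a₂ a₂') t =
      (∫ t in (0 : ℝ)..1, speed a₁ a₂ t) + ∫ t in (0 : ℝ)..1, speed a₁' a₂' t := by
  have half : (1 / 2 : ℝ) ∈ Set.uIcc 0 1 := by norm_num [Set.uIcc_of_le]
  rw [← intervalIntegral.integral_add_adjacent_intervals
    (h.mono_set (Set.uIcc_subset_uIcc_left half)) (h.mono_set (Set.uIcc_subset_uIcc_right half))]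
  congr 1
  · have eq_left : ∀ᵐ t : ℝ, t ∈ Set.uIoc (0 : ℝ) (1 / 2) →
        speed (concatCoeff a₁ a₁') (concatCoeff a₂ a₂') t = 2 * speed a₁ a₂ (0 + 2 * t) := by
      filter_upwards [Measure.ae_ne volume (1 / 2 : ℝ)] with t hne ht
      rw [Set.uIoc_of_le (by norm_num)] at ht
      rw [speed_concatCoeff, if_pos (lt_of_le_of_ne ht.2 hne)]
    rw [intervalIntegral.integral_congr_ae eq_left, intervalIntegral.integral_const_mul,
      intervalIntegral.mul_integral_comp_add_mul]
    norm_num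
  · have eq_right : ∀ t ∈ Set.uIcc (1 / 2 : ℝ) 1,
        speed (concatCoeff a₁ a₁') (concatCoeff a₂ a₂') t = 2 * speed a₁' a₂' (-1 + 2 * t) := by
      intro t ht
      rw [Set.uIcc_of_le (by norm_num)] at ht
      rw [speed_concatCoeff, if_neg ht.1.not_gt]
    rw [intervalIntegral.integral_congr eq_right, intervalIntegral.integral_const_mul,
      intervalIntegral.mul_integral_comp_add_mul]
    norm_num

end Concat

/-- The lengths of the admissible curves from `x` to `y`, so that `ccDist x y` is their infimum. -/
def lengths (x y : Heis) : Set ℝ :=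
  {l : ℝ | ∃ γ a₁ a₂, IsAdmissible x y γ a₁ a₂ ∧ l = ∫ s in (0 : ℝ)..1, speed a₁ a₂ s}

theorem lengths_nonneg {x y : Heis} {l : ℝ} (h : l ∈ lengths x y) : 0 ≤ l := by
  obtain ⟨γ, a₁, a₂, -, rfl⟩ := h
  exact intervalIntegral.integral_nonneg zero_le_one fun r _ => speed_nonneg _ _ r

theorem IsAdmissible.integral_tail_mem_lengths {x y : Heis} {γ : ℝ → Heis} {a₁ a₂ : ℝ → ℝ}
    (h : IsAdmissible x y γ a₁ a₂) {s : ℝ} (hs : s ∈ Set.Ico (0 : ℝ) 1) :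
    ∫ t in s..1, speed a₁ a₂ t ∈ lengths (γ s) y := by
  refine ⟨_, _, _, h.tail hs, ?_⟩
  simp_rw [speed_comp_affine a₁ a₂ _ (sub_nonneg.2 hs.2.le)]
  rw [intervalIntegral.integral_const_mul, intervalIntegral.mul_integral_comp_add_mul]
  simp

theorem zero_mem_lengths (x : Heis) : 0 ∈ lengths x x := by
  refine ⟨fun _ => x, 0, 0, ?_, by simp [speed]⟩
  exact
    { lipschitz := ⟨0, (LipschitzWith.const x).lipschitzOnWith⟩
      measurable₁ := measurable_zero
      measurable₂ := measurable_zero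
      deriv := .of_forall fun s => by simpa using hasDerivAt_const s x
      source := rfl
      target := rfl }

theorem add_mem_lengths {x y z : Heis} {l l' : ℝ} (h : l ∈ lengths x y) (h' : l' ∈ lengths y z) :
    l + l' ∈ lengths x z := by
  obtain ⟨γ, a₁, a₂, hγ, rfl⟩ := h
  obtain ⟨γ', a₁', a₂', hγ', rfl⟩ := h'
  refine ⟨_, _, _, hγ.trans hγ', (integral_speed_concatCoeff ?_).symm⟩
  exact (hγ.trans hγ').intervalIntegrable_speed (by simp) (by simp)

theorem abs_mem_lengths (x : Heis) (k : Fin 2) (t : ℝ) : |t| ∈ lengths (x ⋆ flow k t) x := by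
  refine ⟨fun s => x ⋆ flow k (t + -t * s), fun _ => ![-t, 0] k, fun _ => ![0, -t] k, ?_, ?_⟩
  · refine ⟨?_, measurable_const, measurable_const, .of_forall fun s => ?_, by simp, ?_⟩
    · simp only [hmul_flow]
      exact ⟨_, ((LipschitzWith.const x).add ((ContinuousLinearMap.toSpanSingleton ℝ
        (X k x)).lipschitz.comp (lipschitzWith_affine t (-t)))).lipschitzOnWith⟩
    · have velocity (y : Heis) : ![-t, 0] k • X₁ y + ![0, -t] k • X₂ y = -t • X k y := by
        fin_cases k <;> simp [X]
      rw [velocity, X_hmul_flow]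
      simp only [hmul_flow]
      refine hasDerivAt_comp_affine (γ := fun r => x + r • X k x) ?_
      simpa using ((hasDerivAt_id (t + -t * s)).smul_const (X k x)).const_add x
    · simp [hmul_flow]
  · fin_cases k <;> simp [speed, Real.sqrt_sq_eq_abs]

theorem lengths_zero_nonempty (x : Heis) : (lengths x 0).Nonempty := by
  obtain ⟨w, rfl, -⟩ := exists_word x
  induction w with
  | nil => exact ⟨0, zero_mem_lengths 0⟩
  | cons a w ih =>
    obtain ⟨l, hl⟩ := ih
    exact ⟨_, add_mem_lengths (abs_mem_lengths _ a.1 a.2) hl⟩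

theorem d_nonneg (x : Heis) : 0 ≤ d x := Real.sInf_nonneg fun _ h => lengths_nonneg h

theorem d_le_of_mem_lengths {x : Heis} {l : ℝ} (h : l ∈ lengths x 0) : d x ≤ l :=
  csInf_le ⟨0, fun _ h => lengths_nonneg h⟩ h

theorem d_zero : d 0 = 0 := le_antisymm (d_le_of_mem_lengths (zero_mem_lengths 0)) (d_nonneg 0)

theorem exists_mem_lengths_lt {x : Heis} {l : ℝ} (h : d x < l) : ∃ l' ∈ lengths x 0, l' < l :=
  exists_lt_of_csInf_lt (lengths_zero_nonempty x) h

theorem d_hmul_flow_le (x : Heis) (k : Fin 2) (t : ℝ) : d (x ⋆ flow k t) ≤ d x + |t| := by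
  refine le_of_forall_gt_imp_ge_of_dense fun l hl => ?_
  obtain ⟨l', mem, hlt⟩ := exists_mem_lengths_lt (lt_sub_iff_add_lt.2 hl)
  linarith [d_le_of_mem_lengths (add_mem_lengths (abs_mem_lengths x k t) mem)]

theorem abs_d_hmul_flow_sub_le (x : Heis) (k : Fin 2) (t : ℝ) :
    |d (x ⋆ flow k t) - d x| ≤ |t| := by
  have there := d_hmul_flow_le x k t
  have back := d_hmul_flow_le (x ⋆ flow k t) k (-t)
  rw [hmul_flow_neg, abs_neg] at back
  exact abs_le.2 ⟨by linarith, by linarith⟩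

theorem abs_d_hmul_endpoint_sub_le (x : Heis) (w : Word) :
    |d (x ⋆ Word.endpoint w) - d x| ≤ Word.length w := by
  induction w with
  | nil => simp [Word.endpoint, Word.length, hmul_zero]
  | cons a w ih =>
    rw [Word.endpoint, Word.length, ← hmul_assoc, add_comm]
    exact (abs_sub_le _ (d (x ⋆ Word.endpoint w)) _).trans
      (add_le_add (abs_d_hmul_flow_sub_le _ _ _) ih)

theorem abs_d_hmul_sub_le (x v : Heis) : |d (x ⋆ v) - d x| ≤ 10 * hnorm v := by
  obtain ⟨w, rfl, hw⟩ := exists_word v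
  exact (abs_d_hmul_endpoint_sub_le x w).trans hw

theorem d_le_hnorm (x : Heis) : d x ≤ 10 * hnorm x := by
  have := (abs_le.1 (abs_d_hmul_sub_le 0 x)).2
  rwa [zero_hmul, d_zero, sub_zero] at this

theorem hnorm_le_d (x : Heis) : hnorm x ≤ d x := by
  refine le_of_forall_gt_imp_ge_of_dense fun l hl => ?_
  obtain ⟨l', ⟨γ, a₁, a₂, h, rfl⟩, hlt⟩ := exists_mem_lengths_lt hl
  have := h.hnorm_displacement_le (t := 1) (by simp)
  rw [h.target, hmul_zero, hnorm_neg] at this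
  exact this.trans hlt.le

@[fun_prop]
theorem continuous_d : Continuous d := by
  rw [continuous_iff_continuousAt]
  intro x
  have displacement : Filter.Tendsto (fun y => 10 * hnorm (-x ⋆ y)) (nhds x) (nhds 0) := by
    have cont : Continuous fun y => 10 * hnorm (-x ⋆ y) := by fun_prop
    simpa [neg_hmul_self, hnorm_zero] using cont.tendsto x
  refine tendsto_iff_dist_tendsto_zero.2
    (squeeze_zero (fun _ => dist_nonneg) (fun y => ?_) displacement)
  simpa only [hmul_neg_cancel, Real.dist_eq] using abs_d_hmul_sub_le x (-x ⋆ y)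

@[fun_prop]
theorem measurable_d : Measurable d := continuous_d.measurable

/-- Along an almost minimizing curve one gets closer to the identity at almost unit speed. -/
theorem exists_hmul_d_le (x : Heis) {l : ℝ} (hl : 0 < l) (hx : l ≤ d x) :
    ∃ v, hnorm v ≤ l ∧ d (x ⋆ v) ≤ d x - l / 2 := by
  obtain ⟨L, ⟨γ, a₁, a₂, h, rfl⟩, hlt⟩ :=
    exists_mem_lengths_lt (lt_add_of_pos_right (d x) (half_pos hl))
  have d_le : d x ≤ ∫ s in (0 : ℝ)..1, speed a₁ a₂ s := d_le_of_mem_lengths ⟨γ, a₁, a₂, h, rfl⟩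
  have cont : ContinuousOn (fun t => ∫ s in (0 : ℝ)..t, speed a₁ a₂ s) (Set.Icc 0 1) :=
    (intervalIntegral.continuousOn_primitive_interval' (b₁ := 0) (b₂ := 1)
      (h.intervalIntegrable_speed (by simp) (by simp)) (by simp)).mono (by simp)
  obtain ⟨s, hs, hsl : ∫ r in (0 : ℝ)..s, speed a₁ a₂ r = l⟩ :=
    intermediate_value_Icc zero_le_one cont ⟨by simpa using hl.le, hx.trans d_le⟩
  refine ⟨-x ⋆ γ s, hsl ▸ h.hnorm_displacement_le hs, ?_⟩
  rw [hmul_neg_cancel]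
  rcases eq_or_lt_of_le hs.2 with rfl | hs₁
  · rw [h.target, d_zero]
    linarith
  · have tail := d_le_of_mem_lengths (h.integral_tail_mem_lengths ⟨hs.1, hs₁⟩)
    have split := intervalIntegral.integral_add_adjacent_intervals
      (h.intervalIntegrable_speed (s := 0) (by simp) hs)
      (h.intervalIntegrable_speed (t := 1) hs (by simp))
    linarith

/-! ### Increments along translations -/

/-- The length `|∇ f|` of the sub-gradient. -/
def gradNorm (f : Heis → ℝ) (x : Heis) : ℝ := Real.sqrt (∑ k, lieDeriv k f x ^ 2)

theorem gradNorm_nonneg (f : Heis → ℝ) (x : Heis) : 0 ≤ gradNorm f x := Real.sqrt_nonneg _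

theorem abs_lieDeriv_le (k : Fin 2) (f : Heis → ℝ) (x : Heis) : |lieDeriv k f x| ≤ gradNorm f x :=
  Real.abs_le_sqrt (Finset.single_le_sum (f := fun k => lieDeriv k f x ^ 2)
    (fun _ _ => sq_nonneg _) (Finset.mem_univ k))

theorem continuous_X (k : Fin 2) : Continuous (X k) := by
  fin_cases k
  · change Continuous X₁
    unfold X₁; fun_prop
  · change Continuous X₂
    unfold X₂; fun_prop

section Increments

variable {f : Heis → ℝ} {q : ℝ} {w w' : Heis → ENNReal}

theorem continuous_lieDeriv (hf : ContDiff ℝ 1 f) (k : Fin 2) : Continuous (lieDeriv k f) :=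
  (hf.continuous_fderiv one_ne_zero).clm_apply (continuous_X k)

theorem continuous_gradNorm (hf : ContDiff ℝ 1 f) : Continuous (gradNorm f) :=
  Real.continuous_sqrt.comp
    (continuous_finsetSum _ fun k _ => (continuous_lieDeriv hf k).pow 2)

theorem hasDerivAt_comp_flow (hf : ContDiff ℝ 1 f) (y : Heis) (k : Fin 2) (s : ℝ) :
    HasDerivAt (fun s => f (y ⋆ flow k s)) (lieDeriv k f (y ⋆ flow k s)) s := by
  have integral_curve : HasDerivAt (fun s => y ⋆ flow k s) (X k y) s := by
    simp only [hmul_flow]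
    simpa using ((hasDerivAt_id s).smul_const (X k y)).const_add y
  rw [lieDeriv, X_hmul_flow]
  exact ((hf.differentiable one_ne_zero) _).hasFDerivAt.comp_hasDerivAt s integral_curve

theorem enorm_sub_hmul_flow_rpow_le (hf : ContDiff ℝ 1 f) (hq : 1 ≤ q) (y : Heis) (k : Fin 2)
    (t : ℝ) : ‖f (y ⋆ flow k t) - f y‖ₑ ^ q ≤
      ENNReal.ofReal |t| ^ (q - 1) * ∫⁻ s in Set.uIoc 0 t, ‖gradNorm f (y ⋆ flow k s)‖ₑ ^ q := by
  have deriv_cont : Continuous fun s => lieDeriv k f (y ⋆ flow k s) :=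
    (continuous_lieDeriv hf k).comp (by fun_prop)
  have grad_cont : Continuous fun s => gradNorm f (y ⋆ flow k s) :=
    (continuous_gradNorm hf).comp (by fun_prop)
  have ftc : f (y ⋆ flow k t) - f y = ∫ s in (0 : ℝ)..t, lieDeriv k f (y ⋆ flow k s) := by
    rw [intervalIntegral.integral_eq_sub_of_hasDerivAt
      (fun s _ => hasDerivAt_comp_flow hf y k s) (deriv_cont.intervalIntegrable 0 t)]
    simp [hmul_flow]
  have le_lintegral : ‖f (y ⋆ flow k t) - f y‖ₑ ≤
      ∫⁻ s in Set.uIoc 0 t, ‖gradNorm f (y ⋆ flow k s)‖ₑ := by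
    rw [ftc, ← ofReal_norm, intervalIntegral.norm_integral_eq_norm_integral_uIoc, ofReal_norm]
    refine (enorm_integral_le_lintegral_enorm _).trans (lintegral_mono fun s => ?_)
    exact enorm_le_iff_norm_le.2 (by
      rw [Real.norm_of_nonneg (gradNorm_nonneg _ _)]
      exact abs_lieDeriv_le _ _ _)
  refine (ENNReal.rpow_le_rpow le_lintegral (by linarith)).trans ?_
  simpa [Set.uIoc, max_sub_min_eq_abs'] using rpow_lintegral_enorm_le
    (μ := volume.restrict (Set.uIoc 0 t)) hq grad_cont.aestronglyMeasurable

theorem lintegral_flow_increment_le (hf : ContDiff ℝ 1 f) (hq : 1 ≤ q) (hw' : Measurable w')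
    (u : Heis) (k : Fin 2) (t : ℝ) (hww : ∀ x s, |s| ≤ |t| → w x ≤ w' (x ⋆ u ⋆ flow k s)) :
    ∫⁻ x, w x * ‖f (x ⋆ u ⋆ flow k t) - f (x ⋆ u)‖ₑ ^ q ≤
      ENNReal.ofReal |t| ^ q * ∫⁻ z, w' z * ‖gradNorm f z‖ₑ ^ q := by
  set F : Heis → ENNReal := fun z => w' z * ‖gradNorm f z‖ₑ ^ q
  have grad_meas : Measurable fun z => ‖gradNorm f z‖ₑ ^ q :=
    (continuous_gradNorm hf).measurable.enorm.pow_const q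
  have F_meas : Measurable F := hw'.mul grad_meas
  have pointwise (x : Heis) : w x * ‖f (x ⋆ u ⋆ flow k t) - f (x ⋆ u)‖ₑ ^ q ≤
      ENNReal.ofReal |t| ^ (q - 1) * ∫⁻ s in Set.uIoc 0 t, F (x ⋆ u ⋆ flow k s) := by
    refine (mul_le_mul_right (enorm_sub_hmul_flow_rpow_le hf hq (x ⋆ u) k t) (w x)).trans ?_
    have flow_meas : Measurable fun s => ‖gradNorm f (x ⋆ u ⋆ flow k s)‖ₑ ^ q :=
      ((continuous_gradNorm hf).comp (g := gradNorm f) (f := fun s => x ⋆ u ⋆ flow k s)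
        (by fun_prop)).measurable.enorm.pow_const q
    rw [mul_left_comm, ← lintegral_const_mul _ flow_meas]
    refine mul_le_mul_right ?_ _
    refine setLIntegral_mono' measurableSet_uIoc fun s hs => ?_
    have hs : |s| ≤ |t| := by simpa using Set.abs_sub_left_of_mem_uIcc (Set.uIoc_subset_uIcc hs)
    exact mul_le_mul_left (hww x s hs) _
  have translate (s : ℝ) : ∫⁻ x, F (x ⋆ u ⋆ flow k s) = ∫⁻ z, F z := by
    simp only [hmul_assoc]
    exact (measurePreserving_hmul_right (u ⋆ flow k s)).lintegral_comp F_meas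
  have joint_meas : Measurable fun z : Heis × ℝ => F (z.1 ⋆ u ⋆ flow k z.2) := by
    have joint_cont : Continuous fun z : Heis × ℝ => z.1 ⋆ u ⋆ flow k z.2 := by fun_prop
    exact F_meas.comp joint_cont.measurable
  refine (lintegral_mono pointwise).trans_eq ?_
  rw [lintegral_const_mul' _ _ (by finiteness), lintegral_lintegral_swap joint_meas.aemeasurable]
  simp only [translate, lintegral_const, Measure.restrict_apply_univ]
  rw [Set.uIoc, Real.volume_Ioc, max_sub_min_eq_abs', zero_sub, abs_neg]
  rcases eq_or_ne t 0 with rfl | ht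
  · simp [show 0 < q by linarith]
  · rw [mul_comm (∫⁻ z, F z), ← mul_assoc]
    congr 1
    conv_lhs => rw [← ENNReal.rpow_one (ENNReal.ofReal |t|), ← ENNReal.rpow_mul, one_mul]
    rw [← ENNReal.rpow_add _ _ (by simpa) (by finiteness), sub_add_cancel]

theorem eLpNorm'_withDensity_rpow (hq : 0 < q) (hw : Measurable w) {g : Heis → ℝ}
    (hg : Measurable g) :
    eLpNorm' g q (volume.withDensity w) ^ q = ∫⁻ x, w x * ‖g x‖ₑ ^ q := by
  rw [← lintegral_rpow_enorm_eq_rpow_eLpNorm' hq,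
    lintegral_withDensity_eq_lintegral_mul _ hw (hg.enorm.pow_const q)]
  rfl

theorem eLpNorm'_endpoint_increment_le (hf : ContDiff ℝ 1 f) (hq : 1 ≤ q) (hw : Measurable w)
    (hw' : Measurable w') (v : Word)
    (hww : ∀ x z, |d z - d x| ≤ Word.length v → w x ≤ w' z) :
    eLpNorm' (fun x => f (x ⋆ Word.endpoint v) - f x) q (volume.withDensity w) ≤
      ENNReal.ofReal (Word.length v) * eLpNorm' (gradNorm f) q (volume.withDensity w') := by
  have q_pos : 0 < q := by linarith
  have f_meas := hf.continuous.measurable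
  have increment_meas (u u' : Heis) : Measurable fun x => f (x ⋆ u) - f (x ⋆ u') :=
    (f_meas.comp (by fun_prop)).sub (f_meas.comp (by fun_prop))
  induction v with
  | nil => simp [Word.endpoint, hmul_zero, eLpNorm', q_pos]
  | cons a v ih =>
    obtain ⟨k, t⟩ := a
    rw [Word.length] at hww ⊢
    have tail := ih fun x z hz => hww x z (hz.trans (by simp))
    have head : eLpNorm' (fun x => f (x ⋆ (Word.endpoint v ⋆ flow k t)) - f (x ⋆ Word.endpoint v))
        q (volume.withDensity w) ≤
          ENNReal.ofReal |t| * eLpNorm' (gradNorm f) q (volume.withDensity w') := by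
      rw [← ENNReal.rpow_le_rpow_iff q_pos, ENNReal.mul_rpow_of_nonneg _ _ q_pos.le,
        eLpNorm'_withDensity_rpow q_pos hw (increment_meas _ _),
        eLpNorm'_withDensity_rpow q_pos hw' (continuous_gradNorm hf).measurable]
      simp only [← hmul_assoc]
      refine lintegral_flow_increment_le hf hq hw' _ k t fun x s hs => hww _ _ ?_
      refine (abs_sub_le _ (d (x ⋆ Word.endpoint v)) _).trans ?_
      rw [add_comm]
      exact add_le_add (abs_d_hmul_endpoint_sub_le x v) ((abs_d_hmul_flow_sub_le _ k s).trans hs)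
    have minkowski := eLpNorm'_add_le (μ := volume.withDensity w)
      (increment_meas (Word.endpoint v ⋆ flow k t) (Word.endpoint v)).aestronglyMeasurable
      (increment_meas (Word.endpoint v) 0).aestronglyMeasurable hq
    simp only [hmul_zero, Pi.add_def, sub_add_sub_cancel] at minkowski
    refine (minkowski.trans (add_le_add head tail)).trans_eq ?_
    rw [add_comm, ← add_mul, ENNReal.ofReal_add (Word.length_nonneg v) (abs_nonneg t)]

theorem lintegral_increment_le (hf : ContDiff ℝ 1 f) (hq : 1 ≤ q) (hw : Measurable w)
    (hw' : Measurable w') (v : Heis) (hww : ∀ x z, |d z - d x| ≤ 10 * hnorm v → w x ≤ w' z) :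
    ∫⁻ x, w x * ‖f (x ⋆ v) - f x‖ₑ ^ q ≤
      ENNReal.ofReal (10 * hnorm v) ^ q * ∫⁻ z, w' z * ‖gradNorm f z‖ₑ ^ q := by
  have q_pos : 0 < q := by linarith
  have f_meas := hf.continuous.measurable
  obtain ⟨v, rfl, hv⟩ := exists_word v
  have increment_meas : Measurable fun x => f (x ⋆ Word.endpoint v) - f x :=
    (f_meas.comp (by fun_prop)).sub f_meas
  rw [← eLpNorm'_withDensity_rpow q_pos hw increment_meas,
    ← eLpNorm'_withDensity_rpow q_pos hw' (continuous_gradNorm hf).measurable,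
    ← ENNReal.mul_rpow_of_nonneg _ _ q_pos.le, ENNReal.rpow_le_rpow_iff q_pos]
  refine (eLpNorm'_endpoint_increment_le hf hq hw hw' v
    fun x z hz => hww x z (hz.trans hv)).trans ?_
  gcongr

end Increments

/-! ### Confining potentials -/

/-- The slope `L + (1 + t)^(p - 1)` at distance `t` from the identity of a confining potential;
`L` is the strength of the boundary condition, in which all estimates have to be uniform. -/
def rate (p L t : ℝ) : ℝ := L + (1 + t) ^ (p - 1)

/-- `U` behaves like a radial potential with slope comparable to `rate p L`, up to bounded
errors. -/
structure IsConfining (p c₁ C₁ C₂ L : ℝ) (U : Heis → ℝ) : Prop where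
  measurable : Measurable U
  nonneg : 0 ≤ L
  zero : |U 0| ≤ C₂
  upper : ∀ x y, d y ≤ d x → U x - U y ≤ C₁ * (rate p L (d x) * (d x - d y)) + C₂
  lower : ∀ x y, d y ≤ d x → c₁ * (rate p L (d x) * (d x - d y)) - C₂ ≤ U x - U y

/-- The unnormalised Gibbs density `e^{-U}`. -/
def boltzmann (U : Heis → ℝ) (x : Heis) : ENNReal := ENNReal.ofReal (Real.exp (-U x))

/-- The unnormalised energy `∫ |∇ f|^q e^{-U}`. -/
def gradEnergy (q : ℝ) (U f : Heis → ℝ) : ENNReal := ∫⁻ x, boltzmann U x * ‖gradNorm f x‖ₑ ^ q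

/-- The density `e^{-U} H^s`, where `H` is the rate. -/
def weight (p L s : ℝ) (U : Heis → ℝ) (x : Heis) : ENNReal :=
  ENNReal.ofReal (Real.exp (-U x) * rate p L (d x) ^ s)

/-- The weight at `x` cut off to displacements `v` of size less than `lam / H`, the scale on which
`U` varies by a bounded amount. -/
def kernel (p L s : ℝ) (U : Heis → ℝ) (lam : ℝ) (x v : Heis) : ENNReal :=
  if hnorm v * rate p L (d x) < lam then weight p L s U x else 0

section Rate

variable {p L s t R : ℝ}

theorem one_le_rate (hp : 1 ≤ p) (hL : 0 ≤ L) (ht : 0 ≤ t) : 1 ≤ rate p L t :=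
  le_add_of_nonneg_of_le hL (Real.one_le_rpow (by linarith) (by linarith))

theorem rate_mono (hp : 1 ≤ p) (hs : 0 ≤ s) (hst : s ≤ t) : rate p L s ≤ rate p L t := by
  have : 0 ≤ p - 1 := by linarith
  unfold rate
  gcongr

theorem rate_le_mul_rate (hp : 1 ≤ p) (hL : 0 ≤ L) (hs : 0 ≤ s) (ht : 0 ≤ t) (hR : |t - s| ≤ R) :
    rate p L t ≤ (1 + R) ^ (p - 1) * rate p L s := by
  have R_nonneg : 0 ≤ R := (abs_nonneg _).trans hR
  have one_le : 1 ≤ (1 + R) ^ (p - 1) := Real.one_le_rpow (by linarith) (by linarith)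
  have submultiplicative : (1 + t) ^ (p - 1) ≤ (1 + R) ^ (p - 1) * (1 + s) ^ (p - 1) := by
    rw [← Real.mul_rpow (by linarith) (by linarith)]
    refine Real.rpow_le_rpow (by linarith) ?_ (by linarith)
    nlinarith [(abs_le.1 hR).2]
  unfold rate
  nlinarith

@[fun_prop]
theorem measurable_rate : Measurable (rate p L) := by
  unfold rate
  fun_prop

end Rate

section Weight

variable {p L s q lam : ℝ} {U : Heis → ℝ}

@[fun_prop]
theorem measurable_boltzmann (hU : Measurable U) : Measurable (boltzmann U) := by
  unfold boltzmann
  fun_prop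

@[fun_prop]
theorem measurable_weight (hU : Measurable U) : Measurable (weight p L s U) := by
  unfold weight
  fun_prop

theorem weight_zero : weight p L 0 U = boltzmann U := by
  funext x
  simp [weight, boltzmann]

theorem weight_add {x : Heis} (hx : 0 < rate p L (d x)) (t : ℝ) :
    weight p L (s + t) U x = ENNReal.ofReal (rate p L (d x) ^ s) * weight p L t U x := by
  rw [weight, weight, ← ENNReal.ofReal_mul (by positivity), Real.rpow_add hx, mul_left_comm]

theorem weight_le_mul_weight {x z : Heis} {a κ : ℝ} (hs : 0 ≤ s) (hκ : 0 ≤ κ)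
    (hx : 0 ≤ rate p L (d x)) (hz : 0 ≤ rate p L (d z)) (hU : U z - U x ≤ a)
    (hrate : rate p L (d x) ≤ κ * rate p L (d z)) :
    weight p L s U x ≤ ENNReal.ofReal (Real.exp a * κ ^ s) * weight p L s U z := by
  rw [weight, weight, ← ENNReal.ofReal_mul (by positivity)]
  refine ENNReal.ofReal_le_ofReal ?_
  calc Real.exp (-U x) * rate p L (d x) ^ s
      ≤ Real.exp (a - U z) * (κ * rate p L (d z)) ^ s := by gcongr; linarith
    _ = Real.exp a * κ ^ s * (Real.exp (-U z) * rate p L (d z) ^ s) := by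
        rw [sub_eq_add_neg, Real.exp_add, Real.mul_rpow hκ hz]
        ring

@[fun_prop]
theorem measurable_kernel {α : Type*} [MeasurableSpace α] {f g : α → Heis} (hU : Measurable U)
    (hf : Measurable f) (hg : Measurable g) :
    Measurable fun a => kernel p L s U lam (f a) (g a) := by
  unfold kernel
  refine Measurable.ite (measurableSet_lt ?_ measurable_const) ?_ measurable_const
  · fun_prop
  · exact (measurable_weight hU).comp hf

theorem kernel_of_lt {x v : Heis} (h : hnorm v * rate p L (d x) < lam) :
    kernel p L s U lam x v = weight p L s U x := if_pos h

theorem kernel_of_ge {x v : Heis} (h : lam ≤ hnorm v * rate p L (d x)) :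
    kernel p L s U lam x v = 0 := if_neg h.not_gt

theorem lintegral_kernel {x : Heis} (hx : 0 < rate p L (d x)) (hlam : 0 < lam) :
    ∫⁻ v, kernel p L (4 + s) U lam x v = 8 * ENNReal.ofReal lam ^ 4 * weight p L s U x := by
  have eight_mul : 8 * ENNReal.ofReal lam ^ 4 = ENNReal.ofReal (8 * lam ^ 4) := by
    rw [ENNReal.ofReal_mul (by norm_num), ENNReal.ofReal_pow hlam.le, ENNReal.ofReal_ofNat]
  have kernel_eq : kernel p L (4 + s) U lam x =
      {v | hnorm v < lam / rate p L (d x)}.indicator fun _ => weight p L (4 + s) U x := by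
    funext v
    simp only [kernel, Set.indicator, Set.mem_ofPred_eq, lt_div_iff₀ hx]
  rw [kernel_eq, lintegral_indicator (measurableSet_hnorm_lt _), setLIntegral_const,
    volume_hnorm_lt (by positivity), weight_add hx, mul_right_comm, eight_mul,
    ← ENNReal.ofReal_mul (by positivity)]
  congr 2
  norm_cast
  field_simp

theorem ofReal_hnorm_rpow_mul_kernel_le {x v : Heis} (hq : 0 ≤ q) (hx : 0 < rate p L (d x)) :
    ENNReal.ofReal (hnorm v) ^ q * kernel p L (q + s) U lam x v ≤
      ENNReal.ofReal lam ^ q * kernel p L s U lam x v := by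
  rcases lt_or_ge (hnorm v * rate p L (d x)) lam with hv | hv
  · rw [kernel_of_lt hv, kernel_of_lt hv, weight_add hx, ← mul_assoc,
      ← ENNReal.ofReal_rpow_of_pos hx, ← ENNReal.mul_rpow_of_nonneg _ _ hq,
      ← ENNReal.ofReal_mul (hnorm_nonneg v)]
    gcongr
  · simp [kernel_of_ge hv]

end Weight

namespace IsConfining

variable {p c₁ C₁ C₂ L s q lam Lam : ℝ} {U : Heis → ℝ}

theorem one_le_rate (h : IsConfining p c₁ C₁ C₂ L U) (hp : 1 ≤ p) (x : Heis) :
    1 ≤ rate p L (d x) := Heis.one_le_rate hp h.nonneg (d_nonneg x)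

theorem rate_pos (h : IsConfining p c₁ C₁ C₂ L U) (hp : 1 ≤ p) (x : Heis) :
    0 < rate p L (d x) := one_pos.trans_le (h.one_le_rate hp x)

theorem sub_le (h : IsConfining p c₁ C₁ C₂ L U) (hp : 1 ≤ p) (hc : 0 ≤ c₁) (hC : 0 ≤ C₁)
    {x z : Heis} {R : ℝ} (hR : |d z - d x| ≤ R) :
    U z - U x ≤ C₁ * ((1 + R) ^ (p - 1) * (rate p L (d x) * R)) + C₂ := by
  have R_nonneg : 0 ≤ R := (abs_nonneg _).trans hR
  have x_pos := h.rate_pos hp x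
  rcases le_total (d x) (d z) with outwards | inwards
  · refine (h.upper z x outwards).trans ?_
    rw [← mul_assoc ((1 + R) ^ (p - 1))]
    have rate_le := rate_le_mul_rate hp h.nonneg (d_nonneg x) (d_nonneg z) hR
    have distance_le := (abs_le.1 hR).2
    have := (h.rate_pos hp z).le.trans rate_le
    gcongr
  · have drop := h.lower x z inwards
    have : 0 ≤ c₁ * (rate p L (d x) * (d x - d z)) :=
      mul_nonneg hc (mul_nonneg x_pos.le (sub_nonneg.2 inwards))
    have : 0 ≤ C₁ * ((1 + R) ^ (p - 1) * (rate p L (d x) * R)) := by positivity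
    linarith

theorem kernel_le (h : IsConfining p c₁ C₁ C₂ L U) (hp : 1 ≤ p) (hs : 0 ≤ s) (hc : 0 ≤ c₁)
    (hC : 0 ≤ C₁) (hlam : lam ≤ Lam) (hLam : 0 ≤ Lam) {x z v : Heis}
    (hxz : |d z - d x| ≤ 10 * hnorm v) :
    kernel p L s U lam x v ≤
      ENNReal.ofReal (Real.exp (C₁ * ((1 + 10 * Lam) ^ (p - 1) * (10 * Lam)) + C₂) *
        ((1 + 10 * Lam) ^ (p - 1)) ^ s) *
      kernel p L s U ((1 + 10 * Lam) ^ (p - 1) * lam) z v := by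
  set κ := (1 + 10 * Lam) ^ (p - 1) with hκ
  rcases lt_or_ge (hnorm v * rate p L (d x)) lam with hv | hv
  swap
  · simp [kernel_of_ge hv]
  have exponent_nonneg : 0 ≤ p - 1 := by linarith
  have v_nonneg := hnorm_nonneg v
  have κ_pos : 0 < κ := by positivity
  have v_le : hnorm v ≤ Lam := by nlinarith [h.one_le_rate hp x]
  have hxz' : |d z - d x| ≤ 10 * Lam := hxz.trans (by linarith)
  have rate_z_le : rate p L (d z) ≤ κ * rate p L (d x) :=
    rate_le_mul_rate hp h.nonneg (d_nonneg x) (d_nonneg z) hxz'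
  have rate_x_le : rate p L (d x) ≤ κ * rate p L (d z) :=
    rate_le_mul_rate hp h.nonneg (d_nonneg z) (d_nonneg x) (by rwa [abs_sub_comm])
  have potential_le : U z - U x ≤ C₁ * (κ * (10 * Lam)) + C₂ := by
    refine (h.sub_le hp hc hC hxz).trans ?_
    rw [mul_left_comm (rate p L (d x)), mul_comm (rate p L (d x)), hκ]
    have := hv.le.trans hlam
    have := h.rate_pos hp x
    gcongr
  have hv' : hnorm v * rate p L (d z) < κ * lam := by
    refine (mul_le_mul_of_nonneg_left rate_z_le v_nonneg).trans_lt ?_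
    rw [mul_left_comm]
    gcongr
  rw [kernel_of_lt hv, kernel_of_lt hv']
  exact weight_le_mul_weight hs κ_pos.le (h.rate_pos hp x).le (h.rate_pos hp z).le potential_le
    rate_x_le

end IsConfining

/-- The mean `q`-oscillation of `f` over the scale `lam / H`, integrated against `e^{-U} H^q`; the
factor `H^4` normalises the volume of the ball over which the mean is taken. -/
def oscillation (p L q : ℝ) (U : Heis → ℝ) (lam : ℝ) (f : Heis → ℝ) : ENNReal :=
  ∫⁻ x, ∫⁻ v, kernel p L (4 + q) U lam x v * ‖f (x ⋆ v) - f x‖ₑ ^ q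

section PseudoPoincare

variable {p q c₁ C₁ C₂ L lam Lam : ℝ} {U f : Heis → ℝ}

theorem measurable_increment (hf : Measurable f) :
    Measurable fun z : Heis × Heis => ‖f (z.1 ⋆ z.2) - f z.1‖ₑ ^ q :=
  ((hf.comp (measurable_hmul measurable_fst measurable_snd)).sub
    (hf.comp measurable_fst)).enorm.pow_const q

theorem lintegral_hnorm_mul_kernel_mul_le (hq : 0 ≤ q) (hU : Measurable U)
    (hrate : ∀ x, 0 < rate p L (d x)) (hlam : 0 < lam) {G : Heis → ENNReal} (hG : Measurable G) :
    ∫⁻ v, ENNReal.ofReal (hnorm v) ^ q * ∫⁻ z, kernel p L (4 + q) U lam z v * G z ≤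
      8 * ENNReal.ofReal lam ^ (4 + q) * ∫⁻ z, boltzmann U z * G z := by
  have rpow_add : ENNReal.ofReal lam ^ (4 + q) =
      ENNReal.ofReal lam ^ q * ENNReal.ofReal lam ^ 4 := by
    rw [add_comm, ENNReal.rpow_add _ _ (by simpa) (by finiteness)]
    norm_cast
  have inner (z : Heis) :
      ∫⁻ v, ENNReal.ofReal (hnorm v) ^ q * (kernel p L (4 + q) U lam z v * G z) ≤
        8 * ENNReal.ofReal lam ^ (4 + q) * (boltzmann U z * G z) := by
    calc _ ≤ ∫⁻ v, ENNReal.ofReal lam ^ q * (kernel p L (4 + 0) U lam z v * G z) := by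
          refine lintegral_mono fun v => ?_
          simp only [← mul_assoc, add_zero, add_comm (4 : ℝ) q]
          exact mul_le_mul_left (ofReal_hnorm_rpow_mul_kernel_le hq (hrate z)) _
      _ = _ := by
          rw [lintegral_const_mul' _ _ (by finiteness), lintegral_mul_const _ (by fun_prop),
            lintegral_kernel (hrate z) hlam, weight_zero, rpow_add]
          ring
  simp only [← lintegral_const_mul' _ _ (ENNReal.rpow_ne_top_of_nonneg hq ENNReal.ofReal_ne_top)]
  rw [lintegral_lintegral_swap (by fun_prop), ← lintegral_const_mul' _ _ (by finiteness)]
  exact lintegral_mono inner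

theorem exists_oscillation_le (hp : 1 ≤ p) (hq : 1 ≤ q) (hc : 0 ≤ c₁) (hC : 0 ≤ C₁)
    (hLam : 0 ≤ Lam) :
    ∃ C ≠ (⊤ : ENNReal), ∀ L U, IsConfining p c₁ C₁ C₂ L U → ∀ f, ContDiff ℝ 1 f →
      ∀ lam, 0 < lam → lam ≤ Lam →
        oscillation p L q U lam f ≤ C * ENNReal.ofReal lam ^ (4 + q) * gradEnergy q U f := by
  set κ := (1 + 10 * Lam) ^ (p - 1)
  have κ_pos : 0 < κ := by positivity
  set D := ENNReal.ofReal (Real.exp (C₁ * (κ * (10 * Lam)) + C₂) * κ ^ (4 + q))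
  have q_nonneg : 0 ≤ q := by linarith
  refine ⟨ENNReal.ofReal 10 ^ q * D * (8 * ENNReal.ofReal κ ^ (4 + q)),
    by finiteness, fun L U h f hf lam lam_pos hlam => ?_⟩
  have hU := h.measurable
  set G : Heis → ENNReal := fun x => ‖gradNorm f x‖ₑ ^ q
  have G_meas : Measurable G := (continuous_gradNorm hf).measurable.enorm.pow_const q
  have increments (v : Heis) : ∫⁻ x, kernel p L (4 + q) U lam x v * ‖f (x ⋆ v) - f x‖ₑ ^ q ≤
      ENNReal.ofReal 10 ^ q * D *
        (ENNReal.ofReal (hnorm v) ^ q * ∫⁻ z, kernel p L (4 + q) U (κ * lam) z v * G z) := by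
    refine (lintegral_increment_le hf hq (w' := fun z => D * kernel p L (4 + q) U (κ * lam) z v)
      (by fun_prop) (by fun_prop) v fun x z hxz =>
      h.kernel_le hp (by linarith) hc hC hlam hLam hxz).trans_eq ?_
    simp only [mul_assoc]
    rw [lintegral_const_mul' _ _ ENNReal.ofReal_ne_top, ENNReal.ofReal_mul (by norm_num),
      ENNReal.mul_rpow_of_nonneg _ _ q_nonneg]
    ring
  have joint_meas : Measurable fun z : Heis × Heis =>
      kernel p L (4 + q) U lam z.1 z.2 * ‖f (z.1 ⋆ z.2) - f z.1‖ₑ ^ q :=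
    (measurable_kernel hU measurable_fst measurable_snd).mul
      (measurable_increment hf.continuous.measurable)
  rw [oscillation, lintegral_lintegral_swap joint_meas.aemeasurable]
  refine (lintegral_mono increments).trans ?_
  rw [lintegral_const_mul' _ _ (by finiteness)]
  refine (mul_le_mul_right (lintegral_hnorm_mul_kernel_mul_le q_nonneg hU (h.rate_pos hp)
    (by positivity) G_meas) _).trans_eq ?_
  rw [ENNReal.ofReal_mul κ_pos.le, ENNReal.mul_rpow_of_nonneg _ _ (by linarith), gradEnergy]
  ring

end PseudoPoincare

section Moments

theorem one_add_norm_le (x : Heis) : 1 + ‖x‖ ≤ (1 + d x) ^ 2 := by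
  obtain ⟨h₁, h₂, h₃⟩ := (hnorm_le_iff (d_nonneg x)).1 (hnorm_le_d x)
  have := d_nonneg x
  have : ‖x‖ ≤ d x ^ 2 + 2 * d x := by
    simp only [Prod.norm_def, Real.norm_eq_abs]
    exact max_le (by nlinarith) (max_le (by nlinarith) (by nlinarith))
  linarith

theorem exists_exp_mul_one_add_rpow_le {c : ℝ} (hc : 0 < c) (m : ℝ) :
    ∃ K : ℝ, ∀ t, 0 ≤ t → Real.exp (-(c * t)) * (1 + t) ^ m ≤ K := by
  obtain ⟨n, hn⟩ := exists_nat_ge m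
  refine ⟨Real.exp c * (n.factorial / c ^ n), fun t ht => ?_⟩
  have pow_le : (1 + t) ^ n ≤ Real.exp (c * (1 + t)) * (n.factorial / c ^ n) := by
    have taylor := Real.pow_div_factorial_le_exp (x := c * (1 + t)) (by positivity) n
    rw [div_le_iff₀ (by positivity), mul_pow] at taylor
    rwa [← mul_div_assoc, le_div_iff₀ (by positivity), mul_comm]
  calc Real.exp (-(c * t)) * (1 + t) ^ m ≤ Real.exp (-(c * t)) * (1 + t) ^ (n : ℝ) := by
        gcongr
        linarith
    _ ≤ Real.exp (-(c * t)) * (Real.exp (c * (1 + t)) * (n.factorial / c ^ n)) := by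
        rw [Real.rpow_natCast]
        gcongr
    _ = Real.exp c * (n.factorial / c ^ n) := by
        rw [← mul_assoc, ← Real.exp_add]
        ring_nf

theorem lintegral_exp_neg_d_mul_lt_top {c : ℝ} (hc : 0 < c) (m : ℝ) :
    ∫⁻ x, ENNReal.ofReal (Real.exp (-(c * d x)) * (1 + d x) ^ m) < ⊤ := by
  obtain ⟨K, hK⟩ := exists_exp_mul_one_add_rpow_le hc (m + 8)
  have : (volume : Measure (ℝ × ℝ)).IsAddHaarMeasure := Measure.prod.instIsAddHaarMeasure _ _
  have : (volume : Measure Heis).IsAddHaarMeasure :=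
    Measure.prod.instIsAddHaarMeasure volume (volume : Measure (ℝ × ℝ))
  have norm_integral : ∫⁻ x : Heis, ENNReal.ofReal ((1 + ‖x‖) ^ (-(4 : ℝ))) < ⊤ := by
    refine finite_integral_one_add_norm ?_
    simp only [Module.finrank_prod, Module.finrank_self]
    norm_num
  have pointwise (x : Heis) : Real.exp (-(c * d x)) * (1 + d x) ^ m ≤
      K * (1 + ‖x‖) ^ (-(4 : ℝ)) := by
    have := d_nonneg x
    have decay : (1 + d x) ^ (-(8 : ℝ)) ≤ (1 + ‖x‖) ^ (-(4 : ℝ)) := by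
      rw [show -(8 : ℝ) = (2 : ℕ) * -(4 : ℝ) by norm_num, Real.rpow_mul (by linarith),
        Real.rpow_natCast]
      exact Real.rpow_le_rpow_of_nonpos (by positivity) (one_add_norm_le x) (by norm_num)
    calc Real.exp (-(c * d x)) * (1 + d x) ^ m
        = Real.exp (-(c * d x)) * (1 + d x) ^ (m + 8) * (1 + d x) ^ (-(8 : ℝ)) := by
          rw [mul_assoc, ← Real.rpow_add (by linarith), add_neg_cancel_right]
      _ ≤ K * (1 + ‖x‖) ^ (-(4 : ℝ)) :=
          mul_le_mul (hK _ (d_nonneg x)) decay (by positivity)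
            (le_trans (by positivity) (hK _ (d_nonneg x)))
  refine (lintegral_mono fun x => ENNReal.ofReal_le_ofReal (pointwise x)).trans_lt ?_
  have K_nonneg : 0 ≤ K := le_trans (by positivity) (hK 0 le_rfl)
  simp only [ENNReal.ofReal_mul K_nonneg]
  rw [lintegral_const_mul' _ _ ENNReal.ofReal_ne_top]
  exact ENNReal.mul_lt_top ENNReal.ofReal_lt_top norm_integral

namespace IsConfining

variable {p q c₁ C₁ C₂ L : ℝ} {U : Heis → ℝ}

theorem neg_le (h : IsConfining p c₁ C₁ C₂ L U) (hp : 1 ≤ p) (hc : 0 ≤ c₁) (x : Heis) :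
    -U x ≤ 2 * C₂ + -(c₁ * d x) := by
  have growth := h.lower x 0 (by simpa [d_zero] using d_nonneg x)
  have at_zero := (abs_le.1 h.zero).1
  have : c₁ * d x ≤ c₁ * (rate p L (d x) * d x) := by
    gcongr
    exact le_mul_of_one_le_left (d_nonneg x) (h.one_le_rate hp x)
  rw [d_zero, sub_zero] at growth
  linarith

theorem lintegral_boltzmann_le (h : IsConfining p c₁ C₁ C₂ L U) (hp : 1 ≤ p) (hc : 0 ≤ c₁) :
    ∫⁻ x, boltzmann U x ≤ ENNReal.ofReal (Real.exp (2 * C₂)) *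
      ∫⁻ x, ENNReal.ofReal (Real.exp (-(c₁ * d x))) := by
  rw [← lintegral_const_mul' _ _ ENNReal.ofReal_ne_top]
  refine lintegral_mono fun x => ?_
  rw [← ENNReal.ofReal_mul (Real.exp_pos _).le, ← Real.exp_add]
  exact ENNReal.ofReal_le_ofReal (Real.exp_le_exp.2 (h.neg_le hp hc x))

theorem lintegral_weight_lt_top (h : IsConfining p c₁ C₁ C₂ L U) (hp : 1 ≤ p) (hq : 0 ≤ q)
    (hc : 0 < c₁) : ∫⁻ x, weight p L q U x < ⊤ := by
  have L_nonneg := h.nonneg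
  have pointwise (x : Heis) : weight p L q U x ≤ ENNReal.ofReal (Real.exp (2 * C₂) * (L + 1) ^ q) *
      ENNReal.ofReal (Real.exp (-(c₁ * d x)) * (1 + d x) ^ ((p - 1) * q)) := by
    have := d_nonneg x
    have := h.rate_pos hp x
    have rate_le : rate p L (d x) ≤ (L + 1) * (1 + d x) ^ (p - 1) := by
      have : 1 ≤ (1 + d x) ^ (p - 1) := Real.one_le_rpow (by linarith) (by linarith)
      unfold rate
      nlinarith
    rw [← ENNReal.ofReal_mul (by positivity)]
    refine ENNReal.ofReal_le_ofReal ?_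
    calc Real.exp (-U x) * rate p L (d x) ^ q
        ≤ Real.exp (2 * C₂ + -(c₁ * d x)) * ((L + 1) * (1 + d x) ^ (p - 1)) ^ q := by
          gcongr
          exact h.neg_le hp hc.le x
      _ = _ := by
          rw [Real.exp_add, Real.mul_rpow (by positivity) (by positivity),
            Real.rpow_mul (by positivity)]
          ring
  refine (lintegral_mono pointwise).trans_lt ?_
  rw [lintegral_const_mul' _ _ ENNReal.ofReal_ne_top]
  exact ENNReal.mul_lt_top ENNReal.ofReal_lt_top (lintegral_exp_neg_d_mul_lt_top hc _)

end IsConfining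

end Moments

section FarFromIdentity

variable {p q s c₁ C₁ C₂ L A lam l : ℝ} {U f : Heis → ℝ} {φ : ℝ → ℝ} {x v : Heis}

/-- The displacements from `x` by about `l` that approach the identity by at least `l / 4`. -/
def inward (x : Heis) (l : ℝ) : Set Heis := {v | hnorm v < 2 * l ∧ d (x ⋆ v) ≤ d x - l / 4}

theorem measurableSet_inward : MeasurableSet (inward x l) :=
  (measurableSet_hnorm_lt _).inter
    (measurableSet_le (f := fun v => d (x ⋆ v)) (by fun_prop) measurable_const)

theorem ofReal_le_volume_inward (hl : 0 < l) (hx : l ≤ d x) :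
    ENNReal.ofReal (8 * (l / 40) ^ 4) ≤ volume (inward x l) := by
  obtain ⟨v₀, v₀_le, hv₀⟩ := exists_hmul_d_le x hl hx
  have subset : {u | hnorm u < l / 40} ⊆ (fun u => v₀ ⋆ u) ⁻¹' inward x l := by
    intro u hu
    rw [Set.mem_ofPred_eq] at hu
    refine ⟨(hnorm_hmul_le _ _).trans_lt (by linarith), ?_⟩
    rw [← hmul_assoc]
    linarith [(abs_le.1 (abs_d_hmul_sub_le (x ⋆ v₀) u)).2]
  rw [← volume_hnorm_lt (by positivity)]
  refine (measure_mono subset).trans_eq ?_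
  exact (measurePreserving_hmul_left v₀).measure_preimage measurableSet_inward.nullMeasurableSet

theorem tendsto_exp_neg_mul_rpow {c : ℝ} (hc : 0 < c) (C₂ r s : ℝ) :
    Filter.Tendsto (fun A => Real.exp (-(c * (A / 4)) + C₂) * ((1 + 20 * A) ^ r) ^ s)
      Filter.atTop (nhds 0) := by
  have decay := tendsto_rpow_mul_exp_neg_mul_atTop_nhds_zero (r * s) (c / 80) (by positivity)
  have argument : Filter.Tendsto (fun A : ℝ => 1 + 20 * A) Filter.atTop Filter.atTop :=
    Filter.tendsto_atTop_add_const_left _ _ (Filter.tendsto_id.const_mul_atTop (by norm_num))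
  rw [← mul_zero (Real.exp (c / 80 + C₂))]
  refine ((decay.comp argument).const_mul (Real.exp (c / 80 + C₂))).congr' ?_
  filter_upwards [Filter.eventually_ge_atTop 0] with A hA
  rw [Function.comp_apply, Real.rpow_mul (by positivity), mul_left_comm, ← Real.exp_add, mul_comm]
  ring_nf

theorem IsConfining.weight_le_kernel_hmul (h : IsConfining p c₁ C₁ C₂ L U) (hp : 1 ≤ p)
    (hs : 0 ≤ s) (hc : 0 ≤ c₁) (hA : 0 < A) (hv : v ∈ inward x (A / rate p L (d x))) :
    weight p L s U x ≤
      ENNReal.ofReal (Real.exp (-(c₁ * (A / 4)) + C₂) * ((1 + 20 * A) ^ (p - 1)) ^ s) *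
        kernel p L s U (2 * A) (x ⋆ v) v := by
  have x_pos := h.rate_pos hp x
  have v_nonneg := hnorm_nonneg v
  obtain ⟨v_lt, approach⟩ := hv
  rw [← mul_div_assoc, lt_div_iff₀ x_pos] at v_lt
  have inwards : d (x ⋆ v) ≤ d x := approach.trans (sub_le_self _ (by positivity))
  have dist_le : |d x - d (x ⋆ v)| ≤ 20 * A := by
    rw [abs_sub_comm]
    exact (abs_d_hmul_sub_le x v).trans (by nlinarith [h.one_le_rate hp x])
  have rate_le := rate_le_mul_rate hp h.nonneg (d_nonneg _) (d_nonneg x) dist_le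
  have potential_drop : U (x ⋆ v) - U x ≤ -(c₁ * (A / 4)) + C₂ := by
    have rise_ge : A / 4 ≤ rate p L (d x) * (d x - d (x ⋆ v)) := by
      calc A / 4 = rate p L (d x) * (A / rate p L (d x) / 4) := by field_simp
        _ ≤ _ := by gcongr; linarith
    linarith [h.lower x (x ⋆ v) inwards, mul_le_mul_of_nonneg_left rise_ge hc]
  rw [kernel_of_lt ((mul_le_mul_of_nonneg_left
    (rate_mono hp (d_nonneg _) inwards) v_nonneg).trans_lt v_lt)]
  exact weight_le_mul_weight hs (by positivity) x_pos.le (h.rate_pos hp _).le potential_drop rate_le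

theorem enorm_comp_rpow_le (hq : 1 ≤ q) (hφ : LipschitzWith 1 φ) (a b : ℝ) :
    ‖φ a‖ₑ ^ q ≤ 2 ^ (q - 1) * (‖φ b‖ₑ ^ q + ‖b - a‖ₑ ^ q) := by
  have lipschitz : ‖φ a‖ₑ ≤ ‖φ b‖ₑ + ‖b - a‖ₑ := by
    have := hφ.edist_le_mul a b
    rw [edist_eq_enorm_sub, edist_comm, edist_eq_enorm_sub, ENNReal.coe_one, one_mul] at this
    calc ‖φ a‖ₑ = ‖φ b + (φ a - φ b)‖ₑ := by rw [add_sub_cancel]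
      _ ≤ ‖φ b‖ₑ + ‖φ a - φ b‖ₑ := enorm_add_le _ _
      _ ≤ _ := by gcongr
  exact (ENNReal.rpow_le_rpow lipschitz (by linarith)).trans
    (ENNReal.rpow_add_le_mul_rpow_add_rpow _ _ hq)

theorem lintegral_kernel_hmul (hU : Measurable U) (hrate : ∀ x, 0 < rate p L (d x))
    (hlam : 0 < lam) {P : Heis → ENNReal} (hP : Measurable P) :
    ∫⁻ x, ∫⁻ v, kernel p L (4 + s) U lam (x ⋆ v) v * P (x ⋆ v) =
      8 * ENNReal.ofReal lam ^ 4 * ∫⁻ z, weight p L s U z * P z := by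
  calc ∫⁻ x, ∫⁻ v, kernel p L (4 + s) U lam (x ⋆ v) v * P (x ⋆ v)
      = ∫⁻ v, ∫⁻ x, kernel p L (4 + s) U lam (x ⋆ v) v * P (x ⋆ v) :=
        lintegral_lintegral_swap (by fun_prop)
    _ = ∫⁻ v, ∫⁻ z, kernel p L (4 + s) U lam z v * P z := lintegral_congr fun v =>
        (measurePreserving_hmul_right v).lintegral_comp
          (f := fun z => kernel p L (4 + s) U lam z v * P z) (by fun_prop)
    _ = ∫⁻ z, ∫⁻ v, kernel p L (4 + s) U lam z v * P z :=
        lintegral_lintegral_swap (by fun_prop)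
    _ = ∫⁻ z, 8 * ENNReal.ofReal lam ^ 4 * (weight p L s U z * P z) := by
        refine lintegral_congr fun z => ?_
        rw [lintegral_mul_const _ (by fun_prop), lintegral_kernel (hrate z) hlam, mul_assoc]
    _ = _ := lintegral_const_mul' _ _ (by finiteness)

/-- The points at distance less than `A / H` from the identity. -/
def near (p L A : ℝ) : Set Heis := {x | d x * rate p L (d x) < A}

theorem measurableSet_near : MeasurableSet (near p L A) :=
  measurableSet_lt (f := fun x => d x * rate p L (d x)) (by fun_prop) measurable_const

theorem IsConfining.weight_mul_enorm_rpow_le (h : IsConfining p c₁ C₁ C₂ L U) (hp : 1 ≤ p)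
    (hq : 1 ≤ q) (hc : 0 ≤ c₁) (hA : 0 < A) (hφ : LipschitzWith 1 φ) (hx : x ∉ near p L A) :
    ENNReal.ofReal (8 * (A / 40) ^ 4) * (weight p L q U x * ‖φ (f x)‖ₑ ^ q) ≤
      ∫⁻ v, 2 ^ (q - 1) *
        (ENNReal.ofReal (Real.exp (-(c₁ * (A / 4)) + C₂) * ((1 + 20 * A) ^ (p - 1)) ^ (4 + q)) *
            (kernel p L (4 + q) U (2 * A) (x ⋆ v) v * ‖φ (f (x ⋆ v))‖ₑ ^ q) +
          kernel p L (4 + q) U (2 * A) x v * ‖f (x ⋆ v) - f x‖ₑ ^ q) := by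
  have x_pos := h.rate_pos hp x
  have scale_le : A / rate p L (d x) ≤ d x := by
    rw [div_le_iff₀ x_pos]
    exact not_lt.1 hx
  have volume_ge := ofReal_le_volume_inward (by positivity) scale_le
  calc ENNReal.ofReal (8 * (A / 40) ^ 4) * (weight p L q U x * ‖φ (f x)‖ₑ ^ q)
      = weight p L (4 + q) U x * ‖φ (f x)‖ₑ ^ q *
          ENNReal.ofReal (8 * (A / rate p L (d x) / 40) ^ 4) := by
        have split_constant : ENNReal.ofReal (8 * (A / 40) ^ 4) =
            ENNReal.ofReal (rate p L (d x) ^ (4 : ℝ)) *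
              ENNReal.ofReal (8 * (A / rate p L (d x) / 40) ^ 4) := by
          rw [← ENNReal.ofReal_mul (by positivity)]
          norm_cast
          field_simp
        rw [weight_add x_pos, split_constant]
        ring
    _ ≤ weight p L (4 + q) U x * ‖φ (f x)‖ₑ ^ q * volume (inward x (A / rate p L (d x))) := by
        gcongr
    _ = ∫⁻ _ in inward x (A / rate p L (d x)), weight p L (4 + q) U x * ‖φ (f x)‖ₑ ^ q :=
        (setLIntegral_const _ _).symm
    _ ≤ _ := setLIntegral_mono' measurableSet_inward fun v hv => ?_
    _ ≤ _ := setLIntegral_le_lintegral _ _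
  have v_lt : hnorm v * rate p L (d x) < 2 * A := by
    have := hv.1
    rwa [← mul_div_assoc, lt_div_iff₀ x_pos] at this
  refine (mul_le_mul_right (enorm_comp_rpow_le (hq) hφ (f x) (f (x ⋆ v))) _).trans ?_
  rw [mul_left_comm, mul_add, ← mul_assoc (ENNReal.ofReal _), kernel_of_lt v_lt]
  gcongr
  exact h.weight_le_kernel_hmul hp (by linarith) hc hA hv

theorem IsConfining.setLIntegral_compl_near_le (h : IsConfining p c₁ C₁ C₂ L U) (hp : 1 ≤ p)
    (hq : 1 ≤ q) (hc : 0 ≤ c₁) (hA : 0 < A) (hφ : LipschitzWith 1 φ) (hf : Measurable f) :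
    ENNReal.ofReal (8 * (A / 40) ^ 4) *
        ∫⁻ x in (near p L A)ᶜ, weight p L q U x * ‖φ (f x)‖ₑ ^ q ≤
      2 ^ (q - 1) *
        (ENNReal.ofReal (Real.exp (-(c₁ * (A / 4)) + C₂) * ((1 + 20 * A) ^ (p - 1)) ^ (4 + q)) *
            (8 * ENNReal.ofReal (2 * A) ^ 4 * ∫⁻ x, weight p L q U x * ‖φ (f x)‖ₑ ^ q) +
          oscillation p L q U (2 * A) f) := by
  have hU := h.measurable
  have := hφ.continuous.measurable
  rw [← lintegral_const_mul' _ _ ENNReal.ofReal_ne_top]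
  refine (setLIntegral_mono' measurableSet_near.compl fun x hx =>
    h.weight_mul_enorm_rpow_le hp hq hc hA hφ hx).trans
      ((setLIntegral_le_lintegral _ _).trans_eq ?_)
  have oscillation_meas : Measurable fun z : Heis × Heis =>
      kernel p L (4 + q) U (2 * A) z.1 z.2 * ‖f (z.1 ⋆ z.2) - f z.1‖ₑ ^ q :=
    (measurable_kernel hU measurable_fst measurable_snd).mul (measurable_increment hf)
  have two_pow_ne_top : (2 : ENNReal) ^ (q - 1) ≠ ⊤ := by finiteness
  have inner (x : Heis) := oscillation_meas.comp (measurable_prodMk_left (x := x))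
  simp only [lintegral_const_mul' _ _ two_pow_ne_top]
  simp only [Function.comp_def] at inner
  simp only [lintegral_add_right _ (inner _), lintegral_const_mul' _ _ ENNReal.ofReal_ne_top]
  rw [lintegral_add_right _ oscillation_meas.lintegral_prod_right',
    lintegral_const_mul' _ _ ENNReal.ofReal_ne_top,
    lintegral_kernel_hmul (P := fun x => ‖φ (f x)‖ₑ ^ q) hU (h.rate_pos hp) (by positivity)
      (by fun_prop), oscillation]

theorem two_rpow_mul_ofReal_mul_le {r B : ℝ} (hB : 0 ≤ B) (hA : 0 ≤ A)
    (hBr : B ≤ (2 ^ r * 32 * 40 ^ 4)⁻¹) :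
    2 ^ r * (ENNReal.ofReal B * (8 * ENNReal.ofReal (2 * A) ^ 4)) ≤
      ENNReal.ofReal (8 * (A / 40) ^ 4) * 2⁻¹ := by
  calc _ = ENNReal.ofReal (2 ^ r * (B * (8 * (2 * A) ^ 4))) := by
        rw [ENNReal.ofReal_mul (p := 2 ^ r) (by positivity), ENNReal.ofReal_mul hB,
          ENNReal.ofReal_mul (p := 8) (by positivity), ENNReal.ofReal_pow (by positivity),
          ← ENNReal.ofReal_rpow_of_pos two_pos, ENNReal.ofReal_ofNat, ENNReal.ofReal_ofNat]
    _ ≤ ENNReal.ofReal (8 * (A / 40) ^ 4 * 2⁻¹) := by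
        refine ENNReal.ofReal_le_ofReal ?_
        calc _ ≤ 2 ^ r * ((2 ^ r * 32 * 40 ^ 4)⁻¹ * (8 * (2 * A) ^ 4)) := by gcongr
          _ = _ := by field_simp; norm_num
    _ = _ := by
        rw [ENNReal.ofReal_mul (by positivity), ENNReal.ofReal_inv_of_pos two_pos,
          ENNReal.ofReal_ofNat]

theorem exists_setLIntegral_compl_near_le (hp : 1 ≤ p) (hq : 1 ≤ q) (hc : 0 < c₁) (hC : 0 ≤ C₁)
    (C₂ A₀ : ℝ) :
    ∃ A, A₀ ≤ A ∧ 0 < A ∧ ∃ C ≠ (⊤ : ENNReal), ∀ L U, IsConfining p c₁ C₁ C₂ L U →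
      ∀ f, ContDiff ℝ 1 f → ∀ φ : ℝ → ℝ, LipschitzWith 1 φ →
        ∫⁻ x in (near p L A)ᶜ, weight p L q U x * ‖φ (f x)‖ₑ ^ q ≤
          2⁻¹ * (∫⁻ x, weight p L q U x * ‖φ (f x)‖ₑ ^ q) + C * gradEnergy q U f := by
  obtain ⟨A, ⟨A_large, A_pos⟩, B_small⟩ := ((Filter.eventually_ge_atTop A₀).and
    (Filter.eventually_gt_atTop 0)).and ((tendsto_exp_neg_mul_rpow hc C₂ (p - 1)
      (4 + q)).eventually_le_const (u := (2 ^ (q - 1) * 32 * 40 ^ 4)⁻¹) (by positivity)) |>.exists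
  obtain ⟨C, C_ne_top, oscillation_le⟩ :=
    exists_oscillation_le (C₂ := C₂) (Lam := 2 * A) hp hq hc.le hC (by positivity)
  set B := Real.exp (-(c₁ * (A / 4)) + C₂) * ((1 + 20 * A) ^ (p - 1)) ^ (4 + q)
  set σ := ENNReal.ofReal (8 * (A / 40) ^ 4)
  have σ_ne_zero : σ ≠ 0 := (ENNReal.ofReal_pos.2 (by positivity)).ne'
  have σ_ne_top : σ ≠ ⊤ := ENNReal.ofReal_ne_top
  have coefficient_le :
      2 ^ (q - 1) * (ENNReal.ofReal B * (8 * ENNReal.ofReal (2 * A) ^ 4)) ≤ σ * 2⁻¹ :=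
    two_rpow_mul_ofReal_mul_le (by positivity) A_pos.le B_small
  refine ⟨A, A_large, A_pos, σ⁻¹ * (2 ^ (q - 1) * (C * ENNReal.ofReal (2 * A) ^ (4 + q))),
    by finiteness, fun L U h f hf φ hφ => ?_⟩
  set Y := ∫⁻ x, weight p L q U x * ‖φ (f x)‖ₑ ^ q
  rw [← ENNReal.mul_le_mul_iff_right σ_ne_zero σ_ne_top]
  calc σ * ∫⁻ x in (near p L A)ᶜ, weight p L q U x * ‖φ (f x)‖ₑ ^ q
      ≤ 2 ^ (q - 1) * (ENNReal.ofReal B * (8 * ENNReal.ofReal (2 * A) ^ 4 * Y) +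
          C * ENNReal.ofReal (2 * A) ^ (4 + q) * gradEnergy q U f) :=
        (h.setLIntegral_compl_near_le hp hq hc.le A_pos hφ hf.continuous.measurable).trans
          (by gcongr; exact oscillation_le L U h f hf _ (by positivity) le_rfl)
    _ = 2 ^ (q - 1) * (ENNReal.ofReal B * (8 * ENNReal.ofReal (2 * A) ^ 4)) * Y +
          2 ^ (q - 1) * (C * ENNReal.ofReal (2 * A) ^ (4 + q)) * gradEnergy q U f := by ring
    _ ≤ σ * 2⁻¹ * Y + 2 ^ (q - 1) * (C * ENNReal.ofReal (2 * A) ^ (4 + q)) *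
          gradEnergy q U f := by gcongr
    _ = _ := by
        rw [mul_add, ← mul_assoc σ, ← mul_assoc σ (σ⁻¹ * _), ← mul_assoc σ σ⁻¹,
          ENNReal.mul_inv_cancel σ_ne_zero σ_ne_top, one_mul]

end FarFromIdentity

/-! ### The weighted Poincaré inequality -/

section NearIdentity

variable {p q c₁ C₁ C₂ L A : ℝ} {U f : Heis → ℝ} {x y : Heis}

theorem d_lt_of_mem_near (hp : 1 ≤ p) (hL : 0 ≤ L) (hx : x ∈ near p L A) : d x < A :=
  (le_mul_of_one_le_right (d_nonneg x) (one_le_rate hp hL (d_nonneg x))).trans_lt hx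

theorem hnorm_mul_rate_lt_of_mem_near (hp : 1 ≤ p) (hL : 0 ≤ L) (hx : x ∈ near p L A)
    (hy : y ∈ near p L A) :
    hnorm (-x ⋆ y) * rate p L (d x) < A * (1 + (1 + A) ^ (p - 1)) := by
  have x_lt := d_lt_of_mem_near hp hL hx
  have y_lt := d_lt_of_mem_near hp hL hy
  have := d_nonneg x
  have := d_nonneg y
  have rate_le : rate p L (d x) ≤ (1 + A) ^ (p - 1) * rate p L (d y) :=
    rate_le_mul_rate hp hL (d_nonneg y) (d_nonneg x) (abs_le.2 ⟨by linarith, by linarith⟩)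
  have displacement_le : hnorm (-x ⋆ y) ≤ d x + d y := by
    refine (hnorm_hmul_le _ _).trans (add_le_add ?_ (hnorm_le_d y))
    rw [hnorm_neg]
    exact hnorm_le_d x
  have x_pos := one_pos.trans_le (one_le_rate hp hL (d_nonneg x))
  calc hnorm (-x ⋆ y) * rate p L (d x) ≤ (d x + d y) * rate p L (d x) := by gcongr
    _ = d x * rate p L (d x) + d y * rate p L (d x) := by ring
    _ ≤ d x * rate p L (d x) + d y * ((1 + A) ^ (p - 1) * rate p L (d y)) := by gcongr
    _ = d x * rate p L (d x) + (1 + A) ^ (p - 1) * (d y * rate p L (d y)) := by ring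
    _ < A + (1 + A) ^ (p - 1) * A :=
        add_lt_add_of_lt_of_le hx (mul_le_mul_of_nonneg_left hy.le
          (Real.rpow_nonneg (by linarith) _))
    _ = A * (1 + (1 + A) ^ (p - 1)) := by ring

theorem ofReal_le_volume_near (hp : 1 ≤ p) (hL : 0 ≤ L) (hA : 2 ^ (p - 1) ≤ A) :
    ENNReal.ofReal (8 * (1 / (10 * rate p L 0)) ^ 4) ≤ volume (near p L A) := by
  have rate_ge := one_le_rate hp hL le_rfl
  rw [← volume_hnorm_lt (by positivity)]
  refine measure_mono fun x hx => ?_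
  rw [Set.mem_ofPred_eq, lt_div_iff₀ (by positivity)] at hx
  have scaled_lt : d x * rate p L 0 < 1 := by nlinarith [d_le_hnorm x]
  have x_le : |d x - 0| ≤ 1 := by
    rw [sub_zero, abs_of_nonneg (d_nonneg x)]
    nlinarith [d_nonneg x]
  have rate_le : rate p L (d x) ≤ (1 + 1) ^ (p - 1) * rate p L 0 :=
    rate_le_mul_rate hp hL le_rfl (d_nonneg x) x_le
  have := d_nonneg x
  calc d x * rate p L (d x) ≤ d x * ((1 + 1) ^ (p - 1) * rate p L 0) := by gcongr
    _ = 2 ^ (p - 1) * (d x * rate p L 0) := by ring_nf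
    _ < 2 ^ (p - 1) * 1 := by gcongr
    _ ≤ A := by rwa [mul_one]

theorem volume_near_lt_top (hp : 1 ≤ p) (hL : 0 ≤ L) (hA : 0 < A) : volume (near p L A) < ⊤ := by
  have subset : near p L A ⊆ {x | hnorm x < A} := fun x hx =>
    (hnorm_le_d x).trans_lt (d_lt_of_mem_near hp hL hx)
  refine (measure_mono subset).trans_lt ?_
  rw [volume_hnorm_lt hA]
  exact ENNReal.ofReal_lt_top

theorem ofReal_mul_weight_le (hp : 1 ≤ p) (hL : 0 ≤ L) :
    ENNReal.ofReal (rate p L 0 ^ 4) * weight p L q U x ≤ weight p L (4 + q) U x := by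
  have zero_ge := one_le_rate hp hL le_rfl
  rw [weight_add (one_pos.trans_le (one_le_rate hp hL (d_nonneg x)))]
  norm_cast
  gcongr
  exact rate_mono hp le_rfl (d_nonneg x)

theorem ofReal_mul_setLIntegral_near_le (hp : 1 ≤ p) (hL : 0 ≤ L) (hU : Measurable U)
    (hf : Measurable f) :
    ENNReal.ofReal (rate p L 0 ^ 4) *
        ∫⁻ y in near p L A, ∫⁻ x in near p L A, weight p L q U x * ‖f x - f y‖ₑ ^ q ≤
      oscillation p L q U (A * (1 + (1 + A) ^ (p - 1))) f := by
  set lam := A * (1 + (1 + A) ^ (p - 1))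
  have pointwise (x) (hx : x ∈ near p L A) (y) (hy : y ∈ near p L A) :
      ENNReal.ofReal (rate p L 0 ^ 4) * (weight p L q U x * ‖f x - f y‖ₑ ^ q) ≤
        kernel p L (4 + q) U lam x (-x ⋆ y) * ‖f y - f x‖ₑ ^ q := by
    rw [kernel_of_lt (hnorm_mul_rate_lt_of_mem_near hp hL hx hy), ← mul_assoc, ← enorm_neg,
      neg_sub]
    gcongr
    exact ofReal_mul_weight_le hp hL
  calc _ = ∫⁻ x in near p L A, ∫⁻ y in near p L A,
          ENNReal.ofReal (rate p L 0 ^ 4) * (weight p L q U x * ‖f x - f y‖ₑ ^ q) := by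
        rw [lintegral_lintegral_swap (by fun_prop)]
        simp only [lintegral_const_mul' _ _ ENNReal.ofReal_ne_top]
    _ ≤ ∫⁻ x in near p L A, ∫⁻ y in near p L A,
          kernel p L (4 + q) U lam x (-x ⋆ y) * ‖f y - f x‖ₑ ^ q :=
        setLIntegral_mono' measurableSet_near fun x hx =>
          setLIntegral_mono' measurableSet_near (pointwise x hx)
    _ ≤ ∫⁻ x, ∫⁻ y, kernel p L (4 + q) U lam x (-x ⋆ y) * ‖f y - f x‖ₑ ^ q :=
        (setLIntegral_le_lintegral _ _).trans
          (lintegral_mono fun x => setLIntegral_le_lintegral _ _)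
    _ = oscillation p L q U lam f := lintegral_congr fun x => by
        rw [← (measurePreserving_hmul_left x).lintegral_comp (by fun_prop)]
        simp only [← hmul_assoc, neg_hmul_self, zero_hmul]

theorem exists_setLIntegral_near_le (hp : 1 ≤ p) (hq : 1 ≤ q) (hc : 0 ≤ c₁) (hC : 0 ≤ C₁)
    (C₂ : ℝ) (hA : 2 ^ (p - 1) ≤ A) :
    ∃ C ≠ (⊤ : ENNReal), ∀ L U, IsConfining p c₁ C₁ C₂ L U → ∀ f, ContDiff ℝ 1 f →
      ∃ m : ℝ, ∫⁻ x in near p L A, weight p L q U x * ‖f x - m‖ₑ ^ q ≤ C * gradEnergy q U f := by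
  have A_pos : 0 < A := (by positivity : (0 : ℝ) < 2 ^ (p - 1)).trans_le hA
  set lam := A * (1 + (1 + A) ^ (p - 1))
  have lam_pos : 0 < lam := by positivity
  obtain ⟨C, C_ne_top, oscillation_le⟩ :=
    exists_oscillation_le (C₂ := C₂) (Lam := lam) hp hq hc hC lam_pos.le
  refine ⟨C * ENNReal.ofReal lam ^ (4 + q) * ENNReal.ofReal (10 ^ 4 / 8), by finiteness,
    fun L U h f hf => ?_⟩
  have hU := h.measurable
  have hf' := hf.continuous.measurable
  have volume_ge := ofReal_le_volume_near hp h.nonneg hA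
  have rate_pos := one_pos.trans_le (one_le_rate hp h.nonneg le_rfl)
  have volume_ne_zero : volume (near p L A) ≠ 0 :=
    (lt_of_lt_of_le (ENNReal.ofReal_pos.2 (by positivity)) volume_ge).ne'
  have slice_meas : Measurable fun y =>
      ∫⁻ x in near p L A, weight p L q U x * ‖f x - f y‖ₑ ^ q := by
    fun_prop
  obtain ⟨y, -, below_average⟩ := exists_le_setLAverage volume_ne_zero
    (volume_near_lt_top hp h.nonneg A_pos).ne slice_meas.aemeasurable
  refine ⟨f y, below_average.trans ?_⟩
  rw [setLAverage_eq]
  refine ENNReal.div_le_of_le_mul ?_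
  rw [← ENNReal.mul_le_mul_iff_right (a := ENNReal.ofReal (rate p L 0 ^ 4))
    (ENNReal.ofReal_pos.2 (by positivity)).ne' ENNReal.ofReal_ne_top]
  calc _ ≤ C * ENNReal.ofReal lam ^ (4 + q) * gradEnergy q U f :=
        (ofReal_mul_setLIntegral_near_le hp h.nonneg hU hf').trans
          (oscillation_le L U h f hf lam lam_pos le_rfl)
    _ = C * ENNReal.ofReal lam ^ (4 + q) * gradEnergy q U f *
          (ENNReal.ofReal (rate p L 0 ^ 4) * (ENNReal.ofReal (10 ^ 4 / 8) *
            ENNReal.ofReal (8 * (1 / (10 * rate p L 0)) ^ 4))) := by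
        rw [← ENNReal.ofReal_mul (by positivity), ← ENNReal.ofReal_mul (by positivity)]
        field_simp
        norm_num
    _ ≤ C * ENNReal.ofReal lam ^ (4 + q) * gradEnergy q U f *
          (ENNReal.ofReal (rate p L 0 ^ 4) *
            (ENNReal.ofReal (10 ^ 4 / 8) * volume (near p L A))) := by gcongr
    _ = _ := by ring

end NearIdentity

section Poincare

variable {p q c₁ C₁ C₂ L : ℝ} {U : Heis → ℝ}

theorem IsConfining.lintegral_weight_mul_lt_top (h : IsConfining p c₁ C₁ C₂ L U) (hp : 1 ≤ p)
    (hq : 0 ≤ q) (hc : 0 < c₁) {g : Heis → ℝ} {R : ℝ} (hg : ∀ x, |g x| ≤ R) :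
    ∫⁻ x, weight p L q U x * ‖g x‖ₑ ^ q < ⊤ := by
  calc ∫⁻ x, weight p L q U x * ‖g x‖ₑ ^ q
      ≤ ∫⁻ x, weight p L q U x * ENNReal.ofReal R ^ q := by
        gcongr with x
        rw [Real.enorm_eq_ofReal_abs]
        exact ENNReal.ofReal_le_ofReal (hg x)
    _ = (∫⁻ x, weight p L q U x) * ENNReal.ofReal R ^ q :=
        lintegral_mul_const' _ _ (by finiteness)
    _ < ⊤ := ENNReal.mul_lt_top (h.lintegral_weight_lt_top hp hq hc) (by finiteness)

theorem exists_weighted_poincare (hp : 1 ≤ p) (hq : 1 ≤ q) (hc : 0 < c₁) (hC : 0 ≤ C₁) (C₂ : ℝ) :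
    ∃ C ≠ (⊤ : ENNReal), ∀ L U, IsConfining p c₁ C₁ C₂ L U → ∀ f, ContDiff ℝ 1 f →
      ∃ m : ℝ, ∫⁻ x, weight p L q U x * ‖f x - m‖ₑ ^ q ≤ C * gradEnergy q U f := by
  obtain ⟨A, A_large, -, C, C_ne_top, far_le⟩ :=
    exists_setLIntegral_compl_near_le hp hq hc hC C₂ (2 ^ (p - 1))
  obtain ⟨C', C'_ne_top, near_le⟩ := exists_setLIntegral_near_le hp hq hc.le hC C₂ A_large
  refine ⟨2 * (C' + C), by finiteness, fun L U h f hf => ?_⟩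
  obtain ⟨m, hm⟩ := near_le L U h f hf
  refine ⟨m, lintegral_mul_enorm_rpow_le_of_clip (measurable_weight h.measurable)
    (hf.continuous.measurable.sub_const m) fun n => ?_⟩
  have n_nonneg : (0 : ℝ) ≤ n := n.cast_nonneg
  have lipschitz : LipschitzWith 1 fun t => clip n (t - m) := by
    simpa [Function.comp_def] using
      (lipschitzWith_clip n).comp (LipschitzWith.id.sub (LipschitzWith.const m))
  set Y := ∫⁻ x, weight p L q U x * ‖clip n (f x - m)‖ₑ ^ q with hY
  have Y_finite : Y < ⊤ :=
    h.lintegral_weight_mul_lt_top hp (by linarith) hc fun x => abs_clip_le n_nonneg (f x - m)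
  have near_clip_le : ∫⁻ x in near p L A, weight p L q U x * ‖clip n (f x - m)‖ₑ ^ q ≤
      C' * gradEnergy q U f := by
    refine (lintegral_mono fun x => ?_).trans hm
    gcongr 2
    rw [enorm_le_iff_norm_le]
    exact abs_clip_le_abs n_nonneg _
  have absorb : 2⁻¹ * Y + 2⁻¹ * Y ≤ 2⁻¹ * Y + (C' + C) * gradEnergy q U f := by
    calc 2⁻¹ * Y + 2⁻¹ * Y = Y := by rw [← add_mul, ENNReal.inv_two_add_inv_two, one_mul]
      _ ≤ C' * gradEnergy q U f + (2⁻¹ * Y + C * gradEnergy q U f) := by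
          conv_lhs => rw [hY,
            ← lintegral_add_compl _ (measurableSet_near (p := p) (L := L) (A := A))]
          exact add_le_add near_clip_le (far_le L U h f hf _ lipschitz)
      _ = _ := by ring
  have half_le := ENNReal.le_of_add_le_add_left (by finiteness) absorb
  calc Y = 2 * (2⁻¹ * Y) := by
        rw [← mul_assoc, ENNReal.mul_inv_cancel (by simp) (by simp), one_mul]
    _ ≤ 2 * ((C' + C) * gradEnergy q U f) := by gcongr
    _ = _ := (mul_assoc _ _ _).symm

end Poincare

/-! ### The logarithmic Sobolev inequality -/

section Entropy

theorem sixteen_pow_mul_half_pow (k : ℕ) : (16 : ℝ) ^ k * ((1 / 2) ^ k) ^ 4 = 1 := by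
  rw [← pow_mul, mul_comm k 4, pow_mul, ← mul_pow]
  norm_num

theorem exists_pow_le_and_posLog_le {R : ℝ} (hR : 1 ≤ R) :
    ∃ k : ℕ, 16 ^ k ≤ R ∧ Real.posLog R ≤ 4 * (k + 1) := by
  obtain ⟨k, pow_le, lt_pow⟩ := exists_nat_pow_near hR (by norm_num : (1 : ℝ) < 16)
  have log_sixteen_le : Real.posLog 16 ≤ 4 := by
    rw [show (16 : ℝ) = 2 ^ 4 by norm_num, Real.posLog_pow, Real.posLog_eq_log (by norm_num)]
    norm_num
    linarith [Real.log_two_lt_d9]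
  refine ⟨k, pow_le, ?_⟩
  calc Real.posLog R ≤ Real.posLog (16 ^ (k + 1)) :=
        Real.posLog_le_posLog (by linarith) lt_pow.le
    _ = (k + 1) * Real.posLog 16 := by rw [Real.posLog_pow, Nat.cast_add_one]
    _ ≤ 4 * (k + 1) := by nlinarith [k.cast_nonneg (α := ℝ)]

variable {p q c₁ C₁ C₂ L lam : ℝ} {U : Heis → ℝ}

/-- A bound for the increase of a confining potential along displacements `v` with
`hnorm v * H ≤ 1`, for which `d` changes by at most `10 * hnorm v` and `H` by a factor at most
`11 ^ (p - 1)`. -/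
def unitIncrement (p C₁ C₂ : ℝ) : ℝ := C₁ * (11 ^ (p - 1) * 10) + C₂

namespace IsConfining

theorem rate_mul_d_le (h : IsConfining p c₁ C₁ C₂ L U) (hp : 1 ≤ p) (hq : 1 ≤ q)
    (hpq : (p - 1) * (q - 1) = 1) (x : Heis) :
    rate p L (d x) * d x ≤ rate p L (d x) ^ q := by
  have rate_pos := h.rate_pos hp x
  have dist_nonneg := d_nonneg x
  have d_le : d x ≤ rate p L (d x) ^ (q - 1) := by
    calc d x ≤ ((1 + d x) ^ (p - 1)) ^ (q - 1) := by
          rw [← Real.rpow_mul (by linarith), hpq, Real.rpow_one]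
          linarith
      _ ≤ rate p L (d x) ^ (q - 1) :=
          Real.rpow_le_rpow (by positivity) (le_add_of_nonneg_left h.nonneg) (by linarith)
  calc rate p L (d x) * d x ≤ rate p L (d x) * rate p L (d x) ^ (q - 1) := by gcongr
    _ = rate p L (d x) ^ q := by rw [mul_comm, ← Real.rpow_add_one rate_pos.ne', sub_add_cancel]

theorem C₂_nonneg (h : IsConfining p c₁ C₁ C₂ L U) : 0 ≤ C₂ := (abs_nonneg _).trans h.zero

theorem posLog_le (h : IsConfining p c₁ C₁ C₂ L U) (hp : 1 ≤ p) (hq : 1 ≤ q)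
    (hpq : (p - 1) * (q - 1) = 1) (hC : 0 ≤ C₁) {C₃ Z : ℝ} (hC₃ : 0 ≤ C₃) (hZ : 0 < Z)
    (x : Heis) :
    Real.posLog (Real.exp C₃ * Z * rate p L (d x) ^ (4 : ℝ) * Real.exp (U x)) ≤
      (C₃ + Real.posLog Z + C₁ + 2 * C₂ + 4) * rate p L (d x) ^ q := by
  have C₂_nonneg := h.C₂_nonneg
  have posLog_Z_nonneg : 0 ≤ Real.posLog Z := Real.posLog_nonneg
  set H := rate p L (d x) with hH
  have H_pos : 0 < H := h.rate_pos hp x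
  have H_le : H ≤ H ^ q := Real.self_le_rpow_of_one_le (h.one_le_rate hp x) hq
  have one_le : 1 ≤ H ^ q := (h.one_le_rate hp x).trans H_le
  have potential_le : U x ≤ C₁ * H ^ q + 2 * C₂ := by
    have from_zero := h.upper x 0 (d_zero.trans_le (d_nonneg x))
    rw [d_zero, sub_zero, ← hH] at from_zero
    have := mul_le_mul_of_nonneg_left (h.rate_mul_d_le hp hq hpq x) hC
    linarith [(abs_le.1 h.zero).2]
  have log_H_le : Real.log H ≤ H ^ q := by linarith [Real.log_le_sub_one_of_pos H_pos]
  have log_Z_le : Real.log Z ≤ Real.posLog Z := le_max_right _ _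
  refine max_le (by positivity) ?_
  rw [Real.log_mul (by positivity) (by positivity), Real.log_mul (by positivity) (by positivity),
    Real.log_mul (by positivity) (by positivity), Real.log_exp, Real.log_exp, Real.log_rpow H_pos]
  nlinarith [mul_le_mul_of_nonneg_left one_le
    (by positivity : 0 ≤ C₃ + Real.posLog Z + 2 * C₂)]

theorem kernel_le_boltzmann (h : IsConfining p c₁ C₁ C₂ L U) (hp : 1 ≤ p) (hc : 0 ≤ c₁)
    (hC : 0 ≤ C₁) (hlam : lam ≤ 1) (x v : Heis) :
    kernel p L 4 U lam x v ≤
      ENNReal.ofReal (Real.exp (unitIncrement p C₁ C₂) * rate p L (d x) ^ (4 : ℝ)) *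
        boltzmann U (x ⋆ v) := by
  rcases lt_or_ge (hnorm v * rate p L (d x)) lam with hv | hv
  swap
  · simp [kernel_of_ge hv]
  have rate_pos := h.rate_pos hp x
  have v_nonneg := hnorm_nonneg v
  have v_le : hnorm v ≤ 1 := by nlinarith [h.one_le_rate hp x]
  have potential_le : U (x ⋆ v) - U x ≤ unitIncrement p C₁ C₂ := by
    refine (h.sub_le hp hc hC (abs_d_hmul_sub_le x v)).trans ?_
    have : 0 ≤ p - 1 := by linarith
    unfold unitIncrement
    gcongr <;> linarith
  rw [kernel_of_lt hv, weight, boltzmann, ← ENNReal.ofReal_mul (by positivity), mul_right_comm,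
    ← Real.exp_add]
  gcongr
  linarith

theorem lintegral_kernel_mul_le (h : IsConfining p c₁ C₁ C₂ L U) (hp : 1 ≤ p) (hc : 0 ≤ c₁)
    (hC : 0 ≤ C₁) (hlam : lam ≤ 1) (x : Heis) {φ : Heis → ENNReal} (hφ : Measurable φ) :
    ∫⁻ v, kernel p L 4 U lam x v * φ (x ⋆ v) ≤
      ENNReal.ofReal (Real.exp (unitIncrement p C₁ C₂) * rate p L (d x) ^ (4 : ℝ)) *
        ∫⁻ y, boltzmann U y * φ y := by
  have product_measurable : Measurable fun y => boltzmann U y * φ y :=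
    (measurable_boltzmann h.measurable).mul hφ
  rw [← (measurePreserving_hmul_left x).lintegral_comp product_measurable,
    ← lintegral_const_mul' _ _ ENNReal.ofReal_ne_top]
  refine lintegral_mono fun v => ?_
  rw [← mul_assoc]
  gcongr
  exact h.kernel_le_boltzmann hp hc hC hlam x v

theorem boltzmann_mul_enorm_le (h : IsConfining p c₁ C₁ C₂ L U) (hp : 1 ≤ p) (hq : 1 ≤ q)
    (hq2 : q ≤ 2) (hlam : 0 < lam) {f : Heis → ℝ} (hf : Measurable f) (x : Heis) :
    8 * (ENNReal.ofReal lam ^ 4 * (boltzmann U x * ‖f x‖ₑ ^ q)) ≤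
      2 * (∫⁻ v, kernel p L 4 U lam x v * ‖f (x ⋆ v)‖ₑ ^ q) +
        2 * ∫⁻ v, kernel p L 4 U lam x v * ‖f (x ⋆ v) - f x‖ₑ ^ q := by
  have kernel_measurable : Measurable (kernel p L 4 U lam x) :=
    measurable_kernel h.measurable measurable_const measurable_id
  have two_rpow_le : (2 : ENNReal) ^ (q - 1) ≤ 2 := by
    simpa using ENNReal.rpow_le_rpow_of_exponent_le one_le_two (by linarith : q - 1 ≤ 1)
  have mass : ∫⁻ v, kernel p L 4 U lam x v = 8 * ENNReal.ofReal lam ^ 4 * boltzmann U x := by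
    simpa only [add_zero, weight_zero] using
      lintegral_kernel (s := 0) (U := U) (h.rate_pos hp x) hlam
  calc 8 * (ENNReal.ofReal lam ^ 4 * (boltzmann U x * ‖f x‖ₑ ^ q))
      = ∫⁻ v, kernel p L 4 U lam x v * ‖f x‖ₑ ^ q := by
        rw [lintegral_mul_const _ kernel_measurable, mass]
        ring
    _ ≤ ∫⁻ v, (2 * (kernel p L 4 U lam x v * ‖f (x ⋆ v)‖ₑ ^ q) +
          2 * (kernel p L 4 U lam x v * ‖f (x ⋆ v) - f x‖ₑ ^ q)) := by
        refine lintegral_mono fun v => ?_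
        calc kernel p L 4 U lam x v * ‖f x‖ₑ ^ q
            ≤ kernel p L 4 U lam x v * (2 * (‖f (x ⋆ v)‖ₑ ^ q + ‖f (x ⋆ v) - f x‖ₑ ^ q)) := by
              gcongr
              exact (enorm_comp_rpow_le hq LipschitzWith.id (f x) (f (x ⋆ v))).trans
                (mul_le_mul_left two_rpow_le _)
          _ = _ := by ring
    _ = _ := by
        rw [lintegral_add_left (by fun_prop), lintegral_const_mul' _ _ (by simp),
          lintegral_const_mul' _ _ (by simp)]

theorem weight_mono (h : IsConfining p c₁ C₁ C₂ L U) (hp : 1 ≤ p) {s t : ℝ} (hst : s ≤ t)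
    (x : Heis) : weight p L s U x ≤ weight p L t U x := by
  unfold weight
  gcongr
  exact h.one_le_rate hp x

theorem kernel_mono (h : IsConfining p c₁ C₁ C₂ L U) (hp : 1 ≤ p) {s t : ℝ} (hst : s ≤ t)
    (x v : Heis) : kernel p L s U lam x v ≤ kernel p L t U lam x v := by
  unfold kernel
  split_ifs
  exacts [h.weight_mono hp hst x, le_rfl]

theorem boltzmann_mul_le_of_large (h : IsConfining p c₁ C₁ C₂ L U) (hp : 1 ≤ p) (hq : 1 ≤ q)
    (hq2 : q ≤ 2) (hc : 0 ≤ c₁) (hC : 0 ≤ C₁) (hlam : 0 < lam) (hlam1 : lam ≤ 1) {f : Heis → ℝ}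
    (hf : Measurable f) {x : Heis}
    (large : ENNReal.ofReal (Real.exp (unitIncrement p C₁ C₂) *
        rate p L (d x) ^ (4 : ℝ)) * ∫⁻ y, boltzmann U y * ‖f y‖ₑ ^ q ≤
      ENNReal.ofReal lam ^ 4 * (boltzmann U x * ‖f x‖ₑ ^ q)) :
    ENNReal.ofReal lam ^ 4 * (boltzmann U x * ‖f x‖ₑ ^ q) ≤
      ∫⁻ v, kernel p L (4 + q) U lam x v * ‖f (x ⋆ v) - f x‖ₑ ^ q := by
  have average_le := h.boltzmann_mul_enorm_le hp hq hq2 hlam hf x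
  have translated_le := (h.lintegral_kernel_mul_le hp hc hC hlam1 x
    (φ := fun y => ‖f y‖ₑ ^ q) (by fun_prop)).trans large
  set A := ENNReal.ofReal lam ^ 4 * (boltzmann U x * ‖f x‖ₑ ^ q)
  set Y := ∫⁻ v, kernel p L 4 U lam x v * ‖f (x ⋆ v) - f x‖ₑ ^ q
  have A_ne_top : A ≠ ⊤ := by
    have : boltzmann U x ≠ ⊤ := ENNReal.ofReal_ne_top
    finiteness
  have absorb : 2 * A + 2 * A ≤ 2 * A + 2 * Y := by
    calc 2 * A + 2 * A = 4 * A := by ring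
      _ ≤ 8 * A := by gcongr; norm_num
      _ ≤ 2 * A + 2 * Y := average_le.trans (by gcongr)
  have A_le : A ≤ Y := (ENNReal.mul_le_mul_iff_right (by simp) (by simp)).1
    (ENNReal.le_of_add_le_add_left (by finiteness) absorb)
  refine A_le.trans (lintegral_mono fun v => ?_)
  gcongr
  exact h.kernel_mono hp (by linarith) x v

/-- The dyadic decomposition of the logarithm: where `e^{-U} |f|^q` is between `16 ^ k` and
`16 ^ (k + 1)` times its reference level `A`, it is controlled at the scale `2 ^ (-k)`. -/
theorem boltzmann_mul_posLog_le (h : IsConfining p c₁ C₁ C₂ L U) (hp : 1 ≤ p) (hq : 1 ≤ q)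
    (hq2 : q ≤ 2) (hc : 0 ≤ c₁) (hC : 0 ≤ C₁) {f : Heis → ℝ} (hf : Measurable f) {x : Heis}
    {A : ℝ} (hA : 0 < A)
    (mean_le : ENNReal.ofReal (Real.exp (unitIncrement p C₁ C₂) *
        rate p L (d x) ^ (4 : ℝ)) * ∫⁻ y, boltzmann U y * ‖f y‖ₑ ^ q ≤ ENNReal.ofReal A) :
    boltzmann U x * ‖f x‖ₑ ^ q * ENNReal.ofReal (Real.posLog (Real.exp (-U x) * |f x| ^ q / A)) ≤
      ∑' k : ℕ, ENNReal.ofReal (4 * (k + 1) * 16 ^ k) *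
        ∫⁻ v, kernel p L (4 + q) U ((1 / 2) ^ k) x v * ‖f (x ⋆ v) - f x‖ₑ ^ q := by
  set R := Real.exp (-U x) * |f x| ^ q / A with hR
  have R_nonneg : 0 ≤ R := by positivity
  rcases le_or_gt R 1 with R_le | R_gt
  · simp [(Real.posLog_eq_zero_iff R).2 (by rwa [abs_of_nonneg R_nonneg])]
  obtain ⟨k, pow_le, log_le⟩ := exists_pow_le_and_posLog_le R_gt.le
  have boltzmann_mul : boltzmann U x * ‖f x‖ₑ ^ q =
      ENNReal.ofReal (Real.exp (-U x) * |f x| ^ q) := by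
    rw [boltzmann, Real.enorm_eq_ofReal_abs,
      ENNReal.ofReal_rpow_of_nonneg (abs_nonneg _) (by linarith),
      ← ENNReal.ofReal_mul (Real.exp_pos _).le]
  have large := h.boltzmann_mul_le_of_large hp hq hq2 hc hC (lam := (1 / 2) ^ k) (by positivity)
    (pow_le_one₀ (by norm_num) (by norm_num)) hf (x := x) (by
      refine mean_le.trans ?_
      rw [boltzmann_mul, ← ENNReal.ofReal_pow (by positivity), ← ENNReal.ofReal_mul (by positivity)]
      refine ENNReal.ofReal_le_ofReal ?_
      rw [hR, le_div_iff₀ hA] at pow_le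
      calc A = ((1 / 2) ^ k) ^ 4 * (16 ^ k * A) := by
            linear_combination -A * sixteen_pow_mul_half_pow k
        _ ≤ _ := by gcongr)
  refine le_trans ?_ (ENNReal.le_tsum k)
  calc boltzmann U x * ‖f x‖ₑ ^ q * ENNReal.ofReal (Real.posLog R)
      ≤ boltzmann U x * ‖f x‖ₑ ^ q * ENNReal.ofReal (4 * (k + 1)) := by gcongr
    _ = ENNReal.ofReal (4 * (k + 1) * 16 ^ k) *
          (ENNReal.ofReal ((1 / 2) ^ k) ^ 4 * (boltzmann U x * ‖f x‖ₑ ^ q)) := by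
        rw [← ENNReal.ofReal_pow (by positivity), ← mul_assoc,
          ← ENNReal.ofReal_mul (by positivity), mul_assoc _ (16 ^ k), sixteen_pow_mul_half_pow,
          mul_one, mul_comm]
    _ ≤ _ := by gcongr

/-- The entropy density splits into a weighted term, since `log (1 / μ)` is at most of order
`H ^ q`, and a sum over scales. -/
theorem boltzmann_mul_posLog_div_le (h : IsConfining p c₁ C₁ C₂ L U) (hp : 1 ≤ p) (hq : 1 ≤ q)
    (hq2 : q ≤ 2) (hpq : (p - 1) * (q - 1) = 1) (hc : 0 ≤ c₁) (hC : 0 ≤ C₁) {Z : ℝ} (hZ : 0 < Z)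
    (mass_le : ∫⁻ x, boltzmann U x ≤ ENNReal.ofReal Z) {f : Heis → ℝ} (hf : Measurable f)
    {t : ℝ} (ht : 0 < t)
    (moment_le : ∫⁻ x, boltzmann U x * ‖f x‖ₑ ^ q ≤ ENNReal.ofReal t * ∫⁻ x, boltzmann U x)
    (x : Heis) :
    boltzmann U x * (‖f x‖ₑ ^ q * ENNReal.ofReal (Real.posLog (|f x| ^ q / t))) ≤
      ENNReal.ofReal (unitIncrement p C₁ C₂ + Real.posLog Z + C₁ + 2 * C₂ + 4) *
        (weight p L q U x * ‖f x‖ₑ ^ q) +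
      ∑' k : ℕ, ENNReal.ofReal (4 * (k + 1) * 16 ^ k) *
        ∫⁻ v, kernel p L (4 + q) U ((1 / 2) ^ k) x v * ‖f (x ⋆ v) - f x‖ₑ ^ q := by
  set H := rate p L (d x)
  have H_pos : 0 < H := h.rate_pos hp x
  have C₂_nonneg := h.C₂_nonneg
  set C₃ := unitIncrement p C₁ C₂
  have C₃_nonneg : 0 ≤ C₃ := by
    unfold C₃ unitIncrement
    positivity
  set K := C₃ + Real.posLog Z + C₁ + 2 * C₂ + 4
  have K_nonneg : 0 ≤ K := by
    have := Real.posLog_nonneg (x := Z)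
    positivity
  set A := Real.exp C₃ * Z * H ^ (4 : ℝ) * t with hA
  set R := Real.exp (-U x) * |f x| ^ q / A with hR
  have log_le : Real.posLog (|f x| ^ q / t) ≤ K * H ^ q + Real.posLog R := by
    have factor : |f x| ^ q / t = Real.exp C₃ * Z * H ^ (4 : ℝ) * Real.exp (U x) * R := by
      rw [hR, hA, Real.exp_neg]
      field_simp
    rw [factor]
    exact Real.posLog_mul.trans
      (add_le_add_left (h.posLog_le hp hq hpq hC (by positivity) hZ x) _)
  have weight_eq : weight p L q U x = boltzmann U x * ENNReal.ofReal (H ^ q) := by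
    rw [weight, boltzmann, ENNReal.ofReal_mul (Real.exp_pos _).le]
  have dyadic := h.boltzmann_mul_posLog_le hp hq hq2 hc hC hf (x := x) (A := A) (by positivity) (by
    rw [hA, mul_right_comm _ Z, mul_assoc _ Z, ENNReal.ofReal_mul (p := _ * _) (by positivity)]
    gcongr
    refine moment_le.trans ?_
    rw [mul_comm Z, ENNReal.ofReal_mul ht.le]
    gcongr)
  calc boltzmann U x * (‖f x‖ₑ ^ q * ENNReal.ofReal (Real.posLog (|f x| ^ q / t)))
      ≤ boltzmann U x * (‖f x‖ₑ ^ q * ENNReal.ofReal (K * H ^ q + Real.posLog R)) := by gcongr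
    _ = ENNReal.ofReal K * (weight p L q U x * ‖f x‖ₑ ^ q) +
          boltzmann U x * ‖f x‖ₑ ^ q * ENNReal.ofReal (Real.posLog R) := by
        rw [ENNReal.ofReal_add (by positivity) Real.posLog_nonneg, ENNReal.ofReal_mul K_nonneg,
          weight_eq]
        ring
    _ ≤ _ := by gcongr

theorem lintegral_boltzmann_mul_posLog_le (h : IsConfining p c₁ C₁ C₂ L U) (hp : 1 ≤ p)
    (hq : 1 ≤ q) (hq2 : q ≤ 2) (hpq : (p - 1) * (q - 1) = 1) (hc : 0 ≤ c₁) (hC : 0 ≤ C₁) {Z : ℝ}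
    (hZ : 0 < Z) (mass_le : ∫⁻ x, boltzmann U x ≤ ENNReal.ofReal Z) {f : Heis → ℝ}
    (hf : Measurable f) {t : ℝ} (ht : 0 < t)
    (moment_le : ∫⁻ x, boltzmann U x * ‖f x‖ₑ ^ q ≤ ENNReal.ofReal t * ∫⁻ x, boltzmann U x) :
    ∫⁻ x, boltzmann U x * (‖f x‖ₑ ^ q * ENNReal.ofReal (Real.posLog (|f x| ^ q / t))) ≤
      ENNReal.ofReal (unitIncrement p C₁ C₂ + Real.posLog Z + C₁ + 2 * C₂ + 4) *
        (∫⁻ x, weight p L q U x * ‖f x‖ₑ ^ q) +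
      ∑' k : ℕ, ENNReal.ofReal (4 * (k + 1) * 16 ^ k) * oscillation p L q U ((1 / 2) ^ k) f := by
  have weight_measurable : Measurable (weight p L q U) := measurable_weight h.measurable
  have kernel_measurable (k : ℕ) : Measurable fun z : Heis × Heis =>
      kernel p L (4 + q) U ((1 / 2) ^ k) z.1 z.2 * ‖f (z.1 ⋆ z.2) - f z.1‖ₑ ^ q :=
    (measurable_kernel h.measurable measurable_fst measurable_snd).mul (measurable_increment hf)
  refine (lintegral_mono (h.boltzmann_mul_posLog_div_le hp hq hq2 hpq hc hC hZ mass_le hf ht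
    moment_le)).trans_eq ?_
  rw [lintegral_add_left (by fun_prop), lintegral_const_mul _ (by fun_prop),
    lintegral_tsum fun k =>
      ((kernel_measurable k).lintegral_prod_right'.const_mul _).aemeasurable]
  simp only [lintegral_const_mul' _ _ ENNReal.ofReal_ne_top, oscillation]

end IsConfining

theorem exists_lintegral_boltzmann_le (hp : 1 ≤ p) (hc : 0 < c₁) (C₂ : ℝ) :
    ∃ Z : ℝ, 0 < Z ∧ ∀ L U, IsConfining p c₁ C₁ C₂ L U →
      ∫⁻ x, boltzmann U x ≤ ENNReal.ofReal Z := by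
  have finite := lintegral_exp_neg_d_mul_lt_top hc 0
  simp only [Real.rpow_zero, mul_one] at finite
  set B := ENNReal.ofReal (Real.exp (2 * C₂)) * ∫⁻ x, ENNReal.ofReal (Real.exp (-(c₁ * d x)))
  have B_ne_top : B ≠ ⊤ := by finiteness
  refine ⟨B.toReal + 1, by positivity, fun L U h => (h.lintegral_boltzmann_le hp hc.le).trans ?_⟩
  exact (ENNReal.ofReal_toReal B_ne_top).ge.trans (ENNReal.ofReal_le_ofReal (by simp))

theorem tsum_scales_ne_top (hq : 0 < q) :
    ∑' k : ℕ, ENNReal.ofReal (4 * (k + 1) * 16 ^ k) * ENNReal.ofReal ((1 / 2) ^ k) ^ (4 + q) ≠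
      ⊤ := by
  set r : ℝ := (1 / 2) ^ q with hr
  have r_norm : ‖r‖ < 1 := by
    rw [Real.norm_of_nonneg (by positivity)]
    exact Real.rpow_lt_one (by norm_num) (by norm_num) hq
  have scales : ∀ k : ℕ,
      ENNReal.ofReal (4 * (k + 1) * 16 ^ k) * ENNReal.ofReal ((1 / 2) ^ k) ^ (4 + q) =
        ENNReal.ofReal (4 * (k ^ 1 * r ^ k + r ^ k)) := fun k => by
    rw [ENNReal.ofReal_rpow_of_pos (by positivity), ← ENNReal.ofReal_mul (by positivity),
      Real.rpow_add (by positivity), Real.rpow_ofNat, ← Real.rpow_natCast_mul (by norm_num) k q,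
      mul_comm (k : ℝ) q, Real.rpow_mul_natCast (by norm_num), ← hr]
    congr 1
    linear_combination 4 * (k + 1) * r ^ k * sixteen_pow_mul_half_pow k
  simp_rw [scales]
  have summable : Summable fun k : ℕ => 4 * ((k : ℝ) ^ 1 * r ^ k + r ^ k) :=
    ((summable_pow_mul_geometric_of_norm_lt_one 1 r_norm).add
      (summable_geometric_of_norm_lt_one r_norm)).mul_left 4
  exact summable.tsum_ofReal_ne_top

theorem exists_entropy_bound (hp : 1 ≤ p) (hq : 1 ≤ q) (hq2 : q ≤ 2)
    (hpq : (p - 1) * (q - 1) = 1) (hc : 0 < c₁) (hC : 0 ≤ C₁) (C₂ : ℝ) :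
    ∃ C ≠ (⊤ : ENNReal), ∀ L U, IsConfining p c₁ C₁ C₂ L U → ∀ f, ContDiff ℝ 1 f → ∃ m : ℝ,
      ∫⁻ x, boltzmann U x * ‖f x - m‖ₑ ^ q ≤ C * gradEnergy q U f ∧
      ∀ t : ℝ, 0 < t →
        ∫⁻ x, boltzmann U x * ‖f x - m‖ₑ ^ q ≤ ENNReal.ofReal t * ∫⁻ x, boltzmann U x →
        ∫⁻ x, boltzmann U x *
            (‖f x - m‖ₑ ^ q * ENNReal.ofReal (Real.posLog (|f x - m| ^ q / t))) ≤
          C * gradEnergy q U f := by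
  obtain ⟨C, C_ne_top, poincare⟩ := exists_weighted_poincare hp hq hc hC C₂
  obtain ⟨D, D_ne_top, oscillation_le⟩ :=
    exists_oscillation_le (C₂ := C₂) (Lam := 1) hp hq hc.le hC zero_le_one
  obtain ⟨Z, Z_pos, mass_le⟩ := exists_lintegral_boltzmann_le (C₁ := C₁) hp hc C₂
  set K := ENNReal.ofReal (unitIncrement p C₁ C₂ + Real.posLog Z + C₁ + 2 * C₂ + 4)
  set T := ∑' k : ℕ, ENNReal.ofReal (4 * (k + 1) * 16 ^ k) * ENNReal.ofReal ((1 / 2) ^ k) ^ (4 + q)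
  have T_ne_top : T ≠ ⊤ := tsum_scales_ne_top (by linarith)
  refine ⟨C + K * C + T * D, by finiteness, fun L U h f hf => ?_⟩
  obtain ⟨m, hm⟩ := poincare L U h f hf
  refine ⟨m, ?_, fun t ht moment_le => ?_⟩
  · refine (lintegral_mono fun x => ?_).trans (hm.trans ?_)
    · rw [← weight_zero (p := p) (L := L)]
      gcongr
      exact h.weight_mono hp (by linarith) x
    · rw [add_assoc]
      exact mul_le_mul_left le_self_add _
  have entropy_le := h.lintegral_boltzmann_mul_posLog_le hp hq hq2 hpq hc.le hC Z_pos
    (mass_le L U h) (hf.continuous.measurable.sub_const m) ht moment_le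
  simp only [oscillation, sub_sub_sub_cancel_right] at entropy_le oscillation_le
  calc _ ≤ _ := entropy_le
    _ ≤ K * (C * gradEnergy q U f) + ∑' k : ℕ, ENNReal.ofReal (4 * (k + 1) * 16 ^ k) *
          (D * ENNReal.ofReal ((1 / 2) ^ k) ^ (4 + q) * gradEnergy q U f) := by
        gcongr with k
        exact oscillation_le L U h f hf _ (by positivity)
          (pow_le_one₀ (by norm_num) (by norm_num))
    _ = (K * C + T * D) * gradEnergy q U f := by
        rw [add_mul, mul_assoc, ← ENNReal.tsum_mul_right, ← ENNReal.tsum_mul_right]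
        congr! 3
        ring
    _ ≤ _ := by
        rw [add_assoc]
        exact mul_le_mul_left le_add_self _

end Entropy

/-- The logarithmic Sobolev inequality `μ(|f|^q log (|f|^q / μ|f|^q)) ≤ c μ(|∇ f|^q)` for all
`f` of class `C¹` with finite right-hand side. The integrability clauses exclude the junk value
`0` of the integrals. -/
def SatisfiesLogSobolev (q c : ℝ) (μ : Measure Heis) : Prop :=
  ∀ f : Heis → ℝ, ContDiff ℝ 1 f → Integrable (fun x => gradNorm f x ^ q) μ →
    Integrable (fun x => |f x| ^ q) μ ∧
    Integrable (fun x => |f x| ^ q * Real.log (|f x| ^ q / ∫ y, |f y| ^ q ∂μ)) μ ∧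
    ∫ x, |f x| ^ q * Real.log (|f x| ^ q / ∫ y, |f y| ^ q ∂μ) ∂μ ≤ c * ∫ x, gradNorm f x ^ q ∂μ

theorem integrable_exp_neg {U : Heis → ℝ} (hU : Measurable U) (hZ : ∫⁻ x, boltzmann U x ≠ ⊤) :
    Integrable fun x => Real.exp (-U x) := by
  refine ⟨by fun_prop, ?_⟩
  rw [hasFiniteIntegral_iff_ofReal (.of_forall fun x => (Real.exp_pos _).le)]
  exact hZ.lt_top

theorem lintegral_boltzmann_mul {U : Heis → ℝ} (hU : Measurable U)
    (hZ : ∫⁻ x, boltzmann U x ≠ ⊤) (g : Heis → ENNReal) :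
    ∫⁻ x, boltzmann U x * g x =
      (∫⁻ x, boltzmann U x) * ∫⁻ x, g x ∂volume.tilted fun x => -U x := by
  have exp_int := integrable_exp_neg hU hZ
  rw [lintegral_tilted, ← lintegral_const_mul' _ _ hZ]
  congr! 2 with x
  rw [← mul_assoc]
  unfold boltzmann
  rw [← ofReal_integral_eq_lintegral_ofReal exp_int (.of_forall fun x => (Real.exp_pos _).le),
    ← ENNReal.ofReal_mul (integral_exp_pos exp_int).le,
    mul_div_cancel₀ _ (integral_exp_pos exp_int).ne']

theorem lintegral_boltzmann_ne_zero {U : Heis → ℝ} (hU : Measurable U) :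
    ∫⁻ x, boltzmann U x ≠ 0 := by
  rw [ne_eq, lintegral_eq_zero_iff (measurable_boltzmann hU)]
  intro vanishes
  obtain ⟨x, hx⟩ := vanishes.exists
  exact (ENNReal.ofReal_pos.2 (Real.exp_pos _)).ne' hx

theorem gradEnergy_eq {q : ℝ} {U f : Heis → ℝ} (hq : 0 ≤ q) (hU : Measurable U)
    (hZ : ∫⁻ x, boltzmann U x ≠ ⊤)
    (hf : Integrable (fun x => gradNorm f x ^ q) (volume.tilted fun x => -U x)) :
    gradEnergy q U f = (∫⁻ x, boltzmann U x) *
      ENNReal.ofReal (∫ x, gradNorm f x ^ q ∂volume.tilted fun x => -U x) := by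
  rw [gradEnergy, lintegral_boltzmann_mul hU hZ, ofReal_integral_eq_lintegral_ofReal hf
    (.of_forall fun x => Real.rpow_nonneg (gradNorm_nonneg f x) q)]
  congr! 3 with x
  rw [Real.enorm_of_nonneg (gradNorm_nonneg f _),
    ENNReal.ofReal_rpow_of_nonneg (gradNorm_nonneg f _) hq]

theorem exists_logSobolev {p q c₁ C₁ : ℝ} (hp : 1 ≤ p) (hq : 1 ≤ q) (hq2 : q ≤ 2)
    (hpq : (p - 1) * (q - 1) = 1) (hc : 0 < c₁) (hC : 0 ≤ C₁) (C₂ : ℝ) :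
    ∃ c : ℝ, 0 < c ∧ ∀ L U, IsConfining p c₁ C₁ C₂ L U →
      IsProbabilityMeasure (volume.tilted fun x => -U x) ∧
      SatisfiesLogSobolev q c (volume.tilted fun x => -U x) := by
  have q_pos : 0 < q := by linarith
  obtain ⟨C, C_ne_top, entropy_bound⟩ := exists_entropy_bound hp hq hq2 hpq hc hC C₂
  refine ⟨27 * C.toReal + 1, by positivity, fun L U h => ?_⟩
  have mass_ne_top : ∫⁻ x, boltzmann U x ≠ ⊤ := by
    rw [← weight_zero (p := p) (L := L)]
    exact (h.lintegral_weight_lt_top hp le_rfl hc).ne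
  have mass_ne_zero := lintegral_boltzmann_ne_zero h.measurable
  set μ : Measure Heis := volume.tilted fun x => -U x
  have prob : IsProbabilityMeasure μ :=
    isProbabilityMeasure_tilted (integrable_exp_neg h.measurable mass_ne_top)
  refine ⟨prob, fun f hf grad_int => ?_⟩
  have grad_nonneg : 0 ≤ ∫ x, gradNorm f x ^ q ∂μ :=
    integral_nonneg fun x => Real.rpow_nonneg (gradNorm_nonneg f x) q
  set A := C.toReal * ∫ x, gradNorm f x ^ q ∂μ with hA
  have A_nonneg : 0 ≤ A := mul_nonneg ENNReal.toReal_nonneg grad_nonneg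
  have energy_eq : C * gradEnergy q U f = (∫⁻ x, boltzmann U x) * ENNReal.ofReal A := by
    rw [gradEnergy_eq q_pos.le h.measurable mass_ne_top grad_int, mul_left_comm, hA,
      ENNReal.ofReal_mul ENNReal.toReal_nonneg, ENNReal.ofReal_toReal C_ne_top]
  obtain ⟨m, moment_le, posLog_le⟩ := entropy_bound L U h f hf
  simp only [energy_eq, lintegral_boltzmann_mul h.measurable mass_ne_top,
    ENNReal.mul_le_mul_iff_right mass_ne_zero mass_ne_top] at moment_le posLog_le
  have entropy_le (δ : ℝ) (hδ : 0 < δ) := entropy_le_of_centered hf.continuous.measurable q_pos hq2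
    (by positivity : 0 < A + δ) A_nonneg moment_le (posLog_le (A + δ) (by positivity) (by
      rw [mul_comm]
      gcongr
      exact moment_le.trans (ENNReal.ofReal_le_ofReal (by linarith))))
  refine ⟨(entropy_le 1 one_pos).1, (entropy_le 1 one_pos).2.1,
    le_of_forall_pos_le_add fun δ hδ => ?_⟩
  have := (entropy_le (δ / 9) (by positivity)).2.2
  linarith

theorem exists_isConfining {p α K c₀ : ℝ} (hp : 2 ≤ p) (hα : 0 < α) (hK : 0 ≤ K)
    (hc₀ : p = 2 → 0 < c₀) (b : ℝ) :
    ∃ c₁ C₁ C₂ : ℝ, 0 < c₁ ∧ 0 ≤ C₁ ∧ ∀ κ L : ℝ, |κ| ≤ K → (p = 2 → c₀ ≤ α + κ) →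
      0 ≤ L → ∀ B : Heis → ℝ, Measurable B → (∀ x, |B x| ≤ b) →
      IsConfining p c₁ C₁ C₂ L fun x => α * d x ^ p + κ * d x ^ 2 + L * d x + B x := by
  obtain ⟨c, C, c_pos, c_le_one, radial_lower⟩ := exists_radial_lower hp hα hK hc₀
  refine ⟨c, α * p + 2 * K + 1, max C 0 + 2 * b, c_pos, by positivity,
    fun κ L hκ hκ₀ hL B hB B_le => ⟨by fun_prop, hL, ?_, fun x y hxy => ?_, fun x y hxy => ?_⟩⟩
  · rw [d_zero, Real.zero_rpow (by linarith)]
    norm_num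
    linarith [B_le 0, abs_nonneg (B 0), le_max_right C 0]
  · have radial := radial_upper hp hα.le hκ (d_nonneg y) hxy
    have linear_nonneg : 0 ≤ L * (d x - d y) := mul_nonneg hL (by linarith)
    have slope_nonneg : 0 ≤ (1 + d x) ^ (p - 1) * (d x - d y) :=
      mul_nonneg (Real.rpow_nonneg (by linarith [d_nonneg x]) _) (by linarith)
    have extra_nonneg : 0 ≤ (α * p + 2 * K) * (L * (d x - d y)) := by positivity
    unfold rate
    linarith [(abs_le.1 (B_le x)).2, (abs_le.1 (B_le y)).1, le_max_right C 0]
  · have radial := radial_lower κ hκ hκ₀ (d y) (d x) (d_nonneg y) hxy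
    have linear_le : c * (L * (d x - d y)) ≤ L * (d x - d y) :=
      mul_le_of_le_one_left (mul_nonneg hL (by linarith)) c_le_one
    unfold rate
    linarith [(abs_le.1 (B_le x)).1, (abs_le.1 (B_le y)).2, le_max_left C 0]

end Heis

/-! ### The single-site measures -/

namespace Site

variable {N : ℕ} {i j : Site N}

theorem exists_eq_add_single (h : dist1 i j = 1) :
    ∃ (l : Fin N) (u : ℤˣ), j = i + Pi.single l (u : ℤ) := by
  obtain ⟨l, hl⟩ : ∃ l, i l ≠ j l := by
    by_contra! same
    simp [dist1, same] at h
  have distance_pos : 1 ≤ |i l - j l| := Int.one_le_abs (sub_ne_zero.2 hl)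
  have split : |i l - j l| + ∑ k ∈ Finset.univ.erase l, |i k - j k| = 1 := by
    rw [← h, dist1, Finset.add_sum_erase _ (fun k => |i k - j k|) (Finset.mem_univ l)]
  have rest_nonneg : 0 ≤ ∑ k ∈ Finset.univ.erase l, |i k - j k| :=
    Finset.sum_nonneg fun _ _ => abs_nonneg _
  have unit : IsUnit (j l - i l) := by
    rw [Int.isUnit_iff_abs_eq, abs_sub_comm]
    omega
  refine ⟨l, unit.unit, funext fun k => ?_⟩
  rcases eq_or_ne k l with rfl | hk
  · simp
  · have same : |i k - j k| ≤ ∑ k ∈ Finset.univ.erase l, |i k - j k| :=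
      Finset.single_le_sum (f := fun k => |i k - j k|) (fun _ _ => abs_nonneg _)
        (Finset.mem_erase.2 ⟨hk, Finset.mem_univ k⟩)
    have := abs_nonneg (i k - j k)
    simp only [Pi.add_apply, Pi.single_eq_of_ne hk]
    grind

theorem card_neighbors_le (i : Site N) : (neighbors i).card ≤ 2 * N := by
  have neighbors_subset : neighbors i ⊆ (Finset.univ : Finset (Fin N × ℤˣ)).image
      fun z => i + Pi.single z.1 (z.2 : ℤ) := fun j hj => by
    obtain ⟨l, u, rfl⟩ := exists_eq_add_single (mem_neighbors.1 hj)
    exact Finset.mem_image.2 ⟨(l, u), Finset.mem_univ _, rfl⟩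
  refine (Finset.card_le_card neighbors_subset).trans (Finset.card_image_le.trans_eq ?_)
  rw [Finset.card_univ, Fintype.card_prod, Fintype.card_fin, Fintype.card_units_int, mul_comm]

end Site

namespace Config

variable {N : ℕ} {p q α ε ρ θ M : ℝ} {φ : Sym2 (Site N) → Config N → ℝ}

theorem siteGradNorm_glue (i : Site N) (f : Config N → ℝ) (x : Heis) (ω : Config N) :
    siteGradNorm i f (glue i x ω) = Heis.gradNorm (fun y => f (glue i y ω)) x := by
  simp [siteGradNorm, siteDeriv, Heis.gradNorm, glue]

theorem energy_eq (i : Site N) (ω : Config N) (x : Heis) :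
    energy α p ε ρ θ φ i ω x =
      (α * Heis.d x ^ p + ε * (Site.neighbors i).card * Heis.d x ^ 2 +
        2 * (ε * ρ) * (∑ j ∈ Site.neighbors i, Heis.d (ω j)) * Heis.d x +
        θ * ∑ j ∈ Site.neighbors i, φ s(i, j) (glue i x ω)) +
      ε * ∑ j ∈ Site.neighbors i, (ρ * Heis.d (ω j)) ^ 2 := by
  have expand : ∑ j ∈ Site.neighbors i, (Heis.d x + ρ * Heis.d (ω j)) ^ 2 =
      (Site.neighbors i).card * Heis.d x ^ 2 +
      2 * ρ * Heis.d x * ∑ j ∈ Site.neighbors i, Heis.d (ω j) +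
      ∑ j ∈ Site.neighbors i, (ρ * Heis.d (ω j)) ^ 2 := by
    rw [Finset.mul_sum, ← nsmul_eq_mul, ← Finset.sum_const, ← Finset.sum_add_distrib,
      ← Finset.sum_add_distrib]
    exact Finset.sum_congr rfl fun j _ => by ring
  rw [energy, expand]
  ring

theorem abs_sum_neighbors_le (hφ : ∀ i j, Site.dist1 i j = 1 → ∀ ω, |φ s(i, j) ω| ≤ M)
    (i : Site N) (ω : Config N) :
    |∑ j ∈ Site.neighbors i, φ s(i, j) ω| ≤ 2 * N * |M| := by
  have card_le : ((Site.neighbors i).card : ℝ) ≤ 2 * N := by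
    exact_mod_cast Site.card_neighbors_le i
  calc |∑ j ∈ Site.neighbors i, φ s(i, j) ω|
      ≤ ∑ j ∈ Site.neighbors i, |φ s(i, j) ω| := Finset.abs_sum_le_sum_abs _ _
    _ ≤ ∑ _j ∈ Site.neighbors i, |M| := Finset.sum_le_sum fun j hj =>
        (hφ i j (Site.mem_neighbors.1 hj) ω).trans (le_abs_self M)
    _ = (Site.neighbors i).card * |M| := by rw [Finset.sum_const, nsmul_eq_mul]
    _ ≤ 2 * N * |M| := by gcongr

theorem exists_isConfining_energy
    (hφ_meas : ∀ i j, Site.dist1 i j = 1 → ∀ ω, Measurable fun x => φ s(i, j) (glue i x ω))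
    (hφ : ∀ i j, Site.dist1 i j = 1 → ∀ ω, |φ s(i, j) ω| ≤ M) (hp : 2 ≤ p) (hα : 0 < α)
    (hερ : 0 ≤ ε * ρ) (hε : p = 2 → 0 < α + 2 * N * ε) :
    ∃ c₁ C₁ C₂ : ℝ, 0 < c₁ ∧ 0 ≤ C₁ ∧ ∀ (i : Site N) (ω : Config N), ∃ L a : ℝ,
      Heis.IsConfining p c₁ C₁ C₂ L fun x => energy α p ε ρ θ φ i ω x - a := by
  have leading_pos (h : p = 2) : 0 < α + min 0 (2 * N * ε) := by
    rcases min_choice 0 (2 * N * ε) with h' | h' <;> rw [h']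
    · rwa [add_zero]
    · exact hε h
  obtain ⟨c₁, C₁, C₂, hc₁, hC₁, confining⟩ := Heis.exists_isConfining hp hα
    (K := |ε| * (2 * N)) (by positivity) leading_pos (|θ| * (2 * N * |M|))
  refine ⟨c₁, C₁, C₂, hc₁, hC₁, fun i ω =>
    ⟨2 * (ε * ρ) * ∑ j ∈ Site.neighbors i, Heis.d (ω j),
      ε * ∑ j ∈ Site.neighbors i, (ρ * Heis.d (ω j)) ^ 2, ?_⟩⟩
  have card_le : ((Site.neighbors i).card : ℝ) ≤ 2 * N := by
    exact_mod_cast Site.card_neighbors_le i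
  simp only [energy_eq, add_sub_cancel_right]
  refine confining _ _ ?_ (fun _ => ?_) ?_ _ ?_ fun x => ?_
  · rw [abs_mul, Nat.abs_cast]
    gcongr
  · gcongr
    rcases le_total 0 ε with h | h
    · exact (min_le_left _ _).trans (by positivity)
    · exact (min_le_right _ _).trans (by nlinarith)
  · have := Finset.sum_nonneg fun j (_ : j ∈ Site.neighbors i) => Heis.d_nonneg (ω j)
    positivity
  · exact (Finset.measurable_sum _ fun j hj =>
      hφ_meas i j (Site.mem_neighbors.1 hj) ω).const_mul θ
  · rw [abs_mul]
    gcongr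
    exact abs_sum_neighbors_le hφ i _

end Config

theorem theorem4p1_general {N : ℕ} {p q α ε ρ θ M : ℝ} {φ : Sym2 (Site N) → Config N → ℝ}
    (hφ_meas : ∀ i j, Site.dist1 i j = 1 →
      ∀ ω, Measurable fun x => φ s(i, j) (Config.glue i x ω))
    (hφ : ∀ i j, Site.dist1 i j = 1 → ∀ ω, |φ s(i, j) ω| ≤ M)
    (hp : 2 ≤ p) (hpq : 1 / p + 1 / q = 1) (hα : 0 < α) (hερ : 0 ≤ ε * ρ)
    (hε : p = 2 → 0 < α + 2 * N * ε) :
    ∃ c : ℝ, 0 < c ∧ ∀ (i : Site N) (ω : Config N),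
      IsProbabilityMeasure (Config.siteMeasure α p ε ρ θ φ i ω) ∧
      Heis.SatisfiesLogSobolev q c (Config.siteMeasure α p ε ρ θ φ i ω) := by
  have conjugate : p.HolderConjugate q :=
    Real.holderConjugate_iff.2 ⟨by linarith, by simpa only [one_div] using hpq⟩
  have sub_one_mul_sub_one : (p - 1) * (q - 1) = 1 := by
    linear_combination conjugate.mul_eq_add
  have q_le_two : q ≤ 2 := by nlinarith [conjugate.symm.lt]
  obtain ⟨c₁, C₁, C₂, hc₁, hC₁, confining⟩ :=
    Config.exists_isConfining_energy (θ := θ) hφ_meas hφ hp hα hερ hε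
  obtain ⟨c, c_pos, logSobolev⟩ := Heis.exists_logSobolev (by linarith : 1 ≤ p)
    conjugate.symm.lt.le q_le_two sub_one_mul_sub_one hc₁ hC₁ C₂
  refine ⟨c, c_pos, fun i ω => ?_⟩
  obtain ⟨L, a, h⟩ := confining i ω
  have shift : Config.siteMeasure α p ε ρ θ φ i ω =
      volume.tilted fun x => -(Config.energy α p ε ρ θ φ i ω x - a) := by
    simp only [neg_sub', sub_neg_eq_add, tilted_add_const, Config.siteMeasure]
  rw [shift]
  exact logSobolev L _ h

end

theorem theorem4p1 (N : ℕ) (hN : 1 ≤ N) (p q α ε ρ θ : ℝ)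
    (φ : Sym2 (Site N) → Config N → ℝ) (hφ : Config.IsBoundedPotential φ)
    (hp : 2 ≤ p) (hpq : 1 / p + 1 / q = 1) (hα : 0 < α) (hερ : 0 < ε * ρ)
    (hε : p = 2 → -(α / (2 * (N : ℝ))) < ε) :
    ∃ c : ℝ, 0 < c ∧ ∀ (i : Site N) (ω : Config N),
      IsProbabilityMeasure (Config.siteMeasure α p ε ρ θ φ i ω) ∧
      ∀ f : Config N → ℝ, Config.IsC ((⊤ : ℕ∞) : WithTop ℕ∞) f →
        -- if `E_i^ω(|∇ᵢ f|^q) = ∞` there is nothing to prove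
        Integrable (fun x => Config.siteGradNorm i f (Config.glue i x ω) ^ q)
          (Config.siteMeasure α p ε ρ θ φ i ω) →
        Integrable (fun x => |f (Config.glue i x ω)| ^ q)
          (Config.siteMeasure α p ε ρ θ φ i ω) ∧
        Integrable (fun x => |f (Config.glue i x ω)| ^ q *
            Real.log (|f (Config.glue i x ω)| ^ q /
              ∫ y, |f (Config.glue i y ω)| ^ q ∂(Config.siteMeasure α p ε ρ θ φ i ω)))
          (Config.siteMeasure α p ε ρ θ φ i ω) ∧
        ∫ x, |f (Config.glue i x ω)| ^ q *
            Real.log (|f (Config.glue i x ω)| ^ q /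
              ∫ y, |f (Config.glue i y ω)| ^ q ∂(Config.siteMeasure α p ε ρ θ φ i ω))
          ∂(Config.siteMeasure α p ε ρ θ φ i ω)
        ≤ c * ∫ x, Config.siteGradNorm i f (Config.glue i x ω) ^ q
          ∂(Config.siteMeasure α p ε ρ θ φ i ω) := by
  obtain ⟨M, -, hM⟩ := hφ
  have leading_pos (h : p = 2) : 0 < α + 2 * N * ε := by
    have hN' : (0 : ℝ) < 2 * N := by positivity
    linarith [(lt_div_iff₀' hN').1 (neg_lt.1 (hε h))]
  obtain ⟨c, c_pos, h⟩ := theorem4p1_general (θ := θ)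
    (fun i j hij ω => ((hM i j hij).1 i ω).continuous.measurable)
    (fun i j hij => (hM i j hij).2.2.1) hp hpq hα hερ.le leading_pos
  refine ⟨c, c_pos, fun i ω => ⟨(h i ω).1, fun f hf grad_int => ?_⟩⟩
  simp only [Config.siteGradNorm_glue] at grad_int ⊢
  exact (h i ω).2 _ ((hf i ω).of_le (by exact_mod_cast le_top)) grad_int
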